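/- Let $\mathbb F$ be a field. A set-multilinear depth-3 circuit with top fan-in $k$ in the variables $x_1,\dots,x_n$ is an expression $\sum_{i=1}^k a_i\prod_{j=1}^d \ell_{ij}$ for which there is a partition of $\{x_1,\dots,x_n\}$ into $d$ nonempty colors such that every $\ell_{ij}$ is a linear polynomial $b_0+\sum_r b_r x_r$ over $\mathbb F$ that involves only variables of the $j$-th color; the partition is the same for all $k$ products. Time is measured on a random access machine whose memory holds natural numbers and elements of $\mathbb F$, and which performs in one time step an addition, (truncated) subtraction or zero test of natural numbers, or an addition, subtraction, multiplication, inversion or zero test of elements of $\mathbb F$; the circuits are given to it by $n$, $c$, $k$, the numbers $d$ and all the coefficients $a_i$ and $b_r$. **Theorem.** There are a whitebox algorithm (one program, for all fields and all inputs) and an absolute constant in the $O(\cdot)$ below such that, for every field $\mathbb F$ and all integers $n\ge 2$, $c\ge 1$, $k\ge 1$, the following holds. Let $C(\mathbf x)$ be an $n$-variate polynomial given as a sum of $c$ set-multilinear depth-3 circuits over $\mathbb F$, each with top fan-in $k$ (each circuit may have its own partition). Given these circuits, the algorithm decides whether $C$ is the zero polynomial in time $$(nck)^{O(2^{c-1}\,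 n^{1-\epsilon}\log n)},\qquad \epsilon := \frac1{2^{c-1}} .$$ In particular, for constant $c$ and $k$ polynomially bounded in $n$ this time is subexponential, that is, $2^{o(n)}$. -/

import Mathlib

/-! ### Depth-3 circuits -/

/-- A depth-3 (sum-product-sum) circuit in `n` variables with top fan-in `k`, each of whose
product gates multiplies `d` linear polynomials.  The `j`-th factor of the `i`-th product gate is
`const i j + ∑ r, coeff i j r * x_r`, and `top i` is the scalar with which the `i`-th product gate
enters the top sum. -/
structure Depth3Circuit (F : Type*) (n k : ℕ) where
  d : ℕ
  top : Fin k → F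
  const : Fin k → Fin d → F
  coeff : Fin k → Fin d → Fin n → F

namespace Depth3Circuit

variable {F : Type*} {n k : ℕ}

/-- The linear polynomial that is the `j`-th factor of the `i`-th product gate. -/
noncomputable def factor [Field F] (C : Depth3Circuit F n k) (i : Fin k) (j : Fin C.d) :
    MvPolynomial (Fin n) F :=
  MvPolynomial.C (C.const i j) + ∑ r, MvPolynomial.C (C.coeff i j r) * MvPolynomial.X r

/-- The polynomial computed by the circuit. -/
noncomputable def poly [Field F] (C : Depth3Circuit F n k) : MvPolynomial (Fin n) F :=
  ∑ i, MvPolynomial.C (C.top i) * ∏ j, C.factor i j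

/-- The circuit is set-multilinear: there is one partition of the variables into `d` (nonempty)
colors, common to all product gates, such that the `j`-th factor of every product gate involves
only variables of the `j`-th color. -/
def IsSetMultilinear [Field F] (C : Depth3Circuit F n k) : Prop :=
  ∃ color : Fin n → Fin C.d, Function.Surjective color ∧
    ∀ i j r, C.coeff i j r ≠ 0 → color r = j

end Depth3Circuit

/-! ### Random access machines over a field

A machine has natural-number cells and field cells.  A cell is addressed by an array name and a
finite list of natural-number subscripts; a scalar variable is an array cell with no subscripts.
Natural numbers can only be added, subtracted and compared with zero; field elements can be added,
subtracted, multiplied, inverted and compared with zero.  Each operation and each test takes one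
unit of time.  A program does not mention the field, so the same program runs over every field. -/

/-- A reference to a cell in a program: an array name together with subscripts, each of which is
(the name of) a scalar natural-number variable. -/
structure Ref where
  name : ℕ
  subs : List ℕ

/-- The contents of the memory: a natural-number and a field element for each address. -/
structure Memory (F : Type*) where
  nat : ℕ × List ℕ → ℕ
  fld : ℕ × List ℕ → F

namespace Memory

variable {F : Type*}

/-- The address to which a reference points, given the current contents of the memory. -/
def addr (σ : Memory F) (x : Ref) : ℕ × List ℕ :=
  (x.name, x.subs.map fun v => σ.nat (v, []))

/-- The natural number in the cell `x`. -/
def getNat (σ : Memory F) (x : Ref) : ℕ := σ.nat (σ.addr x)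

/-- The field element in the cell `x`. -/
def getFld (σ : Memory F) (x : Ref) : F := σ.fld (σ.addr x)

/-- Write a natural number into the cell `x`. -/
def setNat (σ : Memory F) (x : Ref) (v : ℕ) : Memory F :=
  { σ with nat := Function.update σ.nat (σ.addr x) v }

/-- Write a field element into the cell `x`. -/
def setFld (σ : Memory F) (x : Ref) (v : F) : Memory F :=
  { σ with fld := Function.update σ.fld (σ.addr x) v }

end Memory

/-- Programs.  In each assignment the first reference is the target. -/
inductive Prog where
  | skip : Prog
  | natConst (x : Ref) (m : ℕ) : Prog
  | natAdd (x y z : Ref) : Prog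
  | natSub (x y z : Ref) : Prog
  | fldZero (x : Ref) : Prog
  | fldOne (x : Ref) : Prog
  | fldAdd (x y z : Ref) : Prog
  | fldSub (x y z : Ref) : Prog
  | fldMul (x y z : Ref) : Prog
  | fldInv (x y : Ref) : Prog
  | seq (P Q : Prog) : Prog
  | ifNatZero (x : Ref) (P Q : Prog) : Prog
  | ifFldZero (x : Ref) (P Q : Prog) : Prog
  | whileNatNonzero (x : Ref) (P : Prog) : Prog

/-- `Run P σ t τ`: started on the memory `σ`, the program `P` halts after exactly `t` time steps
with the memory `τ`.  (Subtraction of natural numbers is truncated, the inverse of `0` is `0`.) -/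
inductive Run {F : Type*} [Field F] : Prog → Memory F → ℕ → Memory F → Prop where
  | skip (σ) : Run .skip σ 1 σ
  | natConst (σ x m) : Run (.natConst x m) σ 1 (σ.setNat x m)
  | natAdd (σ x y z) : Run (.natAdd x y z) σ 1 (σ.setNat x (σ.getNat y + σ.getNat z))
  | natSub (σ x y z) : Run (.natSub x y z) σ 1 (σ.setNat x (σ.getNat y - σ.getNat z))
  | fldZero (σ x) : Run (.fldZero x) σ 1 (σ.setFld x 0)
  | fldOne (σ x) : Run (.fldOne x) σ 1 (σ.setFld x 1)
  | fldAdd (σ x y z) : Run (.fldAdd x y z) σ 1 (σ.setFld x (σ.getFld y + σ.getFld z))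
  | fldSub (σ x y z) : Run (.fldSub x y z) σ 1 (σ.setFld x (σ.getFld y - σ.getFld z))
  | fldMul (σ x y z) : Run (.fldMul x y z) σ 1 (σ.setFld x (σ.getFld y * σ.getFld z))
  | fldInv (σ x y) : Run (.fldInv x y) σ 1 (σ.setFld x (σ.getFld y)⁻¹)
  | seq {P Q σ τ ρ s t} : Run P σ s τ → Run Q τ t ρ → Run (.seq P Q) σ (s + t) ρ
  | ifNatZero_true {x P Q σ τ t} :
      σ.getNat x = 0 → Run P σ t τ → Run (.ifNatZero x P Q) σ (t + 1) τ
  | ifNatZero_false {x P Q σ τ t} :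
      σ.getNat x ≠ 0 → Run Q σ t τ → Run (.ifNatZero x P Q) σ (t + 1) τ
  | ifFldZero_true {x P Q σ τ t} :
      σ.getFld x = 0 → Run P σ t τ → Run (.ifFldZero x P Q) σ (t + 1) τ
  | ifFldZero_false {x P Q σ τ t} :
      σ.getFld x ≠ 0 → Run Q σ t τ → Run (.ifFldZero x P Q) σ (t + 1) τ
  | while_done {x P σ} :
      σ.getNat x = 0 → Run (.whileNatNonzero x P) σ 1 σ
  | while_step {x P σ τ ρ s t} :
      σ.getNat x ≠ 0 → Run P σ s τ → Run (.whileNatNonzero x P) τ t ρ →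
        Run (.whileNatNonzero x P) σ (s + t + 1) ρ

/-- Machines are deterministic: the running time and the final memory are determined by the
program and the initial memory. -/
theorem Run.deterministic {F : Type*} [Field F] {P : Prog} {σ τ τ' : Memory F} {t t' : ℕ}
    (h : Run P σ t τ) (h' : Run P σ t' τ') : t = t' ∧ τ = τ' := by
  induction h generalizing t' τ' with
  | seq _ _ ih₁ ih₂ =>
    cases h' with
    | seq a b =>
      obtain ⟨rfl, rfl⟩ := ih₁ a
      obtain ⟨rfl, rfl⟩ := ih₂ b
      exact ⟨rfl, rfl⟩
  | ifNatZero_true hx _ ih =>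
    cases h' with
    | ifNatZero_true _ a => obtain ⟨rfl, rfl⟩ := ih a; exact ⟨rfl, rfl⟩
    | ifNatZero_false hx' _ => exact absurd hx hx'
  | ifNatZero_false hx _ ih =>
    cases h' with
    | ifNatZero_true hx' _ => exact absurd hx' hx
    | ifNatZero_false _ a => obtain ⟨rfl, rfl⟩ := ih a; exact ⟨rfl, rfl⟩
  | ifFldZero_true hx _ ih =>
    cases h' with
    | ifFldZero_true _ a => obtain ⟨rfl, rfl⟩ := ih a; exact ⟨rfl, rfl⟩
    | ifFldZero_false hx' _ => exact absurd hx hx'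
  | ifFldZero_false hx _ ih =>
    cases h' with
    | ifFldZero_true hx' _ => exact absurd hx' hx
    | ifFldZero_false _ a => obtain ⟨rfl, rfl⟩ := ih a; exact ⟨rfl, rfl⟩
  | while_done hx =>
    cases h' with
    | while_done _ => exact ⟨rfl, rfl⟩
    | while_step hx' _ _ => exact absurd hx hx'
  | while_step hx _ _ ih₁ ih₂ =>
    cases h' with
    | while_done hx' => exact absurd hx' hx
    | while_step _ a b =>
      obtain ⟨rfl, rfl⟩ := ih₁ a
      obtain ⟨rfl, rfl⟩ := ih₂ b
      exact ⟨rfl, rfl⟩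
  | _ => cases h'; exact ⟨rfl, rfl⟩

/-- The initial memory on input `C`, a list of `c` depth-3 circuits in `n` variables with top
fan-in `k`.  The scalar variables `1`, `2`, `3` hold `n`, `c`, `k`, and the natural-number array
`4` holds the number of factors of the product gates of each circuit; the field arrays `0`, `1`,
`2` hold the scalars `top`, `const`, `coeff` of the circuits.  All other cells hold `0`. -/
def inputMemory {F : Type*} [Field F] {n c k : ℕ} (C : Fin c → Depth3Circuit F n k) :
    Memory F where
  nat := fun a =>
    match a with
    | (1, []) => n
    | (2, []) => c
    | (3, []) => k
    | (4, [s]) => if hs : s < c then (C ⟨s, hs⟩).d else 0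
    | _ => 0
  fld := fun a =>
    match a with
    | (0, [s, i]) =>
      if hs : s < c then if hi : i < k then (C ⟨s, hs⟩).top ⟨i, hi⟩ else 0 else 0
    | (1, [s, i, j]) =>
      if hs : s < c then if hi : i < k then if hj : j < (C ⟨s, hs⟩).d then
        (C ⟨s, hs⟩).const ⟨i, hi⟩ ⟨j, hj⟩ else 0 else 0 else 0
    | (2, [s, i, j, r]) =>
      if hs : s < c then if hi : i < k then if hj : j < (C ⟨s, hs⟩).d then if hr : r < n then
        (C ⟨s, hs⟩).coeff ⟨i, hi⟩ ⟨j, hj⟩ ⟨r, hr⟩ else 0 else 0 else 0 else 0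
    | _ => 0

/-- The output of a computation: the final value of the scalar variable `0`. -/
def Memory.output {F : Type*} (σ : Memory F) : ℕ := σ.nat (0, [])

/-- The quantity `(n c k) ^ (K * 2 ^ (c - 1) * n ^ (1 - ε) * log n)`, where
`ε = 1 / 2 ^ (c - 1)` (used for `c ≥ 1` only). -/
noncomputable def timeBound (K : ℝ) (n c k : ℕ) : ℝ :=
  ((n : ℝ) * c * k) ^
    (K * 2 ^ (c - 1) * (n : ℝ) ^ (1 - 1 / 2 ^ (c - 1) : ℝ) * Real.logb 2 n)

/-! The test substitutes a power of a single variable for every `x_r` and tries all exponent vectors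
from a small explicit family, one of which keeps a nonzero sum nonzero.

Isolation on one base set. Let B be a set of variables on which every one of the c colorings is
constant, injective, or compatible with one common order. Every interval of that order splits at
most two color classes per circuit (`IsCompatible.card_split_le`). Hence the coefficients of a
product gate, seen as a polynomial in the variables inside the interval, span at most 2^2
dimensions, and those of the whole sum at most 4ck (`partialRankLE_evalSum`). As for read-once
branching programs of width 4ck, a weight isolating one nonzero monomial is built along dyadic
intervals: products of the basis monomials of two halves span for the union, a new weight separates
these few candidates, and a greedy choice leaves again at most 4ck of them (`exists_isWeightBasis`,
`exists_isolated`). The weights are residues of 2^r modulo a P polynomial in n, c, k. A suitable P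
exists because a nonzero integer divisible by all P ≤ 2h is at least 2^h in absolute value
(`exists_modulus_separating`).

Covering. Sorting the variables by their last color makes that coloring monotone, so only the other
q = c - 1 colorings must become constant or injective. Passing repeatedly to a large color class, or
to the elements of a fixed index in their classes, covers the variables by at most 2^q n / b sets,
where b is about n^(1/2^q) (`exists_cover`).

Assembly. The base sets are treated one after another, each with a new indeterminate over the field
reached so far (`exists_substitution`). As the exponents are bounded, the indeterminates merge into
one by using the exponents as digits in a large base (`exists_coeff_evalSum_ne_zero`). All choices
of base sets and moduli are the digits of one number below U = X^(m(q+l)), where X = (8nck)^4, m is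
the number of base sets and l = O(log n) (`exists_code`).

The program reads the colors off the nonzero coefficients, runs through all codes, and computes the
coefficients below U of each resulting univariate polynomial. The zero polynomial never yields a
nonzero coefficient. The total time is at most U^7, and m(q+l) = O(2^q n^(1-ε) log n)
(`digitCount_le`). -/

/-! ### Residues of powers of two as weights -/

/-- A representative of `2 ^ r` modulo `P`, computed by repeated doubling. -/
def powResidue (P : ℕ) : ℕ → ℕ
  | 0 => 1
  | r + 1 => if P ≤ powResidue P r + powResidue P r then
      powResidue P r + powResidue P r - P else powResidue P r + powResidue P r

/-- Strict inequality fails for `P = 1`, where the representative stays 1. -/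
theorem powResidue_le {P : ℕ} (hP : 1 ≤ P) (r : ℕ) : powResidue P r ≤ P := by
  induction r with
  | zero => exact hP
  | succ r ih => rw [powResidue]; split_ifs <;> omega

theorem powResidue_modEq (P r : ℕ) : powResidue P r ≡ 2 ^ r [MOD P] := by
  induction r with
  | zero => rfl
  | succ r ih =>
    have h : powResidue P r + powResidue P r ≡ 2 ^ (r + 1) [MOD P] := by
      rw [pow_succ, mul_two]; exact ih.add ih
    rw [powResidue]
    split_ifs with hle
    · refine Nat.ModEq.trans ?_ h
      conv_rhs => rw [← Nat.sub_add_cancel hle]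
      simp [Nat.ModEq]
    · exact h

/-- Every prime power exactly dividing the central binomial coefficient is at most `2 * h`, so it is
one of the assumed divisors. This replaces the prime number estimates that usually bound a least
common multiple from below. -/
theorem centralBinom_dvd_of_forall_dvd {h N : ℕ} (hN : N ≠ 0)
    (hd : ∀ P, 1 ≤ P → P ≤ 2 * h → P ∣ N) : h.centralBinom ∣ N := by
  rcases Nat.eq_zero_or_pos h with rfl | hpos
  · simp
  rw [← Nat.factorization_le_iff_dvd (Nat.centralBinom_ne_zero h) hN]
  intro p
  by_cases hp : p.Prime
  · have hle : p ^ (h.centralBinom.factorization p) ≤ 2 * h :=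
      Nat.factorization_choose_le_log.trans' le_rfl |> fun hlog =>
        (Nat.pow_le_pow_right hp.pos hlog).trans (Nat.pow_log_le_self p (by omega))
    exact (hp.pow_dvd_iff_le_factorization hN).1 (hd _ (Nat.one_le_pow _ _ hp.pos) hle)
  · simp [Nat.factorization_eq_zero_of_not_prime _ hp]

theorem two_pow_le_centralBinom (h : ℕ) : 2 ^ h ≤ h.centralBinom := by
  induction h with
  | zero => simp
  | succ h ih =>
    have h1 := Nat.succ_mul_centralBinom_succ h
    have h2 : (h + 1) * 2 ^ (h + 1) ≤ (h + 1) * (h + 1).centralBinom := by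
      rw [h1, pow_succ]
      calc (h + 1) * (2 ^ h * 2) = (2 * (h + 1)) * 2 ^ h := by ring
        _ ≤ (2 * (2 * h + 1)) * h.centralBinom := Nat.mul_le_mul (by omega) ih
    exact Nat.le_of_mul_le_mul_left h2 (by omega)

theorem sum_two_pow_lt {n : ℕ} (S : Finset (Fin n)) : ∑ r ∈ S, 2 ^ (r : ℕ) < 2 ^ n := by
  calc ∑ r ∈ S, 2 ^ (r : ℕ) ≤ ∑ r : Fin n, 2 ^ (r : ℕ) :=
        Finset.sum_le_sum_of_subset (Finset.subset_univ S)
    _ = ∑ r ∈ Finset.range n, 2 ^ r := Fin.sum_univ_eq_sum_range (fun r => 2 ^ r) n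
    _ < 2 ^ n := Nat.geomSum_lt le_rfl (by simp)

theorem sum_two_pow_injective {n : ℕ} :
    Function.Injective fun S : Finset (Fin n) => ∑ r ∈ S, 2 ^ (r : ℕ) := by
  intro S S' h
  have h' : (S.map Fin.valEmbedding) = S'.map Fin.valEmbedding := by
    apply Finset.geomSum_injective le_rfl
    simpa using h
  exact Finset.map_injective _ h'

/-- Finitely many pairs of distinct sets are simultaneously separated by the residues of powers of
two modulo a small number. -/
theorem exists_modulus_separating {n : ℕ} (A : Finset (Finset (Fin n) × Finset (Fin n)))
    (hA : ∀ p ∈ A, p.1 ≠ p.2) {h : ℕ} (hh : n * A.card < h) :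
    ∃ P, 1 ≤ P ∧ P ≤ 2 * h ∧
      ∀ p ∈ A, ∑ r ∈ p.1, powResidue P r ≠ ∑ r ∈ p.2, powResidue P r := by
  by_contra! hcon
  set δ : Finset (Fin n) × Finset (Fin n) → ℕ := fun p =>
    ((∑ r ∈ p.1, 2 ^ (r : ℕ) : ℕ) - (∑ r ∈ p.2, 2 ^ (r : ℕ) : ℕ) : ℤ).natAbs with hδ
  have hδ0 : ∀ p ∈ A, δ p ≠ 0 := by
    intro p hp h0
    rw [hδ, Int.natAbs_eq_zero, sub_eq_zero] at h0
    exact hA p hp (sum_two_pow_injective (by exact_mod_cast h0))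
  have hδle : ∀ p ∈ A, δ p ≤ 2 ^ n := by
    intro p _
    have h1 := sum_two_pow_lt p.1
    have h2 := sum_two_pow_lt p.2
    simp only [hδ]
    omega
  have hprod : ∏ p ∈ A, δ p ≠ 0 := Finset.prod_ne_zero_iff.2 hδ0
  -- If every `P ≤ 2 * h` failed, each would divide some difference `δ p`, hence the product. The
  -- product is at most `2 ^ (n * A.card)`, while the central binomial coefficient is at least `2 ^
  -- h`.
  have hdvd : h.centralBinom ∣ ∏ p ∈ A, δ p := by
    refine centralBinom_dvd_of_forall_dvd hprod fun P hP1 hP2 => ?_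
    obtain ⟨p, hp, heq⟩ := hcon P hP1 hP2
    refine Dvd.dvd.trans ?_ (Finset.dvd_prod_of_mem _ hp)
    have hmod : ∀ S : Finset (Fin n),
        ∑ r ∈ S, powResidue P r ≡ ∑ r ∈ S, 2 ^ (r : ℕ) [MOD P] := fun S => by
      induction S using Finset.induction_on with
      | empty => rfl
      | insert a S ha ih =>
        rw [Finset.sum_insert ha, Finset.sum_insert ha]
        exact (powResidue_modEq P a).add ih
    have h3 : ∑ r ∈ p.1, 2 ^ (r : ℕ) ≡ ∑ r ∈ p.2, 2 ^ (r : ℕ) [MOD P] :=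
      ((hmod p.1).symm.trans (by rw [heq])).trans (hmod p.2)
    have h4 := (Nat.modEq_iff_dvd.1 h3.symm)
    rw [hδ]
    exact Int.natCast_dvd.1 h4
  have hle : h.centralBinom ≤ (2 ^ n) ^ A.card :=
    (Nat.le_of_dvd (Nat.pos_of_ne_zero hprod) hdvd).trans (Finset.prod_le_pow_card _ _ _ hδle)
  have h5 := (two_pow_le_centralBinom h).trans hle
  rw [← pow_mul] at h5
  exact absurd ((Nat.pow_le_pow_iff_right (by norm_num)).1 h5) (by omega)

/-! ### Bases that are minimal for a weight -/

section Basis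

variable {E V α : Type*} [Field E] [AddCommGroup V] [Module E V]

/-- The greedy basis: elements are scanned by increasing weight, and one is kept exactly when it is
independent of those kept before. A rejected element therefore depends on strictly lighter ones
only. -/
theorem exists_min_weight_basis (Φ : α → V) (w : α → ℕ) (K : Finset α) (hw : Set.InjOn w K) :
    ∃ S ⊆ K, LinearIndepOn E Φ (S : Set α) ∧
      ∀ u ∈ K, u ∈ S ∨ Φ u ∈ Submodule.span E (Φ '' {s | s ∈ S ∧ w s < w u}) := by
  classical
  induction K using Finset.induction_on_max_value w with
  | empty => exact ⟨∅, Finset.Subset.refl _, by simp, by simp⟩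
  | insert a K ha hmax ih =>
    obtain ⟨S, hSK, hind, hspan⟩ := ih (hw.mono (by simp))
    have hlt : ∀ s ∈ K, w s < w a := fun s hs =>
      lt_of_le_of_ne (hmax s hs) fun h => ha (hw (by simp [hs]) (by simp) h ▸ hs)
    by_cases hmem : Φ a ∈ Submodule.span E (Φ '' (S : Set α))
    · refine ⟨S, hSK.trans (Finset.subset_insert _ _), hind, fun u hu => ?_⟩
      rcases Finset.mem_insert.1 hu with rfl | hu
      · right
        refine Submodule.span_mono (Set.image_mono fun s hs => ?_) hmem
        exact ⟨hs, hlt s (hSK hs)⟩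
      · exact hspan u hu
    · refine ⟨insert a S, Finset.insert_subset_insert _ hSK, ?_, fun u hu => ?_⟩
      · rw [Finset.coe_insert]
        exact hind.insert hmem
      · rcases Finset.mem_insert.1 hu with rfl | hu
        · exact Or.inl (Finset.mem_insert_self _ _)
        · refine (hspan u hu).imp (Finset.mem_insert_of_mem ·) fun h => ?_
          refine Submodule.span_mono (Set.image_mono fun s hs => ?_) h
          exact ⟨Finset.mem_insert_of_mem hs.1, hs.2⟩

theorem LinearIndepOn.card_le_of_subset_span {Φ : α → V} {S : Finset α}
    (hind : LinearIndepOn E Φ (S : Set α)) {G : Finset V}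
    (hG : ∀ s ∈ S, Φ s ∈ Submodule.span E (G : Set V)) : S.card ≤ G.card := by
  classical
  have := linearIndependent_le_span_aux' (fun s : S => Φ s) hind (G : Set V) (by
    rintro _ ⟨s, rfl⟩; exact hG s s.2)
  simpa using this

end Basis

/-! ### Isolating weights -/

/-- Appending the digits `f 0, …, f (ℓ - 1)` to the number `w` written in base `D`. -/
def horner (D : ℕ) (f : ℕ → ℕ) (w : ℕ) : ℕ → ℕ
  | 0 => w
  | l + 1 => horner D f w l * D + f l

theorem horner_congr {D : ℕ} {f g : ℕ → ℕ} {w l : ℕ} (h : ∀ i < l, f i = g i) :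
    horner D f w l = horner D g w l := by
  induction l with
  | zero => rfl
  | succ l ih =>
    rw [horner, horner, ih fun i hi => h i (by omega), h l (by omega)]

theorem horner_eq_add (D : ℕ) (f : ℕ → ℕ) (w l : ℕ) :
    horner D f w l = w * D ^ l + horner D f 0 l := by
  induction l with
  | zero => simp [horner]
  | succ l ih => rw [horner, horner, ih]; ring

/-- The weight of a monomial is additive in each digit. If digit sums stay below `D`, appending a
digit refines the order given by the old weight and only breaks its ties. -/
theorem sum_horner_succ {ι : Type*} (D : ℕ) (f : ℕ → ι → ℕ) (S : Finset ι) (l : ℕ) :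
    ∑ r ∈ S, horner D (fun i => f i r) 0 (l + 1) =
      (∑ r ∈ S, horner D (fun i => f i r) 0 l) * D + ∑ r ∈ S, f l r := by
  simp only [horner]
  rw [Finset.sum_add_distrib, Finset.sum_mul]

section Isolation

variable {ι : Type*}

/-- The elements of `B` whose position lies in the `a`-th dyadic interval of length `2 ^ i`. -/
def dyadicBlock (B : Finset ι) (pos : ι → ℕ) (i a : ℕ) : Finset ι :=
  B.filter fun r => pos r / 2 ^ i = a

theorem dyadicBlock_subset (B : Finset ι) (pos : ι → ℕ) (i a : ℕ) :
    dyadicBlock B pos i a ⊆ B := Finset.filter_subset _ _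

theorem dyadicBlock_disjoint (B : Finset ι) (pos : ι → ℕ) (i : ℕ) {a a' : ℕ} (h : a ≠ a') :
    Disjoint (dyadicBlock B pos i a) (dyadicBlock B pos i a') := by
  rw [Finset.disjoint_left]
  intro r hr hr'
  exact h ((Finset.mem_filter.1 hr).2.symm.trans (Finset.mem_filter.1 hr').2)

variable [DecidableEq ι]

/-- For a coefficient function `f` of a multilinear polynomial in the variables `B`, the
coefficient of the monomial `u` in the variables `I`, as a coefficient function in the variables
`B \ I`. -/
def partialCoeff {E : Type*} (B I : Finset ι) (f : Finset ι → E) (u : Finset ι) :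
    Finset ι → E :=
  fun v => f (u ∪ (v ∩ (B \ I)))

theorem dyadicBlock_succ (B : Finset ι) (pos : ι → ℕ) (i a : ℕ) :
    dyadicBlock B pos (i + 1) a = dyadicBlock B pos i (2 * a) ∪ dyadicBlock B pos i (2 * a + 1) := by
  ext r
  simp only [dyadicBlock, Finset.mem_filter, Finset.mem_union, pow_succ, ← Nat.div_div_eq_div_mul]
  rw [← and_or_left]
  refine and_congr_right fun _ => ?_
  omega

/-- A set `K` of monomials in the variables `I` which spans all partial coefficients in a way that
respects the weight `w`. -/
structure IsWeightBasis {E : Type*} [Field E] (B I : Finset ι) (f : Finset ι → E)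
    (w : Finset ι → ℕ) (R : ℕ) (K : Finset (Finset ι)) : Prop where
  subset : ∀ s ∈ K, s ⊆ I
  card_le : K.card ≤ R
  mem_or_span : ∀ u ⊆ I, u ∈ K ∨
    partialCoeff B I f u ∈ Submodule.span E (partialCoeff B I f '' {s | s ∈ K ∧ w s < w u})

variable {E : Type*} [Field E]

/-- The products of the monomials of two weight bases span with respect to the sum of the
weights. -/
theorem IsWeightBasis.image₂_union {B I₁ I₂ : Finset ι} {f : Finset ι → E} {g : ι → ℕ}
    {R : ℕ} {K₁ K₂ : Finset (Finset ι)} (hd : Disjoint I₁ I₂) (hI₁ : I₁ ⊆ B) (hI₂ : I₂ ⊆ B)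
    (h₁ : IsWeightBasis B I₁ f (fun S => ∑ r ∈ S, g r) R K₁)
    (h₂ : IsWeightBasis B I₂ f (fun S => ∑ r ∈ S, g r) R K₂) :
    ∀ u ⊆ I₁ ∪ I₂, u ∈ Finset.image₂ (· ∪ ·) K₁ K₂ ∨
      partialCoeff B (I₁ ∪ I₂) f u ∈ Submodule.span E (partialCoeff B (I₁ ∪ I₂) f ''
        {s | s ∈ Finset.image₂ (· ∪ ·) K₁ K₂ ∧ ∑ r ∈ s, g r < ∑ r ∈ u, g r}) := by
  have key : ∀ I I' : Finset ι, Disjoint I I' → I ⊆ B → I' ⊆ B → ∀ u' ⊆ I', ∀ (u : Finset ι)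
      (A : Set (Finset ι)), (partialCoeff B I f u ∈ Submodule.span E (partialCoeff B I f '' A)) →
      partialCoeff B (I ∪ I') f (u ∪ u') ∈
        Submodule.span E ((fun s => partialCoeff B (I ∪ I') f (s ∪ u')) '' A) := by
    intro I I' hdis hI hI' u' hu' u A hu
    -- Extracting the coefficient of `u'` is linear, so a linear relation between partial
    -- coefficients for `I` persists when `u'` is attached to all its monomials. All weights then
    -- rise by the same amount, which keeps strict inequalities.
    let L : (Finset ι → E) →ₗ[E] (Finset ι → E) :=
      LinearMap.funLeft E E fun v => u' ∪ (v ∩ (B \ (I ∪ I')))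
    have hL : ∀ s, L (partialCoeff B I f s) = partialCoeff B (I ∪ I') f (s ∪ u') := by
      intro s
      funext v
      simp only [L, LinearMap.funLeft_apply, partialCoeff]
      congr 1
      ext r
      have h1 := @hu' r
      have h2 := @hI' r
      have h3 : r ∈ I' → r ∉ I := fun h h' => Finset.disjoint_left.1 hdis h' h
      simp only [Finset.mem_union, Finset.mem_inter, Finset.mem_sdiff]
      tauto
    have h := Submodule.mem_map_of_mem (f := L) hu
    rw [Submodule.map_span, ← Set.image_comp, hL] at h
    exact (congrArg (fun X => partialCoeff B (I ∪ I') f (u ∪ u') ∈ Submodule.span E X)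
      (Set.image_congr fun s _ => hL s)).mp h
  have hsum : ∀ s₁ ⊆ I₁, ∀ s₂ ⊆ I₂, ∑ r ∈ s₁ ∪ s₂, g r = ∑ r ∈ s₁, g r + ∑ r ∈ s₂, g r :=
    fun s₁ h₁ s₂ h₂ => Finset.sum_union (Finset.disjoint_of_subset_left h₁
      (Finset.disjoint_of_subset_right h₂ hd))
  have right : ∀ s₁ ∈ K₁, ∀ u₂ ⊆ I₂, u₂ ∉ K₂ →
      partialCoeff B (I₁ ∪ I₂) f (s₁ ∪ u₂) ∈ Submodule.span E (partialCoeff B (I₁ ∪ I₂) f ''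
        {s | s ∈ Finset.image₂ (· ∪ ·) K₁ K₂ ∧ ∑ r ∈ s, g r < ∑ r ∈ s₁ ∪ u₂, g r}) := by
    intro s₁ hs₁ u₂ hu₂ hn
    have h := key I₂ I₁ hd.symm hI₂ hI₁ s₁ (h₁.subset _ hs₁) u₂ _
      ((h₂.mem_or_span u₂ hu₂).resolve_left hn)
    rw [Finset.union_comm I₂, Finset.union_comm u₂] at h
    refine Submodule.span_mono ?_ h
    rintro _ ⟨s₂, ⟨hs₂, hlt⟩, rfl⟩
    refine ⟨s₁ ∪ s₂, ⟨Finset.mem_image₂_of_mem hs₁ hs₂, ?_⟩, by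
      simp only [Finset.union_comm s₂]⟩
    rw [hsum _ (h₁.subset _ hs₁) _ (h₂.subset _ hs₂), hsum _ (h₁.subset _ hs₁) _ hu₂]
    simpa using hlt
  intro u hu
  set u₁ := u ∩ I₁ with hu₁
  set u₂ := u ∩ I₂ with hu₂
  have hu₁I : u₁ ⊆ I₁ := Finset.inter_subset_right
  have hu₂I : u₂ ⊆ I₂ := Finset.inter_subset_right
  have hunion : u = u₁ ∪ u₂ := by
    rw [hu₁, hu₂, ← Finset.inter_union_distrib_left, Finset.inter_eq_left.2 hu]
  by_cases hK₁ : u₁ ∈ K₁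
  · by_cases hK₂ : u₂ ∈ K₂
    · left; rw [hunion]; exact Finset.mem_image₂_of_mem hK₁ hK₂
    · right; rw [hunion]; exact right _ hK₁ _ hu₂I hK₂
  · right
    have h := key I₁ I₂ hd hI₁ hI₂ u₂ hu₂I u₁ _ ((h₁.mem_or_span u₁ hu₁I).resolve_left hK₁)
    rw [← hunion] at h
    refine Submodule.span_le.2 ?_ h
    rintro _ ⟨s₁, ⟨hs₁, hlt⟩, rfl⟩
    have hlt' : ∑ r ∈ s₁ ∪ u₂, g r < ∑ r ∈ u, g r := by
      rw [hunion, hsum _ (h₁.subset _ hs₁) _ hu₂I, hsum _ hu₁I _ hu₂I]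
      simpa using hlt
    by_cases hK₂ : u₂ ∈ K₂
    · exact Submodule.subset_span ⟨_, ⟨Finset.mem_image₂_of_mem hs₁ hK₂, hlt'⟩, rfl⟩
    · refine Submodule.span_mono (Set.image_mono fun s hs => ?_) (right s₁ hs₁ u₂ hu₂I hK₂)
      exact ⟨hs.1, hs.2.trans hlt'⟩

/-- If the partial coefficients with respect to every dyadic block span a space of dimension at
most `R`, then `ℓ` members of a separating family of weights give weight bases of the blocks of
length `2 ^ ℓ`. -/
theorem exists_isWeightBasis (B : Finset ι) (f : Finset ι → E) (pos : ι → ℕ)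
    (hpos : Set.InjOn pos B) (R : ℕ) (hR : 2 ≤ R)
    (hrank : ∀ i a, ∃ G : Finset (Finset ι → E), G.card ≤ R ∧ ∀ u ⊆ dyadicBlock B pos i a,
      partialCoeff B (dyadicBlock B pos i a) f u ∈ Submodule.span E (G : Set (Finset ι → E)))
    (D : ℕ) (W : ℕ → ι → ℕ) (good : ℕ → Prop)
    (hgood : ∀ p, good p → ∑ r ∈ B, W p r < D)
    (hsep : ∀ A : Finset (Finset ι × Finset ι), A.card ≤ B.card * (R ^ 2) ^ 2 →
      (∀ x ∈ A, x.1 ≠ x.2) →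
      ∃ p, good p ∧ ∀ x ∈ A, ∑ r ∈ x.1, W p r ≠ ∑ r ∈ x.2, W p r) (l : ℕ) :
    ∃ p : ℕ → ℕ, (∀ i < l, good (p i)) ∧ ∀ a, ∃ K : Finset (Finset ι),
      IsWeightBasis B (dyadicBlock B pos l a) f
        (fun S => ∑ r ∈ S, horner D (fun i => W (p i) r) 0 l) R K ∧
      (1 ≤ l → Set.InjOn (fun S => ∑ r ∈ S, horner D (fun i => W (p i) r) 0 l) (K : Set (Finset ι))) := by
  induction l with
  | zero =>
    -- A block of length 1 has at most two monomials, and all are kept because `2 ≤ R`. With no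
    -- digits the weight is identically 0, which is why injectivity is claimed only from level 1 on.
    refine ⟨fun _ => 0, by simp, fun a => ⟨(dyadicBlock B pos 0 a).powerset, ⟨?_, ?_, ?_⟩, by simp⟩⟩
    · simp
    · have h1 : (dyadicBlock B pos 0 a).card ≤ 1 := by
        rw [Finset.card_le_one]
        intro r hr r' hr'
        simp only [dyadicBlock, Finset.mem_filter, pow_zero, Nat.div_one] at hr hr'
        exact hpos hr.1 hr'.1 (hr.2.trans hr'.2.symm)
      rw [Finset.card_powerset]
      exact (Nat.pow_le_pow_right (by norm_num) h1).trans (by omega)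
    · intro u hu
      exact Or.inl (Finset.mem_powerset.2 hu)
  | succ l ih =>
    obtain ⟨p, hpg, hp⟩ := ih
    choose K hK _ using hp
    -- One modulus must serve all blocks of the level simultaneously. At most `B.card` blocks are
    -- nonempty, and each has at most `R ^ 2` candidate products.
    let A : Finset (Finset ι × Finset ι) := (B.image fun r => pos r / 2 ^ (l + 1)).biUnion fun a =>
      (Finset.image₂ (· ∪ ·) (K (2 * a)) (K (2 * a + 1))).offDiag
    have hcand : ∀ a, (Finset.image₂ (· ∪ ·) (K (2 * a)) (K (2 * a + 1))).card ≤ R ^ 2 := by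
      intro a
      refine (Finset.card_image₂_le _ _ _).trans ?_
      rw [pow_two]
      exact Nat.mul_le_mul (hK _).card_le (hK _).card_le
    have hA : A.card ≤ B.card * (R ^ 2) ^ 2 := by
      refine Finset.card_biUnion_le.trans ((Finset.sum_le_card_nsmul _ _ ((R ^ 2) ^ 2) ?_).trans ?_)
      · intro a _
        rw [Finset.offDiag_card, pow_two (R ^ 2)]
        exact (Nat.sub_le _ _).trans (Nat.mul_le_mul (hcand a) (hcand a))
      · rw [smul_eq_mul]
        exact Nat.mul_le_mul_right _ Finset.card_image_le
    obtain ⟨p', hp'g, hp'⟩ := hsep A hA (by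
      intro x hx
      obtain ⟨a, _, hx⟩ := Finset.mem_biUnion.1 hx
      exact (Finset.mem_offDiag.1 hx).2.2)
    refine ⟨Function.update p l p', fun i hi => ?_, fun a => ?_⟩
    · rcases Nat.lt_succ_iff_lt_or_eq.1 hi with hi | rfl
      · rw [Function.update_of_ne hi.ne]; exact hpg i hi
      · rwa [Function.update_self]
    have hΩ : ∀ S : Finset ι, ∑ r ∈ S, horner D (fun i => W (Function.update p l p' i) r) 0 (l + 1) =
        (∑ r ∈ S, horner D (fun i => W (p i) r) 0 l) * D + ∑ r ∈ S, W p' r := by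
      intro S
      rw [sum_horner_succ D (fun i => W (Function.update p l p' i))]
      congr 2
      · refine Finset.sum_congr rfl fun r _ => horner_congr fun i hi => ?_
        rw [Function.update_of_ne hi.ne]
      · funext r
        rw [Function.update_self]
    simp only [hΩ]
    have hlt : ∀ S ⊆ B, ∑ r ∈ S, W p' r < D := fun S hS =>
      (Finset.sum_le_sum_of_subset hS).trans_lt (hgood p' hp'g)
    set I₁ := dyadicBlock B pos l (2 * a)
    set I₂ := dyadicBlock B pos l (2 * a + 1)
    have hI : dyadicBlock B pos (l + 1) a = I₁ ∪ I₂ := dyadicBlock_succ B pos l a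
    have hIB : I₁ ∪ I₂ ⊆ B := hI ▸ dyadicBlock_subset B pos (l + 1) a
    set C := Finset.image₂ (· ∪ ·) (K (2 * a)) (K (2 * a + 1)) with hC
    have hCI : ∀ s ∈ C, s ⊆ I₁ ∪ I₂ := by
      intro s hs
      obtain ⟨s₁, hs₁, s₂, hs₂, rfl⟩ := Finset.mem_image₂.1 hs
      exact Finset.union_subset_union ((hK _).subset _ hs₁) ((hK _).subset _ hs₂)
    -- Reduction modulo `D` recovers the last digit, which already separates the candidates. An
    -- empty block is not in `A`, but its only candidate is the empty monomial.
    have hinj : Set.InjOn (fun S => (∑ r ∈ S, horner D (fun i => W (p i) r) 0 l) * D +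
        ∑ r ∈ S, W p' r) (C : Set (Finset ι)) := by
      intro s hs s' hs' heq
      by_contra hne
      have hs0 := hCI s hs
      have hs0' := hCI s' hs'
      have hmem : (s, s') ∈ A := by
        refine Finset.mem_biUnion.2 ⟨a, ?_, Finset.mem_offDiag.2 ⟨hs, hs', hne⟩⟩
        obtain ⟨r, hr⟩ : (dyadicBlock B pos (l + 1) a).Nonempty := by
          rw [hI, Finset.nonempty_iff_ne_empty]
          intro h0
          rw [h0, Finset.subset_empty] at hs0 hs0'
          exact hne (hs0.trans hs0'.symm)
        exact Finset.mem_image.2 ⟨r, dyadicBlock_subset _ _ _ _ hr, (Finset.mem_filter.1 hr).2⟩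
      refine hp' _ hmem ?_
      have h := congrArg (· % D) heq
      simp only [Nat.mul_add_mod_self_right] at h
      rwa [Nat.mod_eq_of_lt (hlt s (hs0.trans hIB)), Nat.mod_eq_of_lt (hlt s' (hs0'.trans hIB))] at h
    -- The candidates may number `R ^ 2`; thinning them to an independent set brings the count back
    -- to `R`, so that it does not grow from level to level.
    obtain ⟨S, hSC, hind, hS⟩ := exists_min_weight_basis (E := E) (partialCoeff B (I₁ ∪ I₂) f) _ C hinj
    have hcands : ∀ u ⊆ I₁ ∪ I₂, u ∈ C ∨ partialCoeff B (I₁ ∪ I₂) f u ∈ Submodule.span E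
        (partialCoeff B (I₁ ∪ I₂) f '' {s | s ∈ C ∧
          (∑ r ∈ s, horner D (fun i => W (p i) r) 0 l) * D + ∑ r ∈ s, W p' r <
          (∑ r ∈ u, horner D (fun i => W (p i) r) 0 l) * D + ∑ r ∈ u, W p' r}) := by
      intro u hu
      refine (IsWeightBasis.image₂_union (dyadicBlock_disjoint B pos l (by omega))
        (dyadicBlock_subset _ _ _ _) (dyadicBlock_subset _ _ _ _) (hK (2 * a)) (hK (2 * a + 1))
        u hu).imp id fun h => Submodule.span_mono (Set.image_mono ?_) h
      rintro s ⟨hs, hlt'⟩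
      refine ⟨hs, ?_⟩
      have h1 := hlt s ((hCI s hs).trans hIB)
      have h2 := Nat.mul_le_mul_right D (Nat.succ_le_of_lt hlt')
      rw [Nat.succ_mul] at h2
      omega
    refine ⟨S, ⟨fun s hs => hI ▸ hCI s (hSC hs), ?_, fun u hu => ?_⟩,
      fun _ => hinj.mono (by exact_mod_cast hSC)⟩
    · obtain ⟨G, hGR, hG⟩ := hrank (l + 1) a
      rw [hI] at hG
      exact (hind.card_le_of_subset_span fun s hs => hG s (hCI s (hSC hs))).trans hGR
    · rw [hI] at hu ⊢
      rcases hcands u hu with huC | hspan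
      · exact hS u huC
      · right
        refine Submodule.span_le.2 ?_ hspan
        rintro _ ⟨s, ⟨hsC, hslt⟩, rfl⟩
        rcases hS s hsC with hsS | hs
        · exact Submodule.subset_span ⟨s, ⟨hsS, hslt⟩, rfl⟩
        · refine Submodule.span_mono (Set.image_mono ?_) hs
          rintro s' ⟨hs'S, hs'lt⟩
          exact ⟨hs'S, hs'lt.trans hslt⟩

/-- Under the hypotheses of `exists_isWeightBasis`, some nonzero coefficient is the only one of its
weight. -/
theorem exists_isolated (B : Finset ι) (f : Finset ι → E) (hf : ∃ S ⊆ B, f S ≠ 0) (pos : ι → ℕ)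
    (hpos : Set.InjOn pos B) (R : ℕ) (hR : 2 ≤ R)
    (hrank : ∀ i a, ∃ G : Finset (Finset ι → E), G.card ≤ R ∧ ∀ u ⊆ dyadicBlock B pos i a,
      partialCoeff B (dyadicBlock B pos i a) f u ∈ Submodule.span E (G : Set (Finset ι → E)))
    (D : ℕ) (W : ℕ → ι → ℕ) (good : ℕ → Prop)
    (hgood : ∀ p, good p → ∑ r ∈ B, W p r < D)
    (hsep : ∀ A : Finset (Finset ι × Finset ι), A.card ≤ B.card * (R ^ 2) ^ 2 →
      (∀ x ∈ A, x.1 ≠ x.2) →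
      ∃ p, good p ∧ ∀ x ∈ A, ∑ r ∈ x.1, W p r ≠ ∑ r ∈ x.2, W p r)
    (l : ℕ) (hl : 1 ≤ l) (hposl : ∀ r ∈ B, pos r < 2 ^ l) :
    ∃ p : ℕ → ℕ, (∀ i < l, good (p i)) ∧ ∃ s ⊆ B, f s ≠ 0 ∧ ∀ S ⊆ B, S ≠ s →
      ∑ r ∈ S, horner D (fun i => W (p i) r) 0 l = ∑ r ∈ s, horner D (fun i => W (p i) r) 0 l →
      f S = 0 := by
  obtain ⟨p, hpg, hp⟩ := exists_isWeightBasis B f pos hpos R hR hrank D W good hgood hsep l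
  refine ⟨p, hpg, ?_⟩
  classical
  obtain ⟨K, hK, hinj⟩ := hp 0
  have hB : dyadicBlock B pos l 0 = B :=
    Finset.filter_true_of_mem fun r hr => Nat.div_eq_of_lt (hposl r hr)
  rw [hB] at hK
  specialize hinj hl
  set Ω : Finset ι → ℕ := fun S => ∑ r ∈ S, horner D (fun i => W (p i) r) 0 l
  -- On the top block no variables remain outside, so partial coefficients are scalars and a span of
  -- vanishing ones is zero.
  have hΦ : ∀ u, partialCoeff B B f u = fun _ => f u := fun u => by
    funext v; simp [partialCoeff]
  have hzero : ∀ u ⊆ B, u ∉ K → (∀ s ∈ K, Ω s < Ω u → f s = 0) → f u = 0 := by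
    intro u hu huK h0
    have h := (hK.mem_or_span u hu).resolve_left huK
    have hle : Submodule.span E (partialCoeff B B f '' {s | s ∈ K ∧ Ω s < Ω u}) ≤ ⊥ := by
      rw [Submodule.span_le]
      rintro _ ⟨s, hs, rfl⟩
      rw [hΦ, h0 s hs.1 hs.2]
      rfl
    have h1 := (Submodule.mem_bot E).1 (hle h)
    rw [hΦ] at h1
    exact congrFun h1 ∅
  have hex : ∃ s ∈ K, f s ≠ 0 := by
    by_contra! hcon
    obtain ⟨S, hS, hfS⟩ := hf
    by_cases hSK : S ∈ K
    · exact hfS (hcon S hSK)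
    · exact hfS (hzero S hS hSK fun s hs _ => hcon s hs)
  -- The lightest basis monomial with nonzero coefficient is isolated: another monomial of the same
  -- weight is either outside `K`, hence spanned by lighter coefficients that vanish, or excluded by
  -- injectivity on `K`.
  obtain ⟨s, hs, hmin⟩ := Finset.exists_min_image (K.filter fun s => f s ≠ 0) Ω (by
    obtain ⟨s, hs⟩ := hex
    exact ⟨s, Finset.mem_filter.2 hs⟩)
  rw [Finset.mem_filter] at hs
  refine ⟨s, hK.subset s hs.1, hs.2, fun S hS hne heq => ?_⟩
  by_contra hfS
  by_cases hSK : S ∈ K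
  · exact hne (hinj hSK hs.1 heq)
  · refine hfS (hzero S hS hSK fun s' hs' hlt => ?_)
    by_contra hfs'
    have := hmin s' (Finset.mem_filter.2 ⟨hs', hfs'⟩)
    have heq' : Ω S = Ω s := heq
    omega

end Isolation

/-! ### Multiaffine functions and their coefficients -/

section MultiAffine

variable {ι A : Type*} [CommRing A]

/-- The Möbius transform of a set function. -/
def moebius (p : Finset ι → A) (S : Finset ι) : A :=
  ∑ T ∈ S.powerset, (-1) ^ (S.card + T.card) * p T

theorem map_moebius {A' : Type*} [CommRing A'] (φ : A →+* A') (p : Finset ι → A) (S : Finset ι) :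
    moebius (fun T => φ (p T)) S = φ (moebius p S) := by
  simp [moebius]

theorem moebius_congr {p p' : Finset ι → A} {S : Finset ι} (h : ∀ T ⊆ S, p T = p' T) :
    moebius p S = moebius p' S :=
  Finset.sum_congr rfl fun T hT => by rw [h T (Finset.mem_powerset.1 hT)]

theorem moebius_sum {γ : Type*} (s : Finset γ) (p : γ → Finset ι → A) (S : Finset ι) :
    moebius (fun T => ∑ i ∈ s, p i T) S = ∑ i ∈ s, moebius (p i) S := by
  simp only [moebius, Finset.mul_sum]
  exact Finset.sum_comm

theorem moebius_const_mul (a : A) (p : Finset ι → A) (S : Finset ι) :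
    moebius (fun T => a * p T) S = a * moebius p S := by
  simp only [moebius, Finset.mul_sum]
  exact Finset.sum_congr rfl fun T _ => by ring

variable [DecidableEq ι]

/-- A function of several variables that is affine in each of them. -/
def MultiAffine (P : (ι → A) → A) : Prop :=
  ∀ (x : ι → A) (r : ι) (a : A), P (Function.update x r a) =
    P (Function.update x r 0) + a * (P (Function.update x r 1) - P (Function.update x r 0))

/-- The point whose coordinates in `B` are given by the indicator function of `T`, and whose other
coordinates are those of `x`. -/
def indicatorPoint (x : ι → A) (B T : Finset ι) : ι → A :=
  fun r => if r ∈ B then if r ∈ T then 1 else 0 else x r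

theorem moebius_insert (p : Finset ι → A) {a : ι} {S : Finset ι} (ha : a ∉ S) :
    moebius p (insert a S) = moebius (fun T => p (insert a T)) S - moebius p S := by
  rw [moebius, Finset.sum_powerset_insert ha, moebius, moebius, add_comm, sub_eq_add_neg,
    ← Finset.sum_neg_distrib]
  congr 1
  · refine Finset.sum_congr rfl fun T hT => ?_
    rw [Finset.card_insert_of_notMem ha,
      Finset.card_insert_of_notMem fun h => ha (Finset.mem_powerset.1 hT h)]
    ring
  · refine Finset.sum_congr rfl fun T _ => ?_
    rw [Finset.card_insert_of_notMem ha]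
    ring

/-- Interpolation at 0/1 points, one variable at a time. The coordinates outside `B` stay as in `x`,
so the Möbius values are the coefficients of a polynomial in the variables `B` with all the other
variables already specialized. -/
theorem MultiAffine.eq_sum {P : (ι → A) → A} (hP : MultiAffine P) (B : Finset ι) (x : ι → A) :
    P x = ∑ S ∈ B.powerset, (∏ r ∈ S, x r) * moebius (fun T => P (indicatorPoint x B T)) S := by
  induction B using Finset.induction_on generalizing x with
  | empty =>
    have hx : indicatorPoint x ∅ ∅ = x := by funext r; simp [indicatorPoint]
    simp [moebius, hx]
  | insert a B ha ih =>
    have hx := hP x a (x a)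
    rw [Function.update_eq_self, ih (Function.update x a 0), ih (Function.update x a 1)] at hx
    have h0 : ∀ T, a ∉ T → indicatorPoint (Function.update x a 0) B T =
        indicatorPoint x (insert a B) T := by
      intro T hT
      funext r
      by_cases hr : r = a
      · subst hr; simp [indicatorPoint, ha, hT]
      · simp [indicatorPoint, hr]
    have h1 : ∀ T, indicatorPoint (Function.update x a 1) B T =
        indicatorPoint x (insert a B) (insert a T) := by
      intro T
      funext r
      by_cases hr : r = a
      · subst hr; simp [indicatorPoint, ha]
      · simp [indicatorPoint, hr]
    have hprod : ∀ S ∈ B.powerset, ∀ y, ∏ r ∈ S, Function.update x a y r = ∏ r ∈ S, x r := by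
      intro S hS y
      refine Finset.prod_congr rfl fun r hr => Function.update_of_ne ?_ _ _
      rintro rfl
      exact ha (Finset.mem_powerset.1 hS hr)
    have hm : ∀ S ∈ B.powerset,
        moebius (fun T => P (indicatorPoint (Function.update x a 0) B T)) S =
          moebius (fun T => P (indicatorPoint x (insert a B) T)) S := by
      intro S hS
      refine Finset.sum_congr rfl fun T hT => ?_
      simp only [h0 T fun h => ha (Finset.mem_powerset.1 hS (Finset.mem_powerset.1 hT h))]
    rw [hx, Finset.sum_powerset_insert ha, ← Finset.sum_sub_distrib, Finset.mul_sum]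
    congr 1
    · refine Finset.sum_congr rfl fun S hS => ?_
      rw [hprod S hS, hm S hS]
    · refine Finset.sum_congr rfl fun S hS => ?_
      have haS : a ∉ S := fun h => ha (Finset.mem_powerset.1 hS h)
      rw [hprod S hS, hprod S hS, hm S hS, moebius_insert _ haS, Finset.prod_insert haS]
      simp only [h1]
      ring

theorem sum_powerset_union {M : Type*} [AddCommMonoid M] {u v : Finset ι} (h : Disjoint u v)
    (g : Finset ι → M) :
    ∑ T ∈ (u ∪ v).powerset, g T = ∑ T ∈ u.powerset, ∑ T' ∈ v.powerset, g (T ∪ T') := by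
  induction v using Finset.induction_on generalizing g with
  | empty => simp
  | insert a v ha ih =>
    rw [Finset.disjoint_insert_right] at h
    rw [Finset.union_insert, Finset.sum_powerset_insert (by simp [ha, h.1]), ih h.2, ih h.2,
      ← Finset.sum_add_distrib]
    refine Finset.sum_congr rfl fun T _ => ?_
    rw [Finset.sum_powerset_insert ha]
    simp only [Finset.union_insert]

/-- The signs are multiplicative over disjoint unions. A decomposition of the values at 0/1 points
into products of separated functions thus passes to the coefficients. -/
theorem moebius_union {γ : Type*} {I J : Finset ι} (hIJ : Disjoint I J) (p : Finset ι → A)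
    (Γ : Finset γ) (a b : γ → Finset ι → A)
    (h : ∀ u ⊆ I, ∀ v ⊆ J, p (u ∪ v) = ∑ τ ∈ Γ, a τ u * b τ v) {u v : Finset ι} (hu : u ⊆ I)
    (hv : v ⊆ J) :
    moebius p (u ∪ v) = ∑ τ ∈ Γ, moebius (a τ) u * moebius (b τ) v := by
  have hd : ∀ {u v : Finset ι}, u ⊆ I → v ⊆ J → Disjoint u v := fun hu hv =>
    Finset.disjoint_of_subset_left hu (Finset.disjoint_of_subset_right hv hIJ)
  rw [moebius, sum_powerset_union (hd hu hv)]
  simp only [moebius, Finset.sum_mul_sum]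
  rw [Finset.sum_comm]
  conv_rhs => rw [Finset.sum_comm]; arg 2; ext T; rw [Finset.sum_comm]
  rw [Finset.sum_comm]
  refine Finset.sum_congr rfl fun T hT => Finset.sum_congr rfl fun T' hT' => ?_
  have hT1 := (Finset.mem_powerset.1 hT).trans hu
  have hT1' := (Finset.mem_powerset.1 hT').trans hv
  rw [h T hT1 T' hT1', Finset.card_union_of_disjoint (hd hu hv),
    Finset.card_union_of_disjoint (hd hT1 hT1'), Finset.mul_sum]
  refine Finset.sum_congr rfl fun τ _ => ?_
  ring

end MultiAffine

/-! ### Dimensions of spaces of partial coefficients -/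

section Rank

variable {ι E : Type*} [DecidableEq ι] [Field E]

/-- The partial coefficients with respect to `I` of the multiaffine function with the values `p`
lie in a space of dimension at most `R`. -/
def PartialRankLE (B I : Finset ι) (p : Finset ι → E) (R : ℕ) : Prop :=
  ∃ G : Finset (Finset ι → E), G.card ≤ R ∧
    ∀ u ⊆ I, partialCoeff B I (moebius p) u ∈ Submodule.span E (G : Set (Finset ι → E))

theorem PartialRankLE.const_mul {B I : Finset ι} {p : Finset ι → E} {R : ℕ}
    (h : PartialRankLE B I p R) (a : E) : PartialRankLE B I (fun T => a * p T) R := by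
  obtain ⟨G, hGR, hG⟩ := h
  refine ⟨G, hGR, fun u hu => ?_⟩
  have : partialCoeff B I (moebius fun T => a * p T) u = a • partialCoeff B I (moebius p) u := by
    funext v
    simp [partialCoeff, moebius_const_mul]
  rw [this]
  exact Submodule.smul_mem _ _ (hG u hu)

theorem PartialRankLE.sum {B I : Finset ι} {γ : Type*} {s : Finset γ} {p : γ → Finset ι → E}
    {R : ℕ} (h : ∀ i ∈ s, PartialRankLE B I (p i) R) :
    PartialRankLE B I (fun T => ∑ i ∈ s, p i T) (s.card * R) := by
  classical
  choose! G hGR hG using h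
  refine ⟨s.biUnion G, ?_, fun u hu => ?_⟩
  · exact Finset.card_biUnion_le_card_mul _ _ _ hGR
  · have : partialCoeff B I (moebius fun T => ∑ i ∈ s, p i T) u =
        ∑ i ∈ s, partialCoeff B I (moebius (p i)) u := by
      funext v
      simp [partialCoeff, moebius_sum, Finset.sum_apply]
    rw [this]
    refine Submodule.sum_mem _ fun i hi => Submodule.span_mono ?_ (hG i hi u hu)
    exact_mod_cast Finset.subset_biUnion_of_mem G hi

/-- The functions `b τ` on the outer side, after the Möbius transform, serve as generators; the
inner functions `a τ` only supply scalars. -/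
theorem partialRankLE_of_eq_sum {B I : Finset ι} {γ : Type*} (p : Finset ι → E)
    (Γ : Finset γ) (a b : γ → Finset ι → E)
    (h : ∀ u ⊆ I, ∀ v ⊆ B \ I, p (u ∪ v) = ∑ τ ∈ Γ, a τ u * b τ v) :
    PartialRankLE B I p Γ.card := by
  classical
  refine ⟨Γ.image fun τ v => moebius (b τ) (v ∩ (B \ I)), Finset.card_image_le, fun u hu => ?_⟩
  have : partialCoeff B I (moebius p) u =
      ∑ τ ∈ Γ, moebius (a τ) u • fun v => moebius (b τ) (v ∩ (B \ I)) := by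
    funext v
    rw [partialCoeff, moebius_union Finset.disjoint_sdiff p Γ a b h hu Finset.inter_subset_right]
    simp [Finset.sum_apply]
  rw [this]
  exact Submodule.sum_mem _ fun τ hτ => Submodule.smul_mem _ _
    (Submodule.subset_span (Finset.mem_coe.2 (Finset.mem_image_of_mem _ hτ)))

variable [Fintype ι]

theorem sum_mul_indicatorPoint (a x : ι → E) {B T : Finset ι} (hT : T ⊆ B) :
    ∑ r, a r * indicatorPoint x B T r = ∑ r ∈ Bᶜ, a r * x r + ∑ r ∈ T, a r := by
  rw [← Finset.sum_compl_add_sum B]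
  congr 1
  · refine Finset.sum_congr rfl fun r hr => ?_
    rw [indicatorPoint, if_neg (Finset.mem_compl.1 hr)]
  · rw [← Finset.sum_subset hT]
    · refine Finset.sum_congr rfl fun r hr => ?_
      rw [indicatorPoint, if_pos (hT hr), if_pos hr, mul_one]
    · intro r hr hrT
      rw [indicatorPoint, if_pos hr, if_neg hrT, mul_zero]

/-- A product of linear polynomials in disjoint sets of variables has partial rank at most four
with respect to a set of variables that splits at most two of these sets. -/
theorem partialRankLE_prod {d : ℕ} (const : Fin d → E) (coeff : Fin d → ι → E) (col : ι → ℕ)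
    (hcol : ∀ j r, coeff j r ≠ 0 → col r = j) (x : ι → E) {B I : Finset ι} (hI : I ⊆ B)
    (hsplit : (Finset.univ.filter fun j : Fin d =>
      (∃ r ∈ I, col r = j) ∧ ∃ r ∈ B \ I, col r = j).card ≤ 2) :
    PartialRankLE B I
      (fun T => ∏ j, (const j + ∑ r, coeff j r * indicatorPoint x B T r)) 4 := by
  classical
  set split := Finset.univ.filter fun j : Fin d =>
    (∃ r ∈ I, col r = j) ∧ ∃ r ∈ B \ I, col r = j
  let c' : Fin d → E := fun j => const j + ∑ r ∈ Bᶜ, coeff j r * x r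
  let α : Fin d → Finset ι → E := fun j u => c' j + ∑ r ∈ u, coeff j r
  let β : Fin d → Finset ι → E := fun j v => ∑ r ∈ v, coeff j r
  let outer : Fin d → Prop := fun j => ∃ r ∈ B \ I, col r = j
  -- A factor of an unsplit color depends on one side only and goes entirely there. A factor of a
  -- split color is a sum `α + β` of the two sides; expanding the product of these sums gives one
  -- term for each subset of `split`, so at most `2 ^ 2`. The constant and the variables outside `B`
  -- enter through `c'`.
  have hrank := partialRankLE_of_eq_sum (B := B) (I := I)
    (fun T => ∏ j, (const j + ∑ r, coeff j r * indicatorPoint x B T r)) split.powerset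
    (fun τ u => (∏ j ∈ splitᶜ, if outer j then 1 else α j u) * ∏ j ∈ τ, α j u)
    (fun τ v => (∏ j ∈ splitᶜ, if outer j then c' j + β j v else 1) * ∏ j ∈ split \ τ, β j v) (by
      intro u hu v hv
      have huv : Disjoint u v := Finset.disjoint_of_subset_left hu
        (Finset.disjoint_of_subset_right hv Finset.disjoint_sdiff)
      have hfac : ∀ j, const j + ∑ r, coeff j r * indicatorPoint x B (u ∪ v) r =
          α j u + β j v := by
        intro j
        rw [sum_mul_indicatorPoint _ _ (Finset.union_subset (hu.trans hI)
          (hv.trans Finset.sdiff_subset)), Finset.sum_union huv]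
        simp only [α, β, c']
        ring
      have hout : ∀ j ∈ splitᶜ, α j u + β j v =
          (if outer j then 1 else α j u) * (if outer j then c' j + β j v else 1) := by
        intro j hj
        split_ifs with ho
        · have : ∑ r ∈ u, coeff j r = 0 := by
            refine Finset.sum_eq_zero fun r hr => ?_
            by_contra hne
            simp only [split, Finset.mem_compl, Finset.mem_filter, Finset.mem_univ, true_and] at hj
            exact hj ⟨⟨r, hu hr, hcol j r hne⟩, ho⟩
          simp [α, this]
        · have : β j v = 0 := by
            refine Finset.sum_eq_zero fun r hr => ?_
            by_contra hne
            exact ho ⟨r, hv hr, hcol j r hne⟩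
          simp [this]
      simp only [hfac]
      rw [← Finset.prod_compl_mul_prod split, Finset.prod_congr rfl hout, Finset.prod_mul_distrib,
        Finset.prod_add, Finset.mul_sum]
      refine Finset.sum_congr rfl fun τ _ => ?_
      ring)
  obtain ⟨G, hGR, hG⟩ := hrank
  refine ⟨G, hGR.trans ?_, hG⟩
  rw [Finset.card_powerset]
  exact (Nat.pow_le_pow_right (by norm_num) hsplit).trans (by norm_num)

end Rank

/-! ### Evaluation of sums of circuits -/

section Eval

variable {F A : Type*} [Field F] [CommRing A] {n c k : ℕ}

/-- The value of a sum of circuits at a point with coordinates in an extension of the field. -/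
def evalSum (C : Fin c → Depth3Circuit F n k) (φ : F →+* A) (x : Fin n → A) : A :=
  ∑ s, ∑ i, φ ((C s).top i) *
    ∏ j, (φ ((C s).const i j) + ∑ r, φ ((C s).coeff i j r) * x r)

theorem evalSum_eq_eval₂Hom (C : Fin c → Depth3Circuit F n k) (φ : F →+* A) (x : Fin n → A) :
    evalSum C φ x = MvPolynomial.eval₂Hom φ x (∑ s, (C s).poly) := by
  simp [evalSum, Depth3Circuit.poly, Depth3Circuit.factor]

theorem map_evalSum {A' : Type*} [CommRing A'] (C : Fin c → Depth3Circuit F n k) (φ : F →+* A)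
    (ψ : A →+* A') (x : Fin n → A) :
    ψ (evalSum C φ x) = evalSum C (ψ.comp φ) fun r => ψ (x r) := by
  simp [evalSum]

/-- Each variable occurs in at most one factor of a product gate, namely that of its color, and only
to the first power. -/
theorem multiAffine_evalSum (C : Fin c → Depth3Circuit F n k) (φ : F →+* A)
    (col : Fin c → Fin n → ℕ) (hcol : ∀ s i j r, (C s).coeff i j r ≠ 0 → col s r = j) :
    MultiAffine (evalSum C φ) := by
  intro x r a
  simp only [evalSum, ← Finset.sum_sub_distrib, Finset.mul_sum, ← Finset.sum_add_distrib]
  refine Finset.sum_congr rfl fun s _ => Finset.sum_congr rfl fun i _ => ?_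
  have hlin : ∀ j y, ∑ r', φ ((C s).coeff i j r') * Function.update x r y r' =
      φ ((C s).coeff i j r) * y + ∑ r' ∈ Finset.univ.erase r, φ ((C s).coeff i j r') * x r' := by
    intro j y
    rw [← Finset.add_sum_erase _ _ (Finset.mem_univ r), Function.update_self]
    congr 1
    refine Finset.sum_congr rfl fun r' hr' => ?_
    rw [Function.update_of_ne (Finset.ne_of_mem_erase hr')]
  simp only [hlin]
  by_cases hj : ∃ j : Fin (C s).d, (j : ℕ) = col s r
  · obtain ⟨j₀, hj₀⟩ := hj
    have hprod : ∀ y, ∏ j, (φ ((C s).const i j) + (φ ((C s).coeff i j r) * y +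
        ∑ r' ∈ Finset.univ.erase r, φ ((C s).coeff i j r') * x r')) =
        (φ ((C s).const i j₀) + (φ ((C s).coeff i j₀ r) * y +
          ∑ r' ∈ Finset.univ.erase r, φ ((C s).coeff i j₀ r') * x r')) *
        ∏ j ∈ Finset.univ.erase j₀, (φ ((C s).const i j) +
          ∑ r' ∈ Finset.univ.erase r, φ ((C s).coeff i j r') * x r') := by
      intro y
      rw [← Finset.mul_prod_erase _ _ (Finset.mem_univ j₀)]
      congr 1
      refine Finset.prod_congr rfl fun j hj => ?_
      have h0 : (C s).coeff i j r = 0 := by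
        by_contra hne
        exact Finset.ne_of_mem_erase hj (Fin.ext ((hcol s i j r hne).symm.trans hj₀.symm))
      rw [h0, map_zero, zero_mul, zero_add]
    rw [hprod, hprod, hprod]
    ring
  · have h0 : ∀ j, (C s).coeff i j r = 0 := by
      intro j
      by_contra hne
      exact hj ⟨j, (hcol s i j r hne).symm⟩
    simp [h0]

/-- Rank is subadditive: there are `c * k` product gates, each contributing at most 4. Different
circuits may split different colors, and the partitions need not be related. -/
theorem partialRankLE_evalSum {E : Type*} [Field E] (C : Fin c → Depth3Circuit F n k)
    (φ : F →+* E) (col : Fin c → Fin n → ℕ)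
    (hcol : ∀ s i j r, (C s).coeff i j r ≠ 0 → col s r = j) (x : Fin n → E)
    {B I : Finset (Fin n)} (hI : I ⊆ B)
    (hsplit : ∀ s, (Finset.univ.filter fun j : Fin (C s).d =>
      (∃ r ∈ I, col s r = j) ∧ ∃ r ∈ B \ I, col s r = j).card ≤ 2) :
    PartialRankLE B I (fun T => evalSum C φ (indicatorPoint x B T)) (c * (k * 4)) := by
  have h := PartialRankLE.sum (s := Finset.univ)
    (p := fun s T => ∑ i, φ ((C s).top i) * ∏ j, (φ ((C s).const i j) +
      ∑ r, φ ((C s).coeff i j r) * indicatorPoint x B T r)) (B := B) (I := I) (R := k * 4) (by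
    intro s _
    have h' := PartialRankLE.sum (s := Finset.univ)
      (p := fun i T => φ ((C s).top i) * ∏ j, (φ ((C s).const i j) +
        ∑ r, φ ((C s).coeff i j r) * indicatorPoint x B T r)) (B := B) (I := I) (R := 4) (by
      intro i _
      refine (partialRankLE_prod _ _ (col s) (fun j r hne => ?_) x hI (by convert hsplit s)).const_mul _
      refine hcol s i j r fun h0 => hne ?_
      rw [h0, map_zero])
    simpa using h')
  simpa [evalSum] using h

end Eval

/-! ### Base sets -/

section BaseSets

/-- The number of elements of `A` that precede `r` in its color class. -/
def classIndex (κ : ℕ → ℕ) (A : Finset ℕ) (r : ℕ) : ℕ :=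
  (A.filter fun r' => r' < r ∧ κ r' = κ r).card

/-- For `g < n` the color class `g` in `A`; for `g = n + i` the elements of index `i` in their
classes. -/
def refineStep (n : ℕ) (κ : ℕ → ℕ) (A : Finset ℕ) (g : ℕ) : Finset ℕ :=
  A.filter fun r => g = κ r ∨ g = n + classIndex κ A r

/-- Successive refinement of `A` with respect to the colorings `col 0, …, col (q - 1)`. -/
def refineSet (n : ℕ) (col : ℕ → ℕ → ℕ) (g : ℕ → ℕ) (A : Finset ℕ) : ℕ → Finset ℕ
  | 0 => A
  | s + 1 => refineStep n (col s) (refineSet n col g A s) (g s)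

variable {n : ℕ}

/-- Peels off the first coloring instead of the last, as needed for the recursion in `exists_cover`.
-/
theorem refineSet_succ' (col : ℕ → ℕ → ℕ) (g : ℕ → ℕ) (A : Finset ℕ) (q : ℕ) :
    refineSet n col g A (q + 1) =
      refineSet n (fun s => col (s + 1)) (fun s => g (s + 1)) (refineStep n (col 0) A (g 0)) q := by
  induction q with
  | zero => rfl
  | succ q ih => rw [refineSet, ih, refineSet]

theorem refineSet_congr {col : ℕ → ℕ → ℕ} {g g' : ℕ → ℕ} {A : Finset ℕ} {q : ℕ}
    (h : ∀ s < q, g s = g' s) : refineSet n col g A q = refineSet n col g' A q := by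
  induction q with
  | zero => rfl
  | succ q ih => rw [refineSet, refineSet, ih fun s hs => h s (by omega), h q (by omega)]

theorem refineSet_antitone (col : ℕ → ℕ → ℕ) (g : ℕ → ℕ) (A : Finset ℕ) :
    Antitone (refineSet n col g A) :=
  antitone_nat_of_succ_le fun _ => Finset.filter_subset _ _

theorem classIndex_lt_classIndex {κ : ℕ → ℕ} {A : Finset ℕ} {r r' : ℕ} (hr : r ∈ A)
    (hκ : κ r = κ r') (h : r < r') : classIndex κ A r < classIndex κ A r' := by
  refine Finset.card_lt_card (Finset.ssubset_iff_of_subset ?_ |>.2 ⟨r, ?_, ?_⟩)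
  · intro x hx
    simp only [Finset.mem_filter] at hx ⊢
    exact ⟨hx.1, hx.2.1.trans h, hx.2.2.trans hκ⟩
  · simp [hr, h, hκ]
  · simp

theorem classIndex_lt {κ : ℕ → ℕ} {A : Finset ℕ} {r : ℕ} (hr : r ∈ A) :
    classIndex κ A r < (A.filter fun r' => κ r' = κ r).card := by
  refine Finset.card_lt_card (Finset.ssubset_iff_of_subset ?_ |>.2 ⟨r, ?_, ?_⟩)
  · intro x hx
    simp only [Finset.mem_filter] at hx ⊢
    exact ⟨hx.1, hx.2.2⟩
  · simp [hr]
  · simp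

/-- On a refined set each of the colorings is constant or injective. -/
theorem refineSet_constant_or_injOn {col : ℕ → ℕ → ℕ} {g : ℕ → ℕ} {A : Finset ℕ} {s q : ℕ}
    (hs : s < q) (hcol : ∀ r ∈ A, col s r < n) :
    (∀ r ∈ refineSet n col g A q, ∀ r' ∈ refineSet n col g A q, col s r = col s r') ∨
      Set.InjOn (col s) (refineSet n col g A q : Set ℕ) := by
  have hsub : refineSet n col g A q ⊆ refineSet n col g A (s + 1) := refineSet_antitone col g A hs
  have hA : refineSet n col g A s ⊆ A := refineSet_antitone col g A (Nat.zero_le s)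
  have hmem : ∀ r ∈ refineSet n col g A q, r ∈ refineSet n col g A s ∧
      (g s = col s r ∨ g s = n + classIndex (col s) (refineSet n col g A s) r) := fun r hr =>
    Finset.mem_filter.1 (hsub hr)
  by_cases hg : g s < n
  · left
    intro r hr r' hr'
    have h1 := (hmem r hr).2.resolve_right (by omega)
    have h2 := (hmem r' hr').2.resolve_right (by omega)
    exact h1.symm.trans h2
  · right
    intro r hr r' hr' heq
    obtain ⟨h1, h1'⟩ := hmem r hr
    obtain ⟨h2, h2'⟩ := hmem r' hr'
    have h3 := h1'.resolve_left (by have := hcol r (hA h1); omega)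
    have h4 := h2'.resolve_left (by have := hcol r' (hA h2); omega)
    rcases lt_trichotomy r r' with h | h | h
    · have := classIndex_lt_classIndex h1 heq h; omega
    · exact h
    · have := classIndex_lt_classIndex h2 heq.symm h; omega

theorem refineStep_eq_class {κ : ℕ → ℕ} {A : Finset ℕ} {g : ℕ} (hg : g < n) :
    refineStep n κ A g = A.filter fun r => κ r = g := by
  refine Finset.filter_congr fun r _ => ?_
  constructor
  · rintro (h | h)
    · exact h.symm
    · omega
  · exact fun h => Or.inl h.symm

theorem refineStep_eq_index {κ : ℕ → ℕ} {A : Finset ℕ} (hκ : ∀ r ∈ A, κ r < n) (i : ℕ) :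
    refineStep n κ A (n + i) = A.filter fun r => classIndex κ A r = i := by
  refine Finset.filter_congr fun r hr => ?_
  have := hκ r hr
  omega

theorem sum_card_fiber_le {A : Finset ℕ} (κ : ℕ → ℕ) (J : Finset ℕ) :
    ∑ j ∈ J, (A.filter fun r => κ r = j).card ≤ A.card := by
  rw [← Finset.card_biUnion]
  · exact Finset.card_le_card (Finset.biUnion_subset.2 fun j _ => Finset.filter_subset _ _)
  · intro j _ j' _ hne
    rw [Function.onFun, Finset.disjoint_left]
    intro r hr hr'
    exact hne ((Finset.mem_filter.1 hr).2.symm.trans (Finset.mem_filter.1 hr').2)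

/-- A set with `q` colorings is covered by few refined sets. -/
theorem exists_cover (b : ℕ) (q : ℕ) (A : Finset ℕ) (col : ℕ → ℕ → ℕ)
    (hA : A ⊆ Finset.range n) (hcol : ∀ s < q, ∀ r ∈ A, col s r < n) :
    ∃ G : Finset (ℕ → ℕ), (∀ g ∈ G, ∀ s < q, g s < 2 * n) ∧
      (∀ r ∈ A, ∃ g ∈ G, r ∈ refineSet n col g A q) ∧
      b * G.card + A.card ≤ 2 ^ q * A.card + b ^ 2 ^ q := by
  classical
  induction q generalizing A col with
  | zero =>
    refine ⟨{fun _ => 0}, by simp, fun r hr => ⟨_, Finset.mem_singleton_self _, hr⟩, ?_⟩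
    simp; omega
  | succ q ih =>
    -- The threshold is the additive cost of covering one piece with the remaining `q` colorings.
    -- Classes of at least `T` elements are pieces of their own; elements of smaller classes have an
    -- index below `T` and lie in one of the transversals.
    set T := b ^ 2 ^ q with hT
    let big := (Finset.range n).filter fun j => T ≤ (A.filter fun r => col 0 r = j).card
    let J := big ∪ (Finset.range (min T n)).image fun i => n + i
    have hstep : ∀ j, ∃ G : Finset (ℕ → ℕ), (∀ g ∈ G, ∀ s < q, g s < 2 * n) ∧
        (∀ r ∈ refineStep n (col 0) A j, ∃ g ∈ G,
          r ∈ refineSet n (fun s => col (s + 1)) g (refineStep n (col 0) A j) q) ∧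
        b * G.card + (refineStep n (col 0) A j).card ≤
          2 ^ q * (refineStep n (col 0) A j).card + T := fun j =>
      ih _ _ ((Finset.filter_subset _ _).trans hA) fun s hs r hr =>
        hcol (s + 1) (by omega) r (Finset.filter_subset _ _ hr)
    choose G hG2 hGcover hGcard using hstep
    let cons : ℕ → (ℕ → ℕ) → ℕ → ℕ := fun j h s => Nat.casesOn s j h
    have hκ : ∀ r ∈ A, col 0 r < n := hcol 0 (by omega)
    refine ⟨J.biUnion fun j => (G j).image (cons j), ?_, ?_, ?_⟩
    · intro g hg s hs
      obtain ⟨j, hj, hg⟩ := Finset.mem_biUnion.1 hg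
      obtain ⟨h, hh, rfl⟩ := Finset.mem_image.1 hg
      rcases s with _ | s
      · rcases Finset.mem_union.1 hj with hj | hj
        · have := Finset.mem_range.1 (Finset.mem_filter.1 hj).1
          show j < 2 * n
          omega
        · obtain ⟨i, hi, rfl⟩ := Finset.mem_image.1 hj
          have := Finset.mem_range.1 hi
          show n + i < 2 * n
          omega
      · exact hG2 j h hh s (by omega)
    · intro r hr
      have hex : ∃ j ∈ J, r ∈ refineStep n (col 0) A j := by
        by_cases hbig : T ≤ (A.filter fun r' => col 0 r' = col 0 r).card
        · refine ⟨col 0 r, Finset.mem_union_left _ (Finset.mem_filter.2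
            ⟨Finset.mem_range.2 (hκ r hr), hbig⟩), Finset.mem_filter.2 ⟨hr, Or.inl rfl⟩⟩
        · refine ⟨n + classIndex (col 0) A r, Finset.mem_union_right _ (Finset.mem_image.2
            ⟨_, Finset.mem_range.2 (lt_min ?_ ?_), rfl⟩), Finset.mem_filter.2 ⟨hr, Or.inr rfl⟩⟩
          · exact (classIndex_lt hr).trans (not_le.1 hbig)
          · refine (classIndex_lt hr).trans_le ((Finset.card_le_card
              ((Finset.filter_subset _ _).trans hA)).trans ?_)
            simp
      obtain ⟨j, hj, hrj⟩ := hex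
      obtain ⟨h, hh, hrh⟩ := hGcover j r hrj
      refine ⟨cons j h, Finset.mem_biUnion.2 ⟨j, hj, Finset.mem_image_of_mem _ hh⟩, ?_⟩
      rw [refineSet_succ']
      exact hrh
    · have hcard : (J.biUnion fun j => (G j).image (cons j)).card ≤ ∑ j ∈ J, (G j).card :=
        Finset.card_biUnion_le.trans (Finset.sum_le_sum fun j _ => Finset.card_image_le)
      have hdisj : Disjoint big ((Finset.range (min T n)).image fun i => n + i) := by
        rw [Finset.disjoint_left]
        intro j hj hj'
        obtain ⟨i, _, rfl⟩ := Finset.mem_image.1 hj'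
        have := Finset.mem_range.1 (Finset.mem_filter.1 hj).1
        omega
      have hsplit : ∀ f : ℕ → ℕ, ∑ j ∈ J, f j =
          ∑ j ∈ big, f j + ∑ i ∈ Finset.range (min T n), f (n + i) := by
        intro f
        rw [Finset.sum_union hdisj, Finset.sum_image (by intro i _ i' _ h; simpa using h)]
      have hbig : ∑ j ∈ big, (refineStep n (col 0) A j).card ≤ A.card := by
        refine le_trans (le_of_eq ?_) (sum_card_fiber_le (A := A) (col 0) big)
        refine Finset.sum_congr rfl fun j hj => ?_
        rw [refineStep_eq_class (Finset.mem_range.1 (Finset.mem_filter.1 hj).1)]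
      have hidx : ∑ i ∈ Finset.range (min T n), (refineStep n (col 0) A (n + i)).card ≤ A.card := by
        refine le_trans (le_of_eq ?_)
          (sum_card_fiber_le (A := A) (classIndex (col 0) A) (Finset.range (min T n)))
        refine Finset.sum_congr rfl fun i _ => ?_
        rw [refineStep_eq_index hκ]
      have hbigT : big.card * T ≤ A.card := by
        refine le_trans ?_ (sum_card_fiber_le (A := A) (col 0) big)
        rw [← smul_eq_mul]
        exact Finset.card_nsmul_le_sum _ _ _ fun j hj => (Finset.mem_filter.1 hj).2
      have hmin : min T n * T ≤ T * T := Nat.mul_le_mul_right _ (min_le_left _ _)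
      -- Distinct classes are disjoint, and so are the sets of distinct indices, but a class may
      -- meet an index set. This gives the factor 2 per coloring.
      have hJ : (∑ j ∈ J, (refineStep n (col 0) A j).card) ≤ 2 * A.card := by
        rw [hsplit]; omega
      have hJT : J.card * T ≤ A.card + T * T := by
        have : J.card = big.card + min T n := by
          have := hsplit fun _ => 1
          simpa using this
        rw [this, add_mul]
        omega
      have hsum : b * ∑ j ∈ J, (G j).card + ∑ j ∈ J, (refineStep n (col 0) A j).card ≤
          2 ^ q * ∑ j ∈ J, (refineStep n (col 0) A j).card + J.card * T := by
        rw [Finset.mul_sum, Finset.mul_sum, ← smul_eq_mul (a := J.card), ← Finset.sum_const,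
          ← Finset.sum_add_distrib, ← Finset.sum_add_distrib]
        exact Finset.sum_le_sum fun j _ => hGcard j
      have hmul := Nat.mul_le_mul_left b hcard
      have hTT : b ^ 2 ^ (q + 1) = T * T := by rw [hT, pow_succ, ← pow_add]; congr 1; omega
      rw [hTT, pow_succ]
      -- The summand `A.card` on the left of the claim makes the induction close: with `e = 2 ^ q -
      -- 1`, the cost is at most `e * (2 * A.card) + (A.card + T * T)`, which is `(2 ^ (q + 1) - 1)
      -- * A.card + T * T`.
      obtain ⟨e, he⟩ : ∃ e, 2 ^ q = e + 1 := ⟨2 ^ q - 1, by have := Nat.one_le_two_pow (n := q); omega⟩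
      rw [he] at hsum ⊢
      nlinarith [Nat.mul_le_mul_left e hJ]

end BaseSets

/-! ### Color classes split by dyadic blocks -/

section Split

variable {ι : Type*}

/-- A coloring that is constant, injective, or compatible with the positions of the elements. -/
def IsCompatible (B : Finset ι) (pos : ι → ℕ) (κ : ι → ℕ) : Prop :=
  (∀ r ∈ B, ∀ r' ∈ B, κ r = κ r') ∨ Set.InjOn κ (B : Set ι) ∨
    ∀ r ∈ B, ∀ r' ∈ B, κ r < κ r' → pos r < pos r'

theorem IsCompatible.mono {B B' : Finset ι} {pos κ : ι → ℕ} (h : IsCompatible B pos κ)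
    (hB : B' ⊆ B) : IsCompatible B' pos κ :=
  h.imp (fun h r hr r' hr' => h r (hB hr) r' (hB hr')) <|
    Or.imp (fun h => h.mono (by exact_mod_cast hB)) fun h r hr r' hr' => h r (hB hr) r' (hB hr')

/-- A constant coloring has a single class to split and an injective one has none. If the coloring
is compatible with the positions, classes occupy consecutive stretches, and an interval can cut one
at its left end and one at its right end. -/
theorem IsCompatible.card_split_le [DecidableEq ι] {B : Finset ι} {pos κ : ι → ℕ} (h : IsCompatible B pos κ)
    (i a d : ℕ) :
    (Finset.univ.filter fun j : Fin d => (∃ r ∈ dyadicBlock B pos i a, κ r = j) ∧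
      ∃ r ∈ B \ dyadicBlock B pos i a, κ r = j).card ≤ 2 := by
  classical
  have hI : ∀ {r}, r ∈ dyadicBlock B pos i a → r ∈ B ∧ pos r / 2 ^ i = a :=
    fun hr => Finset.mem_filter.1 hr
  have hJ : ∀ {r}, r ∈ B \ dyadicBlock B pos i a → r ∈ B ∧ pos r / 2 ^ i ≠ a := fun hr =>
    ⟨(Finset.mem_sdiff.1 hr).1, fun h' =>
      (Finset.mem_sdiff.1 hr).2 (Finset.mem_filter.2 ⟨(Finset.mem_sdiff.1 hr).1, h'⟩)⟩
  rcases h with h | h | h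
  · refine le_trans (Finset.card_le_one.2 ?_) one_le_two
    intro j hj j' hj'
    obtain ⟨⟨r, hr, hrj⟩, _⟩ := (Finset.mem_filter.1 hj).2
    obtain ⟨⟨r', hr', hrj'⟩, _⟩ := (Finset.mem_filter.1 hj').2
    exact Fin.ext (hrj.symm.trans ((h r (hI hr).1 r' (hI hr').1).trans hrj'))
  · refine le_trans (le_of_eq ?_) (Nat.zero_le 2)
    rw [Finset.card_eq_zero, Finset.filter_eq_empty_iff]
    rintro j _ ⟨⟨r, hr, hrj⟩, r', hr', hrj'⟩
    have := h (hI hr).1 (hJ hr').1 (hrj.trans hrj'.symm)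
    exact (hJ hr').2 (this ▸ (hI hr).2)
  · let left := Finset.univ.filter fun j : Fin d => (∃ r ∈ dyadicBlock B pos i a, κ r = j) ∧
      ∃ r ∈ B, pos r / 2 ^ i < a ∧ κ r = j
    let right := Finset.univ.filter fun j : Fin d => (∃ r ∈ dyadicBlock B pos i a, κ r = j) ∧
      ∃ r ∈ B, a < pos r / 2 ^ i ∧ κ r = j
    have hleft : left.card ≤ 1 := by
      refine Finset.card_le_one.2 fun j hj j' hj' => ?_
      by_contra hne
      wlog hlt : (j : ℕ) < j' generalizing j j'
      · exact this j' hj' j hj (Ne.symm hne)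
          (lt_of_le_of_ne (not_lt.1 hlt) fun h => hne (Fin.ext h.symm))
      obtain ⟨⟨r, hr, hrj⟩, _⟩ := (Finset.mem_filter.1 hj).2
      obtain ⟨_, r', hr', hlt', hrj'⟩ := (Finset.mem_filter.1 hj').2
      have h1 := h r (hI hr).1 r' hr' (by omega)
      have h2 : pos r / 2 ^ i ≤ pos r' / 2 ^ i := Nat.div_le_div_right h1.le
      have h3 := (hI hr).2
      omega
    have hright : right.card ≤ 1 := by
      refine Finset.card_le_one.2 fun j hj j' hj' => ?_
      by_contra hne
      wlog hlt : (j' : ℕ) < j generalizing j j'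
      · exact this j' hj' j hj (Ne.symm hne)
          (lt_of_le_of_ne (not_lt.1 hlt) fun h => hne (Fin.ext h))
      obtain ⟨⟨r, hr, hrj⟩, _⟩ := (Finset.mem_filter.1 hj).2
      obtain ⟨_, r', hr', hlt', hrj'⟩ := (Finset.mem_filter.1 hj').2
      have h1 := h r' hr' r (hI hr).1 (by omega)
      have h2 : pos r' / 2 ^ i ≤ pos r / 2 ^ i := Nat.div_le_div_right h1.le
      have h3 := (hI hr).2
      omega
    refine (Finset.card_le_card (t := left ∪ right) ?_).trans
      ((Finset.card_union_le _ _).trans (by omega))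
    intro j hj
    obtain ⟨hin, r, hr, hrj⟩ := (Finset.mem_filter.1 hj).2
    rcases lt_or_gt_of_ne (hJ hr).2 with hlt | hlt
    · exact Finset.mem_union_left _ (Finset.mem_filter.2
        ⟨Finset.mem_univ _, hin, r, (hJ hr).1, hlt, hrj⟩)
    · exact Finset.mem_union_right _ (Finset.mem_filter.2
        ⟨Finset.mem_univ _, hin, r, (hJ hr).1, hlt, hrj⟩)

end Split

/-! ### Substitutions that preserve nonzero sums of circuits -/

section Substitution

open Polynomial

universe u

variable {F : Type u} [Field F] {n c k : ℕ}

/-- The exponent of the variable `r` that belongs to the moduli `p 0 + 1, …, p (l - 1) + 1`. -/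
def residueWeight (X : ℕ) (p : ℕ → ℕ) (l r : ℕ) : ℕ :=
  horner X (fun i => powResidue (p i + 1) r) 0 l

/-- The weight of a whole monomial fits into `l` digits, so that weights of several stages can be
concatenated without carries. -/
theorem sum_horner_lt {ι : Type*} {X : ℕ} (S : Finset ι) (f : ℕ → ι → ℕ) (l : ℕ)
    (h : ∀ i < l, ∑ r ∈ S, f i r < X) :
    ∑ r ∈ S, horner X (fun i => f i r) 0 l < X ^ l := by
  induction l with
  | zero => simp [horner]
  | succ l ih =>
    rw [sum_horner_succ X f]
    have h1 := Nat.mul_le_mul_right X (Nat.succ_le_of_lt (ih fun i hi => h i (by omega)))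
    have h2 := h l (by omega)
    rw [Nat.succ_mul] at h1
    rw [pow_succ]
    omega

theorem sum_powResidue_lt {X p : ℕ} (hp : n * (p + 1) < X) (S : Finset (Fin n)) :
    ∑ r ∈ S, powResidue (p + 1) r < X := by
  refine lt_of_le_of_lt ?_ hp
  calc ∑ r ∈ S, powResidue (p + 1) r ≤ ∑ r : Fin n, powResidue (p + 1) r :=
        Finset.sum_le_sum_of_subset (Finset.subset_univ _)
    _ ≤ ∑ r : Fin n, (p + 1) := Finset.sum_le_sum fun r _ => powResidue_le (by omega) _
    _ = n * (p + 1) := by simp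

/-- The bound on the base of the weights that is needed for sums of `c` circuits with top fan-in
`k` in `n` variables. -/
def weightBase (n c k : ℕ) : ℕ :=
  n * (2 * (n * (n * ((c * (k * 4)) ^ 2) ^ 2) + 1))

/-- Combines the rank bound with the separating residues. A modulus is stored as its predecessor `p
i`, so that every natural number encodes an admissible one. -/
theorem exists_isolated_evalSum {E : Type*} [Field E] (C : Fin c → Depth3Circuit F n k)
    (hc : 1 ≤ c) (hk : 1 ≤ k) (φ : F →+* E) (col : Fin c → Fin n → ℕ)
    (hcol : ∀ s i j r, (C s).coeff i j r ≠ 0 → col s r = j) (e : Fin n → E)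
    (he : evalSum C φ e ≠ 0) (B : Finset (Fin n)) (pos : Fin n → ℕ) (hpos : pos.Injective)
    (hB : ∀ s, IsCompatible B pos (col s)) {l : ℕ} (hl : 1 ≤ l) (hposl : ∀ r, pos r < 2 ^ l)
    {X : ℕ} (hX : weightBase n c k < X) :
    ∃ p : ℕ → ℕ, (∀ i < l, n * (p i + 1) < X) ∧ ∃ s ⊆ B,
      moebius (fun T => evalSum C φ (indicatorPoint e B T)) s ≠ 0 ∧ ∀ S ⊆ B, S ≠ s →
        ∑ r ∈ S, residueWeight X p l r = ∑ r ∈ s, residueWeight X p l r →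
        moebius (fun T => evalSum C φ (indicatorPoint e B T)) S = 0 := by
  have hR : 2 ≤ c * (k * 4) := by nlinarith
  refine exists_isolated B (moebius fun T => evalSum C φ (indicatorPoint e B T)) ?_ pos
    hpos.injOn (c * (k * 4)) hR (fun i a => ?_) X (fun p r => powResidue (p + 1) r)
    (fun p => n * (p + 1) < X) (fun p hp => sum_powResidue_lt hp B) ?_ l hl fun r _ => hposl r
  · by_contra! hcon
    refine he ?_
    rw [(multiAffine_evalSum C φ col hcol).eq_sum B e]
    refine Finset.sum_eq_zero fun S hS => ?_
    rw [hcon S (Finset.mem_powerset.1 hS), mul_zero]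
  · have h : PartialRankLE B (dyadicBlock B pos i a)
        (fun T => evalSum C φ (indicatorPoint e B T)) (c * (k * 4)) :=
      partialRankLE_evalSum C φ col hcol e (dyadicBlock_subset B pos i a) fun s => by
        convert (hB s).card_split_le i a (C s).d
    exact h
  · intro A hA hne
    -- At most `n * R ^ 4` pairs with `R = 4ck` need separation, so `P ≤ 2 * h` for this `h`. The
    -- bound `n * P ≤ weightBase n c k < X` then prevents carries.
    obtain ⟨P, hP1, hP2, hP⟩ := exists_modulus_separating A hne
      (h := n * (n * ((c * (k * 4)) ^ 2) ^ 2) + 1) (by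
        refine Nat.lt_succ_of_le (Nat.mul_le_mul_left n (hA.trans (Nat.mul_le_mul_right _ ?_)))
        simpa using Finset.card_le_univ B)
    refine ⟨P - 1, ?_, ?_⟩
    · rw [Nat.sub_add_cancel hP1]
      exact (Nat.mul_le_mul_left n hP2).trans_lt hX
    · rw [Nat.sub_add_cancel hP1]
      exact hP

/-- The exponents of the substitution of powers of new variables for the variables in `B`. -/
def stageWeight (X l : ℕ) (B : Finset (Fin n)) (p : ℕ → ℕ) (r : Fin n) : ℕ :=
  if r ∈ B then residueWeight X p l r else 0

/-- The substitution can be extended by one base set. -/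
theorem exists_substitution_step {E : Type u} [Field E] (C : Fin c → Depth3Circuit F n k)
    (hc : 1 ≤ c) (hk : 1 ≤ k) (φ : F →+* E) (col : Fin c → Fin n → ℕ)
    (hcol : ∀ s i j r, (C s).coeff i j r ≠ 0 → col s r = j) (e : Fin n → E)
    (he : evalSum C φ e ≠ 0) (B : Finset (Fin n)) (pos : Fin n → ℕ) (hpos : pos.Injective)
    (hB : ∀ s, IsCompatible B pos (col s)) {l : ℕ} (hl : 1 ≤ l) (hposl : ∀ r, pos r < 2 ^ l)
    {X : ℕ} (hX : weightBase n c k < X) (y : Fin n → E) (hy : ∀ r, y r ≠ 0) :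
    ∃ p : ℕ → ℕ, (∀ i < l, n * (p i + 1) < X) ∧
      evalSum C ((algebraMap E (RatFunc E)).comp φ) (fun r => if r ∈ B then
        algebraMap E (RatFunc E) (y r) * RatFunc.X ^ residueWeight X p l r
        else algebraMap E (RatFunc E) (e r)) ≠ 0 := by
  obtain ⟨p, hp, s, hs, hne, hiso⟩ := exists_isolated_evalSum C hc hk φ col hcol e he B pos hpos hB
    hl hposl hX
  refine ⟨p, hp, ?_⟩
  set e' : Fin n → RatFunc E := fun r => if r ∈ B then
        algebraMap E (RatFunc E) (y r) * RatFunc.X ^ residueWeight X p l r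
        else algebraMap E (RatFunc E) (e r) with he'
  set f := moebius fun T => evalSum C φ (indicatorPoint e B T) with hf
  have hpoint : ∀ T, indicatorPoint e' B T =
      fun r => algebraMap E (RatFunc E) (indicatorPoint e B T r) := by
    intro T
    funext r
    simp only [indicatorPoint, he']
    split_ifs <;> simp
  have heq : evalSum C ((algebraMap E (RatFunc E)).comp φ) e' = algebraMap E[X] (RatFunc E)
      (∑ S ∈ B.powerset, monomial (∑ r ∈ S, residueWeight X p l r) ((∏ r ∈ S, y r) * f S)) := by
    rw [(multiAffine_evalSum C _ col hcol).eq_sum B e', map_sum]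
    refine Finset.sum_congr rfl fun S hS => ?_
    simp only [hpoint, ← map_evalSum]
    rw [map_moebius, ← hf, ← C_mul_X_pow_eq_monomial, map_mul, map_mul, map_mul, map_pow,
      RatFunc.algebraMap_X, RatFunc.algebraMap_C, RatFunc.algebraMap_C, map_prod]
    have hprod : ∏ r ∈ S, e' r = (∏ r ∈ S, RatFunc.C (y r)) *
        RatFunc.X ^ ∑ r ∈ S, residueWeight X p l r := by
      rw [← Finset.prod_pow_eq_pow_sum, ← Finset.prod_mul_distrib]
      refine Finset.prod_congr rfl fun r hr => ?_
      simp only [he', if_pos (Finset.mem_powerset.1 hS hr), RatFunc.algebraMap_eq_C]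
    rw [hprod, RatFunc.algebraMap_eq_C]
    ring
  rw [heq, Ne, FaithfulSMul.algebraMap_eq_zero_iff]
  intro h0
  -- Isolation leaves a single term at this exponent. The factors `y r` only rescale it by a nonzero
  -- scalar.
  have hcoeff := congrArg (fun P => P.coeff (∑ r ∈ s, residueWeight X p l r)) h0
  simp only [finsetSum_coeff, coeff_monomial, coeff_zero] at hcoeff
  rw [Finset.sum_eq_single s] at hcoeff
  · rw [if_pos rfl] at hcoeff
    exact mul_ne_zero (Finset.prod_ne_zero_iff.2 fun r _ => hy r) hne hcoeff
  · intro S hS hSs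
    split_ifs with h
    · rw [hiso S (Finset.mem_powerset.1 hS) hSs h, mul_zero]
    · rfl
  · intro h
    exact absurd (Finset.mem_powerset.2 hs) h

/-- A nonzero sum of circuits stays nonzero when powers of new variables are substituted for the
variables, provided that the variables are covered by compatible base sets. -/
theorem exists_substitution (C : Fin c → Depth3Circuit F n k) (hC : ∑ s, (C s).poly ≠ 0)
    (hc : 1 ≤ c) (hk : 1 ≤ k) (col : Fin c → Fin n → ℕ)
    (hcol : ∀ s i j r, (C s).coeff i j r ≠ 0 → col s r = j) (m : ℕ) (B : ℕ → Finset (Fin n))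
    (hcover : ∀ r, ∃ t < m, r ∈ B t) (pos : Fin n → ℕ) (hpos : pos.Injective)
    (hB : ∀ t < m, ∀ s, IsCompatible (B t) pos (col s)) {l : ℕ} (hl : 1 ≤ l)
    (hposl : ∀ r, pos r < 2 ^ l) {X : ℕ} (hX : weightBase n c k < X) (t : ℕ) (ht : t ≤ m) :
    ∃ (E : Type u) (_ : Field E) (φ : F →+* E) (e : Fin n → E) (z : ℕ → E) (p : ℕ → ℕ → ℕ),
      (∀ t' < t, ∀ i < l, n * (p t' i + 1) < X) ∧ evalSum C φ e ≠ 0 ∧ (∀ t', z t' ≠ 0) ∧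
      ∀ r, (∀ t', t ≤ t' → t' < m → r ∉ B t') →
        e r = ∏ t' ∈ Finset.range t, z t' ^ stageWeight X l (B t') (p t') r := by
  induction t with
  | zero =>
    -- The process starts at the generic point, where a nonzero polynomial does not vanish.
    refine ⟨FractionRing (MvPolynomial (Fin n) F), inferInstance,
      (algebraMap (MvPolynomial (Fin n) F) _).comp MvPolynomial.C,
      fun r => algebraMap (MvPolynomial (Fin n) F) _ (MvPolynomial.X r), fun _ => 1, fun _ _ => 0,
      by simp, ?_, by simp, fun r hr => ?_⟩
    · rw [← map_evalSum, evalSum_eq_eval₂Hom, Ne, FaithfulSMul.algebraMap_eq_zero_iff]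
      simpa using hC
    · obtain ⟨t', ht', hr'⟩ := hcover r
      exact absurd hr' (hr t' (Nat.zero_le _) ht')
  | succ t ih =>
    obtain ⟨E, _, φ, e, z, p, hp, he, hz, hproc⟩ := ih (by omega)
    classical
    -- Base sets may overlap. A variable stays generic until the last base set that contains it; the
    -- powers due to its earlier base sets are then supplied at once by `y`.
    let B' := (B t).filter fun r => ∀ t', t + 1 ≤ t' → t' < m → r ∉ B t'
    let y : Fin n → E := fun r => ∏ t' ∈ Finset.range t, z t' ^ stageWeight X l (B t') (p t') r
    obtain ⟨p', hp', he'⟩ := exists_substitution_step C hc hk φ col hcol e he B' pos hpos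
      (fun s => (hB t (by omega) s).mono (Finset.filter_subset _ _)) hl hposl hX y
      (fun r => Finset.prod_ne_zero_iff.2 fun t' _ => pow_ne_zero _ (hz t'))
    refine ⟨RatFunc E, inferInstance, _, _,
      fun t' => if t' < t then algebraMap E (RatFunc E) (z t') else RatFunc.X,
      Function.update p t p', fun t' ht' i hi => ?_, he', fun t' => ?_, fun r hr => ?_⟩
    · rcases Nat.lt_succ_iff_lt_or_eq.1 ht' with h | rfl
      · rw [Function.update_of_ne h.ne]; exact hp t' h i hi
      · rw [Function.update_self]; exact hp' i hi
    · show (if t' < t then algebraMap E (RatFunc E) (z t') else RatFunc.X) ≠ 0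
      split_ifs
      · simpa using hz t'
      · exact RatFunc.X_ne_zero
    · have hprod : ∏ t' ∈ Finset.range t,
          (if t' < t then algebraMap E (RatFunc E) (z t') else RatFunc.X) ^
            stageWeight X l (B t') (Function.update p t p' t') r =
          algebraMap E (RatFunc E) (y r) := by
        rw [map_prod]
        refine Finset.prod_congr rfl fun t' ht' => ?_
        have ht'' := Finset.mem_range.1 ht'
        rw [if_pos ht'', Function.update_of_ne ht''.ne, map_pow]
      rw [Finset.prod_range_succ, hprod, Function.update_self]
      simp only [lt_irrefl, if_false]
      by_cases hrt : r ∈ B t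
      · have hrB : r ∈ B' := Finset.mem_filter.2 ⟨hrt, hr⟩
        simp only [if_pos hrB, stageWeight, if_pos hrt]
      · have hrB : r ∉ B' := fun h => hrt (Finset.mem_filter.1 h).1
        simp only [if_neg hrB, stageWeight, if_neg hrt, pow_zero, mul_one]
        congr 1
        refine hproc r fun t' h1 h2 => ?_
        rcases Nat.eq_or_lt_of_le h1 with rfl | h1
        · exact hrt
        · exact hr t' h1 h2

/-- The exponent of the variable `r` after all stages. -/
def totalWeight (X l : ℕ) (B : ℕ → Finset (Fin n)) (p : ℕ → ℕ → ℕ) (r : Fin n) : ℕ → ℕ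
  | 0 => 0
  | t + 1 => totalWeight X l B p r t * X ^ l + stageWeight X l (B t) (p t) r

/-- The weights of the `m` stages become digits in base `X ^ l`, so monomials of equal total weight
have the same value at the point `e` of `exists_substitution`. Since the value at `e` is nonzero,
the coefficients in some weight class do not sum to zero. -/
theorem exists_coeff_evalSum_ne_zero (C : Fin c → Depth3Circuit F n k)
    (hC : ∑ s, (C s).poly ≠ 0)
    (hc : 1 ≤ c) (hk : 1 ≤ k) (col : Fin c → Fin n → ℕ)
    (hcol : ∀ s i j r, (C s).coeff i j r ≠ 0 → col s r = j) (m : ℕ) (B : ℕ → Finset (Fin n))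
    (hcover : ∀ r, ∃ t < m, r ∈ B t) (pos : Fin n → ℕ) (hpos : pos.Injective)
    (hB : ∀ t < m, ∀ s, IsCompatible (B t) pos (col s)) {l : ℕ} (hl : 1 ≤ l)
    (hposl : ∀ r, pos r < 2 ^ l) {X : ℕ} (hX : weightBase n c k < X) :
    ∃ p : ℕ → ℕ → ℕ, (∀ t < m, ∀ i < l, n * (p t i + 1) < X) ∧ ∃ v < (X ^ l) ^ m,
      (evalSum C (Polynomial.C : F →+* F[X])
        fun r => Polynomial.X ^ totalWeight X l B p r m).coeff v ≠ 0 := by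
  obtain ⟨E, _, φ, e, z, p, hp, he, hz, hproc⟩ := exists_substitution C hC hc hk col hcol m B hcover
    pos hpos hB hl hposl hX m le_rfl
  refine ⟨p, hp, ?_⟩
  have hstage : ∀ t < m, ∀ S : Finset (Fin n),
      ∑ r ∈ S, stageWeight X l (B t) (p t) r < X ^ l := by
    intro t ht S
    refine lt_of_le_of_lt (Finset.sum_le_sum (g := fun r : Fin n => residueWeight X (p t) l r)
      fun r _ => ?_) (sum_horner_lt S (fun i (r : Fin n) => powResidue (p t i + 1) r) l
        fun i hi => sum_powResidue_lt (hp t ht i hi) S)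
    rw [stageWeight]
    split_ifs
    · exact le_rfl
    · exact Nat.zero_le _
  have hsucc : ∀ t (S : Finset (Fin n)), ∑ r ∈ S, totalWeight X l B p r (t + 1) =
      (∑ r ∈ S, totalWeight X l B p r t) * X ^ l + ∑ r ∈ S, stageWeight X l (B t) (p t) r := by
    intro t S
    simp only [totalWeight]
    rw [Finset.sum_add_distrib, Finset.sum_mul]
  have hlt : ∀ t ≤ m, ∀ S : Finset (Fin n), ∑ r ∈ S, totalWeight X l B p r t < (X ^ l) ^ t := by
    intro t
    induction t with
    | zero => intro _ S; simp [totalWeight]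
    | succ t ih =>
      intro ht S
      have h1 := Nat.mul_le_mul_right (X ^ l) (Nat.succ_le_of_lt (ih (by omega) S))
      have h2 := hstage t (by omega) S
      rw [Nat.succ_mul] at h1
      rw [hsucc, pow_succ]
      omega
  have hdigits : ∀ t ≤ m, ∀ S S' : Finset (Fin n),
      ∑ r ∈ S, totalWeight X l B p r t = ∑ r ∈ S', totalWeight X l B p r t →
      ∀ t' < t, ∑ r ∈ S, stageWeight X l (B t') (p t') r =
        ∑ r ∈ S', stageWeight X l (B t') (p t') r := by
    intro t
    induction t with
    | zero => intro _ _ _ _ t' ht'; omega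
    | succ t ih =>
      intro ht S S' heq t' ht'
      rw [hsucc, hsucc] at heq
      have h1 := hstage t (by omega) S
      have h2 := hstage t (by omega) S'
      have hpos : 0 < X ^ l := by omega
      rcases Nat.lt_succ_iff_lt_or_eq.1 ht' with h | rfl
      · refine ih (by omega) S S' ?_ t' h
        have h3 := congrArg (· / X ^ l) heq
        simp only [mul_comm _ (X ^ l), Nat.mul_add_div hpos,
          Nat.div_eq_of_lt h1, Nat.div_eq_of_lt h2, add_zero] at h3
        exact h3
      · have h3 := congrArg (· % X ^ l) heq
        simpa [Nat.mul_add_mod_self_right, Nat.mod_eq_of_lt h1, Nat.mod_eq_of_lt h2] using h3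
  by_contra! hcon
  refine he ?_
  set cf : Finset (Fin n) → F := moebius fun T =>
    evalSum C (RingHom.id F) (indicatorPoint (fun _ => 0) Finset.univ T) with hcf
  have hexp : ∀ {A : Type u} [CommRing A] (ψ : F →+* A) (x : Fin n → A),
      evalSum C ψ x = ∑ S : Finset (Fin n), (∏ r ∈ S, x r) * ψ (cf S) := by
    intro A _ ψ x
    rw [(multiAffine_evalSum C ψ col hcol).eq_sum Finset.univ x, Finset.powerset_univ]
    refine Finset.sum_congr rfl fun S _ => ?_
    rw [hcf, ← map_moebius]
    refine congrArg _ (moebius_congr fun T _ => ?_)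
    rw [map_evalSum, RingHom.comp_id]
    congr 1
    funext r
    simp only [indicatorPoint, Finset.mem_univ, if_true]
    split_ifs <;> simp
  set W : Finset (Fin n) → ℕ := fun S => ∑ r ∈ S, totalWeight X l B p r m with hW
  have hfiber : ∀ v < (X ^ l) ^ m, ∑ S : Finset (Fin n) with W S = v, cf S = 0 := by
    intro v hv
    have h := hcon v hv
    rw [hexp] at h
    simp only [Finset.prod_pow_eq_pow_sum, mul_comm _ (Polynomial.C _), finsetSum_coeff,
      coeff_C_mul_X_pow] at h
    rw [Finset.sum_filter]
    simpa only [hW, eq_comm] using h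
  have hzW : ∀ S : Finset (Fin n), ∏ r ∈ S, e r =
      ∏ t ∈ Finset.range m, z t ^ ∑ r ∈ S, stageWeight X l (B t) (p t) r := by
    intro S
    simp only [← Finset.prod_pow_eq_pow_sum]
    rw [Finset.prod_comm]
    exact Finset.prod_congr rfl fun r _ => hproc r fun t' h1 h2 => by omega
  rw [hexp, ← Finset.sum_fiberwise_of_maps_to (g := W) (t := Finset.range ((X ^ l) ^ m))
    fun S _ => Finset.mem_range.2 (hlt m le_rfl S)]
  refine Finset.sum_eq_zero fun v hv => ?_
  by_cases hne : ∃ S₀, W S₀ = v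
  · obtain ⟨S₀, rfl⟩ := hne
    -- By `hdigits`, equal total weight forces equal exponents of every `z t`, so the monomial value
    -- factors out of the fiber sum.
    have hconst : ∀ S ∈ Finset.univ.filter (fun S => W S = W S₀),
        (∏ r ∈ S, e r) * φ (cf S) = (∏ r ∈ S₀, e r) * φ (cf S) := by
      intro S hS
      rw [hzW, hzW]
      congr 1
      refine Finset.prod_congr rfl fun t ht => ?_
      rw [hdigits m le_rfl S S₀ (Finset.mem_filter.1 hS).2 t (Finset.mem_range.1 ht)]
    rw [Finset.sum_congr rfl hconst, ← Finset.mul_sum, ← map_sum,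
      hfiber _ (Finset.mem_range.1 hv), map_zero, mul_zero]
  · push Not at hne
    rw [Finset.sum_eq_zero]
    intro S hS
    exact absurd (Finset.mem_filter.1 hS).2 (hne S)

end Substitution

/-! ### Encoding the choices of base sets and moduli by one number -/

section Codes

/-- The `i`-th digit of `a` in base `X`. -/
def digit (X a i : ℕ) : ℕ := a / X ^ i % X

theorem exists_digits {X : ℕ} (N : ℕ) (δ : ℕ → ℕ) (hδ : ∀ j < N, δ j < X) :
    ∃ a < X ^ N, ∀ j < N, digit X a j = δ j := by
  induction N generalizing δ with
  | zero => exact ⟨0, by simp, by simp⟩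
  | succ N ih =>
    obtain ⟨a, ha, hdig⟩ := ih (fun j => δ (j + 1)) fun j hj => hδ (j + 1) (by omega)
    have h0 := hδ 0 (by omega)
    refine ⟨δ 0 + X * a, ?_, fun j hj => ?_⟩
    · have := Nat.mul_le_mul_left X (Nat.succ_le_of_lt ha)
      rw [Nat.mul_succ] at this
      rw [pow_succ, mul_comm (X ^ N)]
      omega
    · rcases j with _ | j
      · simp [digit, Nat.mod_eq_of_lt h0]
      · rw [← hdig j (by omega), digit, digit, pow_succ, mul_comm (X ^ j), ← Nat.div_div_eq_div_mul,
          Nat.add_mul_div_left _ _ (by omega), Nat.div_eq_of_lt h0, zero_add]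

/-- The base set that is chosen by the digits of `a` from position `o` on. -/
def codeSet (n X : ℕ) (col : ℕ → ℕ → ℕ) (a o : ℕ) : ℕ → Finset ℕ :=
  fun s => refineSet n col (fun s => digit X a (o + s)) (Finset.range n) s

/-- The exponent of the variable `r` after `t` stages, according to the digits of `a`. -/
def codeWeight (n q l X : ℕ) (col : ℕ → ℕ → ℕ) (a r : ℕ) : ℕ → ℕ
  | 0 => 0
  | t + 1 => horner X (fun i => if r ∈ codeSet n X col a (t * (q + l)) q then
      powResidue (digit X a (t * (q + l) + q + i) + 1) r else 0) (codeWeight n q l X col a r t) l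

open Polynomial

universe u

variable {F : Type u} [Field F] {n c k : ℕ}

/-- Completeness of the search. Each stage uses `c - 1` digits for its base set and `l` for its
moduli. The nonzero coefficient lies below the number of codes, so one bound serves for both loops.
-/
theorem exists_code (C : Fin c → Depth3Circuit F n k) (hC : ∑ s, (C s).poly ≠ 0) (hn : 1 ≤ n)
    (hc : 1 ≤ c) (hk : 1 ≤ k) (col : ℕ → ℕ → ℕ) (hcoln : ∀ s < c, ∀ r < n, col s r < n)
    (hcol : ∀ (s : Fin c) i j (r : Fin n), (C s).coeff i j r ≠ 0 → col s r = j)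
    {b m l X : ℕ} (hb : 1 ≤ b) (hbn : b ^ 2 ^ (c - 1) ≤ n)
    (hm : m = n ∨ 2 ^ (c - 1) * n ≤ b * m) (hl : 1 ≤ l) (hnl : n * n ≤ 2 ^ l)
    (hX : weightBase n c k < X) (hX' : 2 * n ≤ X) :
    ∃ a < X ^ (m * (c - 1 + l)), ∃ v < X ^ (m * (c - 1 + l)), (evalSum C (Polynomial.C : F →+* F[X])
      fun r => Polynomial.X ^ codeWeight n (c - 1) l X col a r m).coeff v ≠ 0 := by
  set q := c - 1 with hq
  obtain ⟨G, hG2, hGcover, hGcard⟩ := exists_cover b q (Finset.range n) col (Finset.Subset.refl _)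
    fun s hs r hr => hcoln s (by omega) r (Finset.mem_range.1 hr)
  rw [Finset.card_range] at hGcard
  -- If `m = n`, one base set per variable suffices. Otherwise `b * G.card ≤ 2 ^ q * n ≤ b * m`
  -- makes room for all of `G`, and spare stages repeat one of its members.
  have hgs : ∃ gs : ℕ → ℕ → ℕ, (∀ t < m, gs t ∈ G) ∧
      ∀ r < n, ∃ t < m, r ∈ refineSet n col (gs t) (Finset.range n) q := by
    rcases hm with rfl | hm
    · choose! g hg hrg using hGcover
      exact ⟨g, fun t ht => hg t (Finset.mem_range.2 ht),
        fun r hr => ⟨r, hr, hrg r (Finset.mem_range.2 hr)⟩⟩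
    · obtain ⟨g₀, hg₀, _⟩ := hGcover 0 (Finset.mem_range.2 hn)
      have hGm : G.card ≤ m := Nat.le_of_mul_le_mul_left (c := b) (by omega) hb
      refine ⟨fun t => G.toList.getD t g₀, fun t _ => ?_, fun r hr => ?_⟩
      · rcases lt_or_ge t G.toList.length with h | h
        · show G.toList.getD t g₀ ∈ G
          rw [List.getD_eq_getElem _ _ h]
          exact Finset.mem_toList.1 (List.getElem_mem h)
        · show G.toList.getD t g₀ ∈ G
          rw [List.getD_eq_default _ _ h]
          exact hg₀
      · obtain ⟨g, hg, hrg⟩ := hGcover r (Finset.mem_range.2 hr)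
        obtain ⟨t, ht, rfl⟩ := List.mem_iff_getElem.1 (Finset.mem_toList.2 hg)
        refine ⟨t, ?_, ?_⟩
        · rw [Finset.length_toList] at ht; omega
        · show r ∈ refineSet n col (G.toList.getD t g₀) (Finset.range n) q
          rw [List.getD_eq_getElem _ _ ht]
          exact hrg
  obtain ⟨gs, hgsG, hgscover⟩ := hgs
  let B : ℕ → Finset (Fin n) := fun t =>
    Finset.univ.filter fun r : Fin n => (r : ℕ) ∈ refineSet n col (gs t) (Finset.range n) q
  -- Sorting by the last color, with ties broken by the name of the variable. The positions lie
  -- below `n * n`, whence twice as many dyadic levels as for `n` positions.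
  let pos : Fin n → ℕ := fun r => col q r * n + r
  have hposinj : pos.Injective := by
    intro r r' h
    have h1 := congrArg (· % n) h
    simp only [pos, Nat.mul_add_mod_self_right, Nat.mod_eq_of_lt r.2, Nat.mod_eq_of_lt r'.2] at h1
    exact Fin.ext h1
  have hposlt : ∀ r, pos r < 2 ^ l := by
    intro r
    have h1 := Nat.mul_le_mul_right n (Nat.succ_le_of_lt (hcoln q (by omega) r r.2))
    rw [Nat.succ_mul] at h1
    have := r.2
    simp only [pos]
    omega
  obtain ⟨p, hp, v, hv, hne⟩ := exists_coeff_evalSum_ne_zero C hC hc hk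
    (fun s r => col s r) hcol m B (fun r => by
      obtain ⟨t, ht, hr⟩ := hgscover r r.2
      exact ⟨t, ht, Finset.mem_filter.2 ⟨Finset.mem_univ _, hr⟩⟩) pos hposinj (fun t _ s => by
      rcases Nat.lt_or_ge s q with hs | hs
      · rcases refineSet_constant_or_injOn (g := gs t) (A := Finset.range n) hs
          (fun r hr => hcoln s s.2 r (Finset.mem_range.1 hr)) with h | h
        · exact Or.inl fun r hr r' hr' =>
            h r (Finset.mem_filter.1 hr).2 r' (Finset.mem_filter.1 hr').2
        · exact Or.inr (Or.inl fun r hr r' hr' heq =>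
            Fin.ext (h (Finset.mem_filter.1 hr).2 (Finset.mem_filter.1 hr').2 heq))
      · have hsq : (s : ℕ) = q := by have := s.2; omega
        refine Or.inr (Or.inr fun r _ r' _ hlt => ?_)
        simp only [hsq] at hlt
        have h1 := Nat.mul_le_mul_right n (Nat.succ_le_of_lt hlt)
        rw [Nat.succ_mul] at h1
        have := r.2
        simp only [pos]
        omega) hl hposlt hX
  have hpX : ∀ t < m, ∀ i < l, p t i < X := fun t ht i hi => by
    have := hp t ht i hi
    nlinarith
  let δ : ℕ → ℕ := fun j => if j % (q + l) < q then gs (j / (q + l)) (j % (q + l))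
    else p (j / (q + l)) (j % (q + l) - q)
  obtain ⟨a, ha, hdig⟩ := exists_digits (X := X) (m * (q + l)) δ (by
    intro j hj
    have hlt : j / (q + l) < m := Nat.div_lt_of_lt_mul (by rwa [mul_comm])
    have hmod := Nat.mod_lt j (y := q + l) (by omega)
    simp only [δ]
    split_ifs with h
    · exact (hG2 _ (hgsG _ hlt) _ h).trans_le hX'
    · exact hpX _ hlt _ (by omega))
  have hdig' : ∀ t < m, ∀ i < q + l, digit X a (t * (q + l) + i) =
      if i < q then gs t i else p t (i - q) := by
    intro t ht i hi
    have h1 := Nat.mul_le_mul_right (q + l) (Nat.succ_le_of_lt ht)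
    rw [Nat.succ_mul] at h1
    rw [hdig _ (by omega)]
    have hdiv : (t * (q + l) + i) / (q + l) = t := by
      rw [mul_comm, Nat.mul_add_div (by omega), Nat.div_eq_of_lt hi, add_zero]
    have hmod : (t * (q + l) + i) % (q + l) = i := by
      rw [Nat.mul_add_mod_self_right, Nat.mod_eq_of_lt hi]
    simp only [δ, hdiv, hmod]
  refine ⟨a, ha, v, hv.trans_le ?_, ?_⟩
  · rw [← pow_mul]
    refine Nat.pow_le_pow_right (by omega) ?_
    rw [mul_comm]
    exact Nat.mul_le_mul_left m (by omega)
  have hweight : ∀ t ≤ m, ∀ r : Fin n, codeWeight n q l X col a r t = totalWeight X l B p r t := by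
    intro t
    induction t with
    | zero => intro _ _; rfl
    | succ t ih =>
      intro ht r
      have hset : codeSet n X col a (t * (q + l)) q =
          refineSet n col (gs t) (Finset.range n) q :=
        refineSet_congr fun s hs => by rw [hdig' t (by omega) s (by omega), if_pos hs]
      rw [codeWeight, totalWeight, horner_eq_add, ih (by omega), hset, stageWeight]
      congr 1
      by_cases hr : (r : ℕ) ∈ refineSet n col (gs t) (Finset.range n) q
      · have hrB : r ∈ B t := Finset.mem_filter.2 ⟨Finset.mem_univ _, hr⟩
        rw [if_pos hrB, residueWeight]
        refine horner_congr fun i hi => ?_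
        rw [if_pos hr, add_assoc, hdig' t (by omega) _ (by omega), if_neg (by omega),
          Nat.add_sub_cancel_left]
      · have hrB : r ∉ B t := fun h => hr (Finset.mem_filter.1 h).2
        rw [if_neg hrB]
        simp only [if_neg hr]
        have hz : ∀ i, horner X (fun _ => 0) 0 i = 0 := by
          intro i
          induction i with
          | zero => rfl
          | succ i ih => rw [horner, ih, zero_mul]
        exact hz l
  simpa only [hweight m le_rfl] using hne

end Codes

/-! ### Reasoning about programs -/

infixr:60 " ⨾ " => Prog.seq

namespace Memory

variable {F : Type*}

theorem getNat_mk (σ : Memory F) (x : ℕ) (l : List ℕ) :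
    σ.getNat ⟨x, l⟩ = σ.nat (x, l.map fun v => σ.nat (v, [])) := rfl

theorem getFld_mk (σ : Memory F) (x : ℕ) (l : List ℕ) :
    σ.getFld ⟨x, l⟩ = σ.fld (x, l.map fun v => σ.nat (v, [])) := rfl

theorem setNat_nat (σ : Memory F) (x : ℕ) (l : List ℕ) (v : ℕ) (a : ℕ × List ℕ) :
    (σ.setNat ⟨x, l⟩ v).nat a = if a = (x, l.map fun v => σ.nat (v, [])) then v else σ.nat a :=
  Function.update_apply _ _ _ _

theorem setNat_fld (σ : Memory F) (x : Ref) (v : ℕ) : (σ.setNat x v).fld = σ.fld := rfl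

theorem setFld_fld (σ : Memory F) (x : ℕ) (l : List ℕ) (v : F) (a : ℕ × List ℕ) :
    (σ.setFld ⟨x, l⟩ v).fld a = if a = (x, l.map fun v => σ.nat (v, [])) then v else σ.fld a :=
  Function.update_apply _ _ _ _

theorem setFld_nat (σ : Memory F) (x : Ref) (v : F) : (σ.setFld x v).nat = σ.nat := rfl

end Memory

namespace Prog

/-- Whether a program assigns to natural-number cells of the array `y`. -/
def writesNat : Prog → ℕ → Bool
  | natConst x _, y => x.name == y
  | natAdd x _ _, y => x.name == y
  | natSub x _ _, y => x.name == y
  | seq P Q, y => P.writesNat y || Q.writesNat y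
  | ifNatZero _ P Q, y => P.writesNat y || Q.writesNat y
  | ifFldZero _ P Q, y => P.writesNat y || Q.writesNat y
  | whileNatNonzero _ P, y => P.writesNat y
  | _, _ => false

/-- Whether a program assigns to field cells of the array `y`. -/
def writesFld : Prog → ℕ → Bool
  | fldZero x, y => x.name == y
  | fldOne x, y => x.name == y
  | fldAdd x _ _, y => x.name == y
  | fldSub x _ _, y => x.name == y
  | fldMul x _ _, y => x.name == y
  | fldInv x _, y => x.name == y
  | seq P Q, y => P.writesFld y || Q.writesFld y
  | ifNatZero _ P Q, y => P.writesFld y || Q.writesFld y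
  | ifFldZero _ P Q, y => P.writesFld y || Q.writesFld y
  | whileNatNonzero _ P, y => P.writesFld y
  | _, _ => false

end Prog

/-- The memories `σ` and `τ` agree on the arrays to which `P` does not assign. -/
structure Frame {F : Type*} (P : Prog) (σ τ : Memory F) : Prop where
  nat : ∀ x l, P.writesNat x = false → τ.nat (x, l) = σ.nat (x, l)
  fld : ∀ x l, P.writesFld x = false → τ.fld (x, l) = σ.fld (x, l)

theorem Run.frame {F : Type*} [Field F] {P : Prog} {σ τ : Memory F} {t : ℕ} (h : Run P σ t τ) :
    Frame P σ τ := by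
  induction h with
  | skip σ => exact ⟨fun _ _ _ => rfl, fun _ _ _ => rfl⟩
  | natConst σ x m | natAdd σ x y z | natSub σ x y z =>
    refine ⟨fun y l h => ?_, fun _ _ _ => rfl⟩
    simp only [Prog.writesNat, beq_eq_false_iff_ne] at h
    exact Function.update_of_ne (fun he => h (congrArg Prod.fst he).symm) _ _
  | fldZero σ x | fldOne σ x | fldAdd σ x y z | fldSub σ x y z | fldMul σ x y z | fldInv σ x y =>
    refine ⟨fun _ _ _ => rfl, fun y l h => ?_⟩
    simp only [Prog.writesFld, beq_eq_false_iff_ne] at h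
    exact Function.update_of_ne (fun he => h (congrArg Prod.fst he).symm) _ _
  | seq _ _ ih₁ ih₂ =>
    refine ⟨fun y l h => ?_, fun y l h => ?_⟩
    · simp only [Prog.writesNat, Bool.or_eq_false_iff] at h
      rw [ih₂.nat y l h.2, ih₁.nat y l h.1]
    · simp only [Prog.writesFld, Bool.or_eq_false_iff] at h
      rw [ih₂.fld y l h.2, ih₁.fld y l h.1]
  | ifNatZero_true _ _ ih | ifFldZero_true _ _ ih =>
    refine ⟨fun y l h => ?_, fun y l h => ?_⟩
    · simp only [Prog.writesNat, Bool.or_eq_false_iff] at h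
      rw [ih.nat y l h.1]
    · simp only [Prog.writesFld, Bool.or_eq_false_iff] at h
      rw [ih.fld y l h.1]
  | ifNatZero_false _ _ ih | ifFldZero_false _ _ ih =>
    refine ⟨fun y l h => ?_, fun y l h => ?_⟩
    · simp only [Prog.writesNat, Bool.or_eq_false_iff] at h
      rw [ih.nat y l h.2]
    · simp only [Prog.writesFld, Bool.or_eq_false_iff] at h
      rw [ih.fld y l h.2]
  | while_done _ => exact ⟨fun _ _ _ => rfl, fun _ _ _ => rfl⟩
  | while_step _ _ _ ih₁ ih₂ =>
    refine ⟨fun y l h => ?_, fun y l h => ?_⟩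
    · rw [ih₂.nat y l h, ih₁.nat y l h]
    · rw [ih₂.fld y l h, ih₁.fld y l h]

/-- Started on `σ`, the program `P` halts within `T` steps with a memory that satisfies `Q`. -/
def Ends {F : Type*} [Field F] (P : Prog) (σ : Memory F) (T : ℕ) (Q : Memory F → Prop) : Prop :=
  ∃ t τ, Run P σ t τ ∧ t ≤ T ∧ Q τ

/-- The counting loop `for i < N do body`; the cell `11` is used for the test. -/
def forLoop (i N : ℕ) (body : Prog) : Prog :=
  .natConst ⟨i, []⟩ 0 ⨾ .natSub ⟨11, []⟩ ⟨N, []⟩ ⟨i, []⟩ ⨾ .whileNatNonzero ⟨11, []⟩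
    (body ⨾ .natConst ⟨11, []⟩ 1 ⨾ .natAdd ⟨i, []⟩ ⟨i, []⟩ ⟨11, []⟩ ⨾
      .natSub ⟨11, []⟩ ⟨N, []⟩ ⟨i, []⟩)

/-- The loop body does not interfere with the counter and the bound. -/
def loopOK (i N : ℕ) (body : Prog) : Bool :=
  !body.writesNat i && !body.writesNat N && i != N && i != 11 && N != 11

/-! ### Program logic with time bounds -/

namespace Ends

variable {F : Type*} [Field F] {P Q : Prog} {σ : Memory F}

theorem imp {T T' : ℕ} {R R' : Memory F → Prop} (h : Ends P σ T R) (hT : T ≤ T')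
    (hR : ∀ τ, Frame P σ τ → R τ → R' τ) : Ends P σ T' R' := by
  obtain ⟨t, τ, hrun, ht, hτ⟩ := h
  exact ⟨t, τ, hrun, ht.trans hT, hR τ hrun.frame hτ⟩

theorem of_run {τ : Memory F} {t : ℕ} {R : Memory F → Prop} (h : Run P σ t τ) (hR : R τ) :
    Ends P σ t R := ⟨t, τ, h, le_rfl, hR⟩

theorem run_seq {τ : Memory F} {t T : ℕ} {R : Memory F → Prop} (h : Run P σ t τ)
    (hQ : Ends Q τ T R) : Ends (P ⨾ Q) σ (t + T) R := by
  obtain ⟨t', τ', hrun, ht, hτ⟩ := hQ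
  exact ⟨_, τ', .seq h hrun, by omega, hτ⟩

theorem seq {T T' : ℕ} {R R' : Memory F → Prop} (h : Ends P σ T R)
    (hQ : ∀ τ, Frame P σ τ → R τ → Ends Q τ T' R') : Ends (P ⨾ Q) σ (T + T') R' := by
  obtain ⟨t, τ, hrun, ht, hτ⟩ := h
  obtain ⟨t', τ', hrun', ht', hτ'⟩ := hQ τ hrun.frame hτ
  exact ⟨_, τ', .seq hrun hrun', by omega, hτ'⟩

theorem ifNatZero {x : Ref} {T : ℕ} {R : Memory F → Prop}
    (h₁ : σ.getNat x = 0 → Ends P σ T R) (h₂ : σ.getNat x ≠ 0 → Ends Q σ T R) :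
    Ends (.ifNatZero x P Q) σ (T + 1) R := by
  by_cases hx : σ.getNat x = 0
  · obtain ⟨t, τ, hrun, ht, hτ⟩ := h₁ hx
    exact ⟨_, τ, .ifNatZero_true hx hrun, by omega, hτ⟩
  · obtain ⟨t, τ, hrun, ht, hτ⟩ := h₂ hx
    exact ⟨_, τ, .ifNatZero_false hx hrun, by omega, hτ⟩

theorem ifFldZero {x : Ref} {T : ℕ} {R : Memory F → Prop}
    (h₁ : σ.getFld x = 0 → Ends P σ T R) (h₂ : σ.getFld x ≠ 0 → Ends Q σ T R) :
    Ends (.ifFldZero x P Q) σ (T + 1) R := by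
  by_cases hx : σ.getFld x = 0
  · obtain ⟨t, τ, hrun, ht, hτ⟩ := h₁ hx
    exact ⟨_, τ, .ifFldZero_true hx hrun, by omega, hτ⟩
  · obtain ⟨t, τ, hrun, ht, hτ⟩ := h₂ hx
    exact ⟨_, τ, .ifFldZero_false hx hrun, by omega, hτ⟩

/-- The rule for counting loops with the invariant `I`. -/
theorem forLoop {i N : ℕ} {body : Prog} {n T : ℕ} (I : ℕ → Memory F → Prop)
    (hok : loopOK i N body = true) (hN : σ.nat (N, []) = n)
    (hstable : ∀ j τ τ', (∀ x l, x ≠ i → x ≠ 11 → τ'.nat (x, l) = τ.nat (x, l)) →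
      τ'.fld = τ.fld → I j τ → I j τ')
    (h0 : I 0 σ)
    (hstep : ∀ j < n, ∀ τ, Frame (forLoop i N body) σ τ → τ.nat (i, []) = j → I j τ →
      Ends body τ T (I (j + 1))) :
    Ends (forLoop i N body) σ (n * (T + 4) + 3) (I n) := by
  simp only [loopOK, Bool.and_eq_true, Bool.not_eq_true', bne_iff_ne] at hok
  obtain ⟨⟨⟨⟨hwi, hwN⟩, hiN⟩, hi11⟩, hN11⟩ := hok
  set loop := Prog.whileNatNonzero ⟨11, []⟩
    (body ⨾ .natConst ⟨11, []⟩ 1 ⨾ .natAdd ⟨i, []⟩ ⟨i, []⟩ ⟨11, []⟩ ⨾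
      .natSub ⟨11, []⟩ ⟨N, []⟩ ⟨i, []⟩) with hloop
  -- Cell `11` holds the number `m` of rounds still to come whenever the test is made. The body may
  -- overwrite it, as it is recomputed from the counter afterwards.
  have hwhile : ∀ m j τ, j + m = n → Frame (_root_.forLoop i N body) σ τ →
      τ.nat (i, []) = j → τ.nat (11, []) = m → τ.nat (N, []) = n → I j τ →
      Ends loop τ (m * (T + 4) + 1) (I n) := by
    intro m
    induction m with
    | zero =>
      intro j τ hj _ _ h11 _ hI
      refine ⟨1, τ, .while_done h11, by omega, ?_⟩
      rw [add_zero] at hj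
      exact hj ▸ hI
    | succ m ih =>
      intro j τ hj hF hi h11 hNn hI
      obtain ⟨t, τ', hrun, ht, hτ'⟩ := hstep j (by omega) τ hF hi hI
      have hfr := hrun.frame
      have hi' := (hfr.nat i [] hwi).trans hi
      have hN' := (hfr.nat N [] hwN).trans hNn
      set τ₁ := τ'.setNat ⟨11, []⟩ 1 with hτ₁
      set τ₂ := τ₁.setNat ⟨i, []⟩ (τ₁.getNat ⟨i, []⟩ + τ₁.getNat ⟨11, []⟩) with hτ₂
      set τ₃ := τ₂.setNat ⟨11, []⟩ (τ₂.getNat ⟨N, []⟩ - τ₂.getNat ⟨i, []⟩) with hτ₃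
      have hrun' : Run (body ⨾ .natConst ⟨11, []⟩ 1 ⨾ .natAdd ⟨i, []⟩ ⟨i, []⟩ ⟨11, []⟩ ⨾
          .natSub ⟨11, []⟩ ⟨N, []⟩ ⟨i, []⟩) τ (t + (1 + (1 + 1))) τ₃ :=
        .seq hrun (.seq (.natConst _ _ _) (.seq (.natAdd _ _ _ _) (.natSub _ _ _ _)))
      have e11 : τ₃.nat (11, []) = m := by
        simp [hτ₃, hτ₂, hτ₁, Memory.setNat_nat, Memory.getNat_mk, hi', hN', hiN.symm, hi11, hN11]
        omega
      have ei : τ₃.nat (i, []) = j + 1 := by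
        simp [hτ₃, hτ₂, hτ₁, Memory.setNat_nat, Memory.getNat_mk, hi', hi11]
      have eo : ∀ x l, x ≠ i → x ≠ 11 → τ₃.nat (x, l) = τ'.nat (x, l) := by
        intro x l h1 h2
        simp [hτ₃, hτ₂, hτ₁, Memory.setNat_nat, h1, h2]
      have ef : τ₃.fld = τ'.fld := rfl
      have hF' : Frame (_root_.forLoop i N body) σ τ₃ := by
        refine ⟨fun x l hx => ?_, fun x l hx => ?_⟩
        · have hx' := hx
          simp only [_root_.forLoop, Prog.writesNat, Bool.or_eq_false_iff,
            beq_eq_false_iff_ne] at hx'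
          rw [eo x l (Ne.symm hx'.1) (Ne.symm hx'.2.1), hfr.nat x l hx'.2.2.1, hF.nat x l hx]
        · have hx' := hx
          simp only [_root_.forLoop, Prog.writesFld, Bool.or_eq_false_iff] at hx'
          rw [ef, hfr.fld x l hx'.2.2.1, hF.fld x l hx]
      obtain ⟨t', ρ, hrun'', ht', hρ⟩ := ih (j + 1) τ₃ (by omega) hF' ei e11
        ((eo N [] hiN.symm hN11).trans hN') (hstable _ _ _ eo ef hτ')
      refine ⟨_, ρ, .while_step (by rw [Memory.getNat_mk]; simp [h11]) hrun' hrun'', ?_, hρ⟩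
      rw [Nat.succ_mul]
      omega
  set σ₁ := σ.setNat ⟨i, []⟩ 0 with hσ₁
  set σ₂ := σ₁.setNat ⟨11, []⟩ (σ₁.getNat ⟨N, []⟩ - σ₁.getNat ⟨i, []⟩) with hσ₂
  have eo : ∀ x l, x ≠ i → x ≠ 11 → σ₂.nat (x, l) = σ.nat (x, l) := by
    intro x l h1 h2
    simp [hσ₂, hσ₁, Memory.setNat_nat, h1, h2]
  obtain ⟨t, τ, hrun, ht, hτ⟩ := hwhile n 0 σ₂ (by omega) (by
      refine ⟨fun x l hx => ?_, fun x l hx => rfl⟩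
      simp only [_root_.forLoop, Prog.writesNat, Bool.or_eq_false_iff, beq_eq_false_iff_ne] at hx
      exact eo x l (Ne.symm hx.1) (Ne.symm hx.2.1))
    (by simp [hσ₂, hσ₁, Memory.setNat_nat, hi11])
    (by simp [hσ₂, hσ₁, Memory.setNat_nat, Memory.getNat_mk, hiN.symm, hN])
    ((eo N [] hiN.symm hN11).trans hN) (hstable _ _ _ eo rfl h0)
  exact ⟨_, τ, .seq (.natConst _ _ _) (.seq (.natSub _ _ _ _) hrun), by omega, hτ⟩

/-- The rule for counting loops, with times measured in powers of `U`. -/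
theorem forLoop_pow {i N : ℕ} {body : Prog} {n U a e : ℕ} (I : ℕ → Memory F → Prop)
    (hok : loopOK i N body = true) (hN : σ.nat (N, []) = n) (hU : 1 ≤ U) (hn : n ≤ U)
    (hstable : ∀ j τ τ', (∀ x l, x ≠ i → x ≠ 11 → τ'.nat (x, l) = τ.nat (x, l)) →
      τ'.fld = τ.fld → I j τ → I j τ')
    (h0 : I 0 σ)
    (hstep : ∀ j < n, ∀ τ, Frame (_root_.forLoop i N body) σ τ → τ.nat (i, []) = j → I j τ →
      Ends body τ (a * U ^ e) (I (j + 1))) :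
    Ends (_root_.forLoop i N body) σ ((a + 7) * U ^ (e + 1)) (I n) := by
  refine (Ends.forLoop I hok hN hstable h0 hstep).imp ?_ fun _ _ h => h
  have h1 : 1 ≤ U ^ e := Nat.one_le_pow _ _ hU
  have h2 : U * 1 ≤ U * U ^ e := Nat.mul_le_mul_left U h1
  calc n * (a * U ^ e + 4) + 3 ≤ U * (a * U ^ e + 4) + 3 := by gcongr
    _ = a * (U * U ^ e) + 4 * U + 3 := by ring
    _ ≤ a * (U * U ^ e) + 4 * (U * U ^ e) + 3 * (U * U ^ e) := by omega
    _ = (a + 7) * U ^ (e + 1) := by ring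

end Ends

/-! ### The program: computing the parameters

The scalar variables `1`, `2`, `3` hold `n`, `c`, `k`; the parameters are stored in the variables
`6` (`c - 1`), `7` (the number of base sets), `8` (the number of moduli for each base set),
`9` (the base of the digits), `10` (the number of codes), and the array `5` holds the colors of the
variables.  The variables `11` and `20` to `28` are counters and temporary cells. -/

/-- Multiplication by repeated addition. -/
def mulProg (x y z : ℕ) : Prog :=
  .natConst ⟨x, []⟩ 0 ⨾ forLoop 28 z (.natAdd ⟨x, []⟩ ⟨x, []⟩ ⟨y, []⟩)

/-- One step of the computation of the square root of the variable `12`. -/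
def sqrtStep : Prog :=
  .natAdd ⟨27, []⟩ ⟨25, []⟩ ⟨26, []⟩ ⨾ .natAdd ⟨27, []⟩ ⟨27, []⟩ ⟨26, []⟩ ⨾
  .natConst ⟨11, []⟩ 1 ⨾ .natAdd ⟨27, []⟩ ⟨27, []⟩ ⟨11, []⟩ ⨾ .natSub ⟨11, []⟩ ⟨27, []⟩ ⟨12, []⟩ ⨾
  .ifNatZero ⟨11, []⟩ (.natAdd ⟨25, []⟩ ⟨27, []⟩ ⟨11, []⟩ ⨾ .natConst ⟨11, []⟩ 1 ⨾
    .natAdd ⟨26, []⟩ ⟨26, []⟩ ⟨11, []⟩) .skip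

/-- Replaces the variable `12` by its square root. -/
def sqrtProg : Prog :=
  .natConst ⟨26, []⟩ 0 ⨾ .natConst ⟨25, []⟩ 0 ⨾ forLoop 21 12 sqrtStep ⨾
  .natConst ⟨27, []⟩ 0 ⨾ .natAdd ⟨12, []⟩ ⟨26, []⟩ ⟨27, []⟩

/-- Computes `c - 1`, an iterated square root of `n`, and `2 ^ (c - 1) * n`. -/
def rootProg : Prog :=
  .natConst ⟨11, []⟩ 1 ⨾ .natSub ⟨6, []⟩ ⟨2, []⟩ ⟨11, []⟩ ⨾ .natConst ⟨27, []⟩ 0 ⨾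
  .natAdd ⟨12, []⟩ ⟨1, []⟩ ⟨27, []⟩ ⨾ .natAdd ⟨13, []⟩ ⟨1, []⟩ ⟨27, []⟩ ⨾
  forLoop 20 6 (sqrtProg ⨾ .natAdd ⟨13, []⟩ ⟨13, []⟩ ⟨13, []⟩)

/-- Computes the number of base sets. -/
def baseCountProg : Prog :=
  .natConst ⟨7, []⟩ 0 ⨾ forLoop 20 1 (.ifNatZero ⟨13, []⟩ .skip
    (.natSub ⟨13, []⟩ ⟨13, []⟩ ⟨12, []⟩ ⨾ .natConst ⟨11, []⟩ 1 ⨾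
      .natAdd ⟨7, []⟩ ⟨7, []⟩ ⟨11, []⟩))

/-- Computes the number of moduli for each base set. -/
def levelCountProg : Prog :=
  .natConst ⟨25, []⟩ 1 ⨾ .natConst ⟨8, []⟩ 0 ⨾ forLoop 20 1
    (.natSub ⟨27, []⟩ ⟨1, []⟩ ⟨25, []⟩ ⨾ .ifNatZero ⟨27, []⟩ .skip
      (.natAdd ⟨25, []⟩ ⟨25, []⟩ ⟨25, []⟩ ⨾ .natConst ⟨11, []⟩ 2 ⨾
        .natAdd ⟨8, []⟩ ⟨8, []⟩ ⟨11, []⟩))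

/-- Computes the base of the digits. -/
def digitBaseProg : Prog :=
  mulProg 25 1 2 ⨾ mulProg 26 25 3 ⨾ .natAdd ⟨26, []⟩ ⟨26, []⟩ ⟨26, []⟩ ⨾
  .natAdd ⟨26, []⟩ ⟨26, []⟩ ⟨26, []⟩ ⨾ .natAdd ⟨26, []⟩ ⟨26, []⟩ ⟨26, []⟩ ⨾
  mulProg 25 26 26 ⨾ mulProg 9 25 25

/-- Computes the number of codes. -/
def codeCountProg : Prog :=
  .natAdd ⟨25, []⟩ ⟨6, []⟩ ⟨8, []⟩ ⨾ .natConst ⟨10, []⟩ 1 ⨾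
  forLoop 20 7 (forLoop 21 25 (mulProg 26 10 9 ⨾ .natConst ⟨27, []⟩ 0 ⨾
    .natAdd ⟨10, []⟩ ⟨26, []⟩ ⟨27, []⟩))

/-! ### Correctness and cost of the parameter computations -/

section Parameters

variable {F : Type*} [Field F] {σ : Memory F}

theorem mulProg_ends {x y z U : ℕ} (hx : x ≠ 11 ∧ x ≠ 28 ∧ x ≠ y ∧ x ≠ z) (hy : y ≠ 11 ∧ y ≠ 28)
    (hz : z ≠ 11 ∧ z ≠ 28) (hU : 1 ≤ U) (hle : σ.nat (z, []) ≤ U) :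
    Ends (mulProg x y z) σ (9 * U) fun τ => τ.nat (x, []) = σ.nat (y, []) * σ.nat (z, []) := by
  obtain ⟨hx11, hx28, hxy, hxz⟩ := hx
  refine (Ends.run_seq (.natConst _ _ _) (Ends.forLoop (n := σ.nat (z, [])) (T := 1)
    (fun j τ => τ.nat (x, []) = σ.nat (y, []) * j) ?_ ?_ ?_ ?_ ?_)).imp ?_ fun _ _ h => h
  · simp [loopOK, Prog.writesNat, hx28, hxz, hz.1, Ne.symm hz.2]
  · simp [Memory.setNat_nat, hxz.symm]
  · intro j τ τ' hn _ h
    rwa [hn x [] hx28 hx11]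
  · simp [Memory.setNat_nat]
  · intro j _ τ hF _ h
    refine Ends.of_run (.natAdd _ _ _ _) ?_
    have hfy := hF.nat y [] (by simp [forLoop, Prog.writesNat, Ne.symm hy.1, Ne.symm hy.2, hxy])
    rw [Memory.setNat_nat] at hfy
    simp only [Memory.setNat_nat, Memory.getNat_mk, List.map_nil, h, hfy, Prod.mk.injEq, and_true,
      hxy.symm, if_true, if_false]
    ring
  · omega

/-- Cells `26` and `25` hold a number and its square. The next square is obtained by additions and
accepted while it does not exceed the input, so the number stops growing at the root. -/
theorem sqrtProg_ends {U : ℕ} (hU : 1 ≤ U) (hle : σ.nat (12, []) ≤ U) :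
    Ends sqrtProg σ (30 * U) fun τ => τ.nat (12, []) = Nat.sqrt (σ.nat (12, [])) := by
  set b := σ.nat (12, []) with hb
  refine Ends.imp (T := 1 + (1 + ((b * (9 + 4) + 3) + (1 + 1)))) (R := fun τ =>
    τ.nat (12, []) = Nat.sqrt b) ?_ (by omega) fun _ _ h => h
  refine Ends.run_seq (.natConst _ _ _) (Ends.run_seq (.natConst _ _ _) (Ends.seq
    (R := fun τ => τ.nat (26, []) = Nat.sqrt b)
    ((Ends.forLoop (n := b) (T := 9) (fun j τ => τ.nat (26, []) = min j (Nat.sqrt b) ∧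
      τ.nat (25, []) = τ.nat (26, []) * τ.nat (26, [])) (by rfl) ?_ ?_ ?_ ?_).imp le_rfl ?_) ?_))
  · simp [Memory.setNat_nat, ← hb]
  · intro j τ τ' hn _ h
    simpa [hn] using h
  · simp [Memory.setNat_nat]
  · rintro j hj τ hF - ⟨h26, h25⟩
    have h12 : τ.nat (12, []) = b := by
      rw [hF.nat 12 [] rfl]
      simp [Memory.setNat_nat, ← hb]
    refine Ends.run_seq (.natAdd _ _ _ _) (Ends.run_seq (.natAdd _ _ _ _) (Ends.run_seq
      (.natConst _ _ _) (Ends.run_seq (.natAdd _ _ _ _) (Ends.run_seq (T := 4) (.natSub _ _ _ _)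
      (Ends.ifNatZero (fun h0 => ?_) fun h0 => ?_)))))
    · refine Ends.run_seq (.natAdd _ _ _ _) (Ends.run_seq (.natConst _ _ _)
        (Ends.of_run (.natAdd _ _ _ _) ?_))
      simp [Memory.setNat_nat, Memory.getNat_mk, h12, h25] at h0 ⊢
      generalize τ.nat (26, []) = y at *
      subst h26
      have hlt : min j (Nat.sqrt b) + 1 ≤ Nat.sqrt b := by
        rw [Nat.le_sqrt]
        have : ∀ y : ℕ, (y + 1) * (y + 1) = y * y + y + y + 1 := fun y => by ring
        rw [this]
        omega
      rw [h0]
      constructor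
      · omega
      · ring
    · refine Ends.imp (Ends.of_run (.skip _) (R := fun τ => τ.nat (26, []) = min (j + 1) (Nat.sqrt b) ∧
        τ.nat (25, []) = τ.nat (26, []) * τ.nat (26, [])) ?_) (by norm_num) fun _ _ h => h
      simp [Memory.setNat_nat, Memory.getNat_mk, h12, h25] at h0 ⊢
      generalize τ.nat (26, []) = y at *
      subst h26
      have hlt : Nat.sqrt b < min j (Nat.sqrt b) + 1 := by
        rw [Nat.sqrt_lt]
        have : ∀ y : ℕ, (y + 1) * (y + 1) = y * y + y + y + 1 := fun y => by ring
        rw [this]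
        omega
      omega
  · rintro τ - ⟨h26, -⟩
    rw [h26]
    exact min_eq_right (Nat.sqrt_le_self b)
  · intro τ _ h26
    refine Ends.run_seq (.natConst _ _ _) (Ends.of_run (.natAdd _ _ _ _) ?_)
    simp [Memory.setNat_nat, Memory.getNat_mk, h26]

/-- For `r = Nat.sqrt b` both `r ^ 2 ≤ b` and `b + 1 ≤ (r + 1) ^ 2` hold, so iterating the integer
root squares the exponents consistently in both bounds on `n`. -/
theorem rootProg_ends {n U : ℕ} (hn : σ.nat (1, []) = n) (hn1 : 1 ≤ n) (hU : 1 ≤ U)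
    (hnU : n ≤ U) (hcU : σ.nat (2, []) ≤ U) :
    Ends rootProg σ (43 * U ^ 2) fun τ => τ.nat (6, []) = σ.nat (2, []) - 1 ∧
      τ.nat (13, []) = 2 ^ (σ.nat (2, []) - 1) * n ∧ 1 ≤ τ.nat (12, []) ∧
      τ.nat (12, []) ^ 2 ^ (σ.nat (2, []) - 1) ≤ n ∧
      n < (τ.nat (12, []) + 1) ^ 2 ^ (σ.nat (2, []) - 1) := by
  have hU2 : 1 ≤ U ^ 2 := Nat.one_le_pow _ _ hU
  refine Ends.imp (T := 1 + (1 + (1 + (1 + (1 + (31 + 7) * U ^ 2))))) (Ends.run_seq (.natConst _ _ _)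
    (Ends.run_seq (.natSub _ _ _ _) (Ends.run_seq (.natConst _ _ _) (Ends.run_seq (.natAdd _ _ _ _)
    (Ends.run_seq (.natAdd _ _ _ _) (Ends.forLoop_pow (n := σ.nat (2, []) - 1) (a := 31) (e := 1)
    (fun j τ => τ.nat (6, []) = σ.nat (2, []) - 1 ∧ τ.nat (13, []) = 2 ^ j * n ∧ 1 ≤ τ.nat (12, []) ∧ τ.nat (12, []) ≤ n ∧
      τ.nat (12, []) ^ 2 ^ j ≤ n ∧ n < (τ.nat (12, []) + 1) ^ 2 ^ j)
    (by rfl) ?_ hU (by omega) ?_ ?_ ?_)))))) (by omega) ?_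
  · simp [Memory.setNat_nat, Memory.getNat_mk]
  · intro j τ τ' hn' _ h
    simpa [hn'] using h
  · simp [Memory.setNat_nat, Memory.getNat_mk, hn, hn1]
  · rintro j - τ - - ⟨h6, h13, h1, hle, hlow, hup⟩
    refine Ends.imp (Ends.seq (sqrtProg_ends hU (hle.trans hnU)) fun τ' hF h12 =>
      Ends.of_run (R := fun τ => τ.nat (6, []) = σ.nat (2, []) - 1 ∧
        τ.nat (13, []) = 2 ^ (j + 1) * n ∧ 1 ≤ τ.nat (12, []) ∧
        τ.nat (12, []) ≤ n ∧ τ.nat (12, []) ^ 2 ^ (j + 1) ≤ n ∧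
        n < (τ.nat (12, []) + 1) ^ 2 ^ (j + 1)) (.natAdd _ _ _ _) ?_) (by rw [pow_one]; omega) fun _ _ h => h
    have h6' := (hF.nat 6 [] rfl).trans h6
    have h13' := (hF.nat 13 [] rfl).trans h13
    simp only [Memory.setNat_nat, Memory.getNat_mk, List.map_nil, h6', h13', h12, if_true,
      Prod.mk.injEq, and_true, Nat.reduceEqDiff, if_false]
    generalize τ.nat (12, []) = b at *
    refine ⟨trivial, by ring, Nat.sqrt_pos.2 h1, (Nat.sqrt_le_self b).trans hle, ?_, ?_⟩
    · rw [pow_succ', pow_mul, pow_two]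
      exact (Nat.pow_le_pow_left (Nat.sqrt_le b) _).trans hlow
    · rw [pow_succ', pow_mul, pow_two]
      exact hup.trans_le (Nat.pow_le_pow_left (Nat.succ_le_succ_sqrt b) _)
  · rintro τ - ⟨h6, h13, h1, -, hlow, hup⟩
    exact ⟨h6, h13, h1, hlow, hup⟩

/-- A division rounded up, by repeated subtraction, and capped at `n`. The cap matters for the
running time when `c` is large compared with `log n`. -/
theorem baseCountProg_ends {n U : ℕ} (hn : σ.nat (1, []) = n) (hn1 : 1 ≤ n) (hU : 1 ≤ U)
    (hnU : n ≤ U) (hN : 1 ≤ σ.nat (13, [])) :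
    Ends baseCountProg σ (15 * U) fun τ => 1 ≤ τ.nat (7, []) ∧ τ.nat (7, []) ≤ n ∧
      (τ.nat (7, []) = n ∨ σ.nat (13, []) ≤ σ.nat (12, []) * τ.nat (7, [])) ∧
      (τ.nat (7, []) - 1) * σ.nat (12, []) < σ.nat (13, []) := by
  set N := σ.nat (13, []) with hNdef
  set b := σ.nat (12, []) with hb
  refine Ends.imp (T := 1 + (n * (4 + 4) + 3)) (Ends.run_seq (.natConst _ _ _)
    (Ends.forLoop (n := n)
    (fun j τ => τ.nat (7, []) ≤ j ∧ τ.nat (13, []) = N - τ.nat (7, []) * b ∧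
      (τ.nat (13, []) = 0 ∨ τ.nat (7, []) = j) ∧
      (τ.nat (7, []) - 1) * b < N) (by rfl) ?_ ?_ ?_ ?_)) (by omega) ?_
  · simpa [Memory.setNat_nat] using hn
  · intro j τ τ' hn' _ h
    simpa [hn'] using h
  · simp [Memory.setNat_nat, ← hNdef]
    omega
  · rintro j - τ hF - ⟨h7, h13, hor, hlt⟩
    have h12 : τ.nat (12, []) = b := by
      rw [hF.nat 12 [] rfl]
      simp [Memory.setNat_nat, ← hb]
    refine Ends.ifNatZero (fun h0 => ?_) fun h0 => ?_
    · refine Ends.imp (Ends.of_run (.skip _) (R := fun τ => τ.nat (7, []) ≤ j + 1 ∧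
        τ.nat (13, []) = N - τ.nat (7, []) * b ∧ (τ.nat (13, []) = 0 ∨ τ.nat (7, []) = j + 1) ∧
        (τ.nat (7, []) - 1) * b < N) ?_) (by norm_num) fun _ _ h => h
      exact ⟨by omega, h13, Or.inl h0, hlt⟩
    · refine Ends.run_seq (.natSub _ _ _ _) (Ends.run_seq (.natConst _ _ _)
        (Ends.of_run (.natAdd _ _ _ _) ?_))
      simp [Memory.setNat_nat, Memory.getNat_mk, h12, h13] at h0 hor ⊢
      generalize τ.nat (7, []) = y at *
      refine ⟨h7, ?_, ?_, ?_⟩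
      · rw [Nat.sub_sub, Nat.succ_mul]
      · omega
      · omega
  · rintro τ - ⟨h7, h13, hor, hlt⟩
    refine ⟨?_, h7, ?_, hlt⟩
    · by_contra h0
      have h0' : τ.nat (7, []) = 0 := by omega
      simp [h0'] at h13 hor
      omega
    · rcases hor with h | h
      · right
        rw [mul_comm]
        omega
      · exact Or.inl h

/-- `n` doublings suffice because `n < 2 ^ n`. The level count is `2 * e` since positions range up
to `n * n`. -/
theorem levelCountProg_ends {n U : ℕ} (hn : σ.nat (1, []) = n) (hn2 : 2 ≤ n)
    (hU : n ≤ U) :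
    Ends levelCountProg σ (15 * U) fun τ => ∃ e, 1 ≤ e ∧ τ.nat (8, []) = 2 * e ∧ n ≤ 2 ^ e ∧
      2 ^ (e - 1) < n := by
  refine Ends.imp (T := 1 + (1 + (n * (5 + 4) + 3))) (Ends.run_seq (.natConst _ _ _)
    (Ends.run_seq (.natConst _ _ _) (Ends.forLoop (n := n)
    (fun j τ => ∃ e, τ.nat (8, []) = 2 * e ∧ τ.nat (25, []) = 2 ^ e ∧ (n ≤ 2 ^ e ∨ e = j) ∧
      2 ^ (e - 1) < n) (by rfl) ?_ ?_ ?_ ?_))) (by omega) ?_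
  · simpa [Memory.setNat_nat] using hn
  · intro j τ τ' hn' _ h
    simpa [hn'] using h
  · exact ⟨0, by simp [Memory.setNat_nat], by simp [Memory.setNat_nat], Or.inr rfl, by simp; omega⟩
  · rintro j - τ hF - ⟨e, h8, h25, hor, hlt⟩
    have h1 : τ.nat (1, []) = n := by
      rw [hF.nat 1 [] rfl]
      simpa [Memory.setNat_nat] using hn
    refine Ends.run_seq (T := 4) (.natSub _ _ _ _) (Ends.ifNatZero (fun h0 => ?_) fun h0 => ?_)
    · refine Ends.imp (Ends.of_run (.skip _) (R := fun τ => ∃ e, τ.nat (8, []) = 2 * e ∧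
        τ.nat (25, []) = 2 ^ e ∧ (n ≤ 2 ^ e ∨ e = j + 1) ∧ 2 ^ (e - 1) < n) ?_) (by norm_num)
        fun _ _ h => h
      simp [Memory.setNat_nat, Memory.getNat_mk, h1, h25] at h0
      refine ⟨e, ?_, ?_, Or.inl (by omega), hlt⟩ <;>
        simp [Memory.setNat_nat, Memory.getNat_mk, h8, h25]
    · refine Ends.run_seq (.natAdd _ _ _ _) (Ends.run_seq (.natConst _ _ _)
        (Ends.of_run (.natAdd _ _ _ _) ?_))
      simp [Memory.setNat_nat, Memory.getNat_mk, h1, h25] at h0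
      refine ⟨e + 1, ?_, ?_, Or.inr ?_, ?_⟩
      · simp [Memory.setNat_nat, Memory.getNat_mk, h8]
        ring
      · simp [Memory.setNat_nat, Memory.getNat_mk, h25]
        ring
      · omega
      · simp; omega
  · rintro τ - ⟨e, h8, -, hor, hlt⟩
    have hle : n ≤ 2 ^ e := by
      rcases hor with h | rfl
      · exact h
      · exact Nat.lt_two_pow_self.le
    refine ⟨e, ?_, h8, hle, hlt⟩
    by_contra h0
    have : e = 0 := by omega
    subst this
    simp at hle
    omega

theorem digitBaseProg_ends {n c k U : ℕ} (hn : σ.nat (1, []) = n) (hc : σ.nat (2, []) = c)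
    (hk : σ.nat (3, []) = k) (hU : 1 ≤ U) (hcU : c ≤ U) (hkU : k ≤ U) (hU1 : 8 * (n * c * k) ≤ U)
    (hU2 : (8 * (n * c * k)) ^ 2 ≤ U) :
    Ends digitBaseProg σ (39 * U) fun τ => τ.nat (9, []) = (8 * (n * c * k)) ^ 4 := by
  refine Ends.imp (Ends.seq (mulProg_ends (by decide) (by decide) (by decide) hU (by rwa [hc]))
    fun τ₁ hF₁ h₁ => Ends.seq (mulProg_ends (by decide) (by decide) (by decide) hU
      (by rwa [hF₁.nat 3 [] rfl, hk]))
    fun τ₂ hF₂ h₂ => Ends.run_seq (.natAdd _ _ _ _) (Ends.run_seq (.natAdd _ _ _ _)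
      (Ends.run_seq (.natAdd _ _ _ _) (Ends.seq (R' := fun τ => τ.nat (9, []) = (8 * (n * c * k)) ^ 4)
      (mulProg_ends (by decide) (by decide) (by decide) hU ?_)
    fun τ₃ hF₃ h₃ => (mulProg_ends (by decide) (by decide) (by decide) hU ?_).imp le_rfl
      fun τ₄ hF₄ h₄ => ?_)))) (by omega) fun _ _ h => h
  all_goals
    rw [hF₁.nat 3 [] rfl, h₁, hn, hc, hk] at h₂
  · simp [Memory.setNat_nat, Memory.getNat_mk, h₂]
    omega
  all_goals
    simp only [Memory.setNat_nat, Memory.getNat_mk, List.map_nil, if_true, h₂] at h₃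
  · rw [h₃]
    refine le_trans (le_of_eq ?_) hU2
    ring
  · rw [h₄, h₃]
    ring

theorem codeCountProg_ends {q l m X U : ℕ} (hq : σ.nat (6, []) = q) (hl : σ.nat (8, []) = l)
    (hm : σ.nat (7, []) = m) (hX : σ.nat (9, []) = X) (hU : 1 ≤ U) (hqU : q + l ≤ U) (hmU : m ≤ U)
    (hXU : X ≤ U) :
    Ends codeCountProg σ (27 * U ^ 3) fun τ => τ.nat (10, []) = X ^ (m * (q + l)) := by
  have hU3 : 1 ≤ U ^ 3 := Nat.one_le_pow _ _ hU
  refine Ends.imp (T := 1 + (1 + (18 + 7) * U ^ 3)) (Ends.run_seq (.natAdd _ _ _ _)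
    (Ends.run_seq (.natConst _ _ _) (Ends.forLoop_pow (n := m) (a := 18) (e := 2)
    (fun j τ => τ.nat (10, []) = X ^ (j * (q + l))) (by rfl) ?_ hU hmU ?_ ?_ ?_))) (by omega)
    fun _ _ h => h
  · simpa [Memory.setNat_nat] using hm
  · intro j τ τ' hn' _ h
    simpa [hn'] using h
  · simp [Memory.setNat_nat]
  · rintro j - τ hF - h10
    have h25 : τ.nat (25, []) = q + l := by
      rw [hF.nat 25 [] rfl]
      simp [Memory.setNat_nat, Memory.getNat_mk, hq, hl]
    have h9 : τ.nat (9, []) = X := by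
      rw [hF.nat 9 [] rfl]
      simpa [Memory.setNat_nat] using hX
    refine Ends.imp (Ends.forLoop_pow (n := q + l) (a := 11) (e := 1)
      (fun i τ => τ.nat (10, []) = X ^ (j * (q + l) + i)) (by rfl) h25 hU hqU ?_ ?_ ?_) le_rfl ?_
    · intro j τ τ' hn' _ h
      simpa [hn'] using h
    · simpa using h10
    · rintro i - τ' hF' - h10'
      have h9' := (hF'.nat 9 [] rfl).trans h9
      refine Ends.imp (Ends.seq (mulProg_ends (by decide) (by decide) (by decide) hU (by rwa [h9']))
        fun τ'' _ h => Ends.run_seq (.natConst _ _ _) (Ends.of_run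
          (R := fun τ => τ.nat (10, []) = X ^ (j * (q + l) + (i + 1))) (.natAdd _ _ _ _) ?_))
        (by rw [pow_one]; omega) fun _ _ h => h
      simp [Memory.setNat_nat, Memory.getNat_mk, h, h9', h10']
      ring
    · intro τ' _ h
      rw [h]
      ring

end Parameters

/-! ### The program: computing the colors of the variables -/

/-- Records the color `22` of the variable `23` if its coefficient does not vanish. -/
def colorStep : Prog :=
  .ifFldZero ⟨2, [20, 21, 22, 23]⟩ .skip
    (.natConst ⟨27, []⟩ 0 ⨾ .natAdd ⟨5, [20, 23]⟩ ⟨22, []⟩ ⟨27, []⟩)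

/-- Computes the colors of the variables. -/
def colorProg : Prog :=
  forLoop 20 2 (.natConst ⟨27, []⟩ 0 ⨾ .natAdd ⟨24, []⟩ ⟨4, [20]⟩ ⟨27, []⟩ ⨾
    forLoop 21 3 (forLoop 22 24 (forLoop 23 1 colorStep)))

section Colors

variable {F : Type*} {σ : Memory F}

/-- All colors recorded in `τ` agree with `κ`, and `τ` contains the colors recorded in `σ`. -/
structure ColorsExtend (κ : ℕ → ℕ → ℕ) (σ τ : Memory F) : Prop where
  eq_or : ∀ s r, τ.nat (5, [s, r]) = 0 ∨ τ.nat (5, [s, r]) = κ s r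
  mono : ∀ s r, σ.nat (5, [s, r]) = κ s r → τ.nat (5, [s, r]) = κ s r

theorem ColorsExtend.trans {κ : ℕ → ℕ → ℕ} {σ τ ρ : Memory F} (h : ColorsExtend κ σ τ)
    (h' : ColorsExtend κ τ ρ) : ColorsExtend κ σ ρ :=
  ⟨h'.eq_or, fun s r hs => h'.mono s r (h.mono s r hs)⟩

theorem ColorsExtend.congr {κ : ℕ → ℕ → ℕ} {σ τ τ' : Memory F} (h : ColorsExtend κ σ τ)
    (hτ : ∀ l, τ'.nat (5, l) = τ.nat (5, l)) : ColorsExtend κ σ τ' :=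
  ⟨fun s r => by rw [hτ]; exact h.eq_or s r, fun s r hs => by rw [hτ]; exact h.mono s r hs⟩

variable [Field F]

theorem colorStep_ends {κ : ℕ → ℕ → ℕ} {s i j r : ℕ} (hσ : ColorsExtend κ σ σ)
    (hs : σ.nat (20, []) = s) (hi : σ.nat (21, []) = i) (hj : σ.nat (22, []) = j)
    (hr : σ.nat (23, []) = r) (hκ : σ.fld (2, [s, i, j, r]) ≠ 0 → κ s r = j) :
    Ends colorStep σ 3 fun τ => ColorsExtend κ σ τ ∧
      (σ.fld (2, [s, i, j, r]) ≠ 0 → τ.nat (5, [s, r]) = κ s r) := by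
  refine Ends.ifFldZero (fun h0 => ?_) fun h0 => ?_
  · simp only [Memory.getFld_mk, List.map_cons, List.map_nil, hs, hi, hj, hr] at h0
    exact (Ends.of_run (.skip _) (R := fun τ => ColorsExtend κ σ τ ∧
      (σ.fld (2, [s, i, j, r]) ≠ 0 → τ.nat (5, [s, r]) = κ s r)) ⟨hσ, fun h => absurd h0 h⟩).imp
      (by norm_num) fun _ _ h => h
  · simp only [Memory.getFld_mk, List.map_cons, List.map_nil, hs, hi, hj, hr] at h0
    refine Ends.run_seq (.natConst _ _ _) (Ends.of_run (.natAdd _ _ _ _) ?_)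
    refine ⟨⟨fun s' r' => ?_, fun s' r' h => ?_⟩, fun _ => ?_⟩
    · simp only [Memory.setNat_nat, Memory.getNat_mk, List.map_cons, List.map_nil, hs, hj, hr,
        Prod.mk.injEq, List.cons.injEq, and_true, true_and, Nat.reduceEqDiff, if_false, if_true,
        false_and]
      split_ifs with h
      · rw [h.1, h.2, hκ h0]
        exact Or.inr rfl
      · exact hσ.eq_or s' r'
    · simp only [Memory.setNat_nat, Memory.getNat_mk, List.map_cons, List.map_nil, hs, hj, hr,
        Prod.mk.injEq, List.cons.injEq, and_true, true_and, Nat.reduceEqDiff, if_false, if_true,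
        false_and]
      split_ifs with h'
      · rw [h'.1, h'.2, hκ h0]
        rfl
      · exact h
    · simp [Memory.setNat_nat, Memory.getNat_mk, hs, hj, hr, hκ h0]

/-- The partition is not part of the input, and only the colors visible in nonzero coefficients can
be recovered. A variable that a circuit does not involve keeps color 0, which is harmless since only
nonzero coefficients constrain the coloring. -/
theorem colorProg_ends {κ : ℕ → ℕ → ℕ} {n c k U : ℕ} {d : ℕ → ℕ} (hn : σ.nat (1, []) = n)
    (hc : σ.nat (2, []) = c) (hk : σ.nat (3, []) = k) (hd : ∀ s, σ.nat (4, [s]) = d s)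
    (hU : 1 ≤ U) (hnU : n ≤ U) (hcU : c ≤ U) (hkU : k ≤ U) (hdU : ∀ s < c, d s ≤ U)
    (hcol : ∀ s r, σ.nat (5, [s, r]) = 0)
    (hκ : ∀ s < c, ∀ i < k, ∀ j < d s, ∀ r < n, σ.fld (2, [s, i, j, r]) ≠ 0 → κ s r = j) :
    Ends colorProg σ (33 * U ^ 4) fun τ =>
      (∀ s r, τ.nat (5, [s, r]) = 0 ∨ τ.nat (5, [s, r]) = κ s r) ∧
      ∀ s < c, ∀ i < k, ∀ j < d s, ∀ r < n, σ.fld (2, [s, i, j, r]) ≠ 0 →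
        τ.nat (5, [s, r]) = κ s r := by
  have hσ : ColorsExtend κ σ σ := ⟨fun s r => Or.inl (hcol s r), fun _ _ h => h⟩
  refine Ends.imp (Ends.forLoop_pow (n := c) (a := 26) (e := 3)
    (fun s τ => ColorsExtend κ σ τ ∧ ∀ s' < s, ∀ i < k, ∀ j < d s', ∀ r < n,
      σ.fld (2, [s', i, j, r]) ≠ 0 → τ.nat (5, [s', r]) = κ s' r)
    (by rfl) hc hU hcU ?_ ⟨hσ, by simp⟩ ?_) le_rfl fun τ _ h => ⟨h.1.eq_or, h.2⟩
  · intro j τ τ' hn' _ h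
    exact ⟨h.1.congr fun l => hn' 5 l (by decide) (by decide), by simpa [hn'] using h.2⟩
  intro s hs τ hF h20 ⟨hτ, hdone⟩
  set τ₁ := (τ.setNat ⟨27, []⟩ 0).setNat ⟨24, []⟩
    ((τ.setNat ⟨27, []⟩ 0).getNat ⟨4, [20]⟩ + (τ.setNat ⟨27, []⟩ 0).getNat ⟨27, []⟩) with hτ₁
  have o₁ : ∀ x l, x ≠ 24 → x ≠ 27 → τ₁.nat (x, l) = τ.nat (x, l) := by
    intro x l h1 h2
    simp [hτ₁, Memory.setNat_nat, h1, h2]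
  have f₁ : τ₁.fld = τ.fld := rfl
  have h24 : τ₁.nat (24, []) = d s := by
    simp [hτ₁, Memory.setNat_nat, Memory.getNat_mk, h20, hF.nat 4 [s] rfl, hd]
  have hτ₁' : ColorsExtend κ σ τ₁ := hτ.congr fun l => o₁ 5 l (by decide) (by decide)
  have hfld : ∀ l, τ₁.fld (2, l) = σ.fld (2, l) := fun l => hF.fld 2 l rfl
  refine Ends.imp (T := 1 + (1 + (17 + 7) * U ^ 3)) (R := fun τ' => ColorsExtend κ τ₁ τ' ∧ ∀ i < k,
      ∀ j < d s, ∀ r < n, σ.fld (2, [s, i, j, r]) ≠ 0 → τ'.nat (5, [s, r]) = κ s r)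
    (Ends.run_seq (.natConst _ _ _) (Ends.run_seq (.natAdd _ _ _ _)
    (Ends.forLoop_pow (n := k) (fun i τ' => ColorsExtend κ τ₁ τ' ∧ ∀ i' < i,
      ∀ j < d s, ∀ r < n, σ.fld (2, [s, i', j, r]) ≠ 0 → τ'.nat (5, [s, r]) = κ s r) (by rfl)
      ?_ hU hkU ?_ ⟨⟨hτ₁'.eq_or, fun _ _ h => h⟩, by simp⟩ ?_))) ?_ ?_
  · exact (o₁ 3 [] (by decide) (by decide)).trans ((hF.nat 3 [] rfl).trans hk)
  · intro j τ τ' hn' _ h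
    exact ⟨h.1.congr fun l => hn' 5 l (by decide) (by decide), by simpa [hn'] using h.2⟩
  · intro i hi τ₂ hF₂ h21 ⟨hτ₂, hdone₂⟩
    refine Ends.imp (Ends.forLoop_pow (n := d s) (a := 10) (e := 1) (fun j τ' => ColorsExtend κ τ₂ τ' ∧
      ∀ j' < j, ∀ r < n, σ.fld (2, [s, i, j', r]) ≠ 0 → τ'.nat (5, [s, r]) = κ s r) (by rfl)
      ((hF₂.nat 24 [] rfl).trans h24) hU (hdU s hs) ?_ ⟨⟨hτ₂.eq_or, fun _ _ h => h⟩, by simp⟩ ?_)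
      le_rfl ?_
    · intro j τ τ' hn' _ h
      exact ⟨h.1.congr fun l => hn' 5 l (by decide) (by decide), by simpa [hn'] using h.2⟩
    · intro j hj τ₃ hF₃ h22 ⟨hτ₃, hdone₃⟩
      refine Ends.imp (Ends.forLoop_pow (n := n) (a := 3) (e := 0) (fun r τ' => ColorsExtend κ τ₃ τ' ∧
        ∀ r' < r, σ.fld (2, [s, i, j, r']) ≠ 0 → τ'.nat (5, [s, r']) = κ s r') (by rfl)
        ?_ hU hnU ?_ ⟨⟨hτ₃.eq_or, fun _ _ h => h⟩, by simp⟩ ?_) le_rfl ?_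
      · rw [hF₃.nat 1 [] rfl, hF₂.nat 1 [] rfl, o₁ 1 [] (by decide) (by decide), hF.nat 1 [] rfl, hn]
      · intro j τ τ' hn' _ h
        exact ⟨h.1.congr fun l => hn' 5 l (by decide) (by decide), by simpa [hn'] using h.2⟩
      · intro r hr τ₄ hF₄ h23 ⟨hτ₄, hdone₄⟩
        have e4 : τ₄.fld (2, [s, i, j, r]) = σ.fld (2, [s, i, j, r]) := by
          rw [hF₄.fld 2 _ rfl, hF₃.fld 2 _ rfl, hF₂.fld 2 _ rfl, hfld]
        refine Ends.imp (colorStep_ends (κ := κ) (s := s) (i := i) (j := j) (r := r)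
          ⟨hτ₄.eq_or, fun _ _ h => h⟩ ?_ ?_ ?_ h23 ?_) (by simp) fun τ₅ _ h => ?_
        · rw [hF₄.nat 20 [] rfl, hF₃.nat 20 [] rfl, hF₂.nat 20 [] rfl,
            o₁ 20 [] (by decide) (by decide), h20]
        · rw [hF₄.nat 21 [] rfl, hF₃.nat 21 [] rfl, h21]
        · rw [hF₄.nat 22 [] rfl, h22]
        · rw [e4]
          exact hκ s hs i hi j hj r hr
        · refine ⟨hτ₄.trans h.1, fun r' hr' hne => ?_⟩
          rcases Nat.lt_succ_iff_lt_or_eq.1 hr' with h' | rfl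
          · exact h.1.mono _ _ (hdone₄ r' h' hne)
          · exact h.2 (by rwa [e4])
      · intro τ₅ _ h
        refine ⟨hτ₃.trans h.1, fun j' hj' r hr hne => ?_⟩
        rcases Nat.lt_succ_iff_lt_or_eq.1 hj' with h' | rfl
        · exact h.1.mono _ _ (hdone₃ j' h' r hr hne)
        · exact h.2 r hr hne
    · intro τ₅ _ h
      refine ⟨hτ₂.trans h.1, fun i' hi' j hj r hr hne => ?_⟩
      rcases Nat.lt_succ_iff_lt_or_eq.1 hi' with h' | rfl
      · exact h.1.mono _ _ (hdone₂ i' h' j hj r hr hne)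
      · exact h.2 j hj r hr hne
  · have := Nat.one_le_pow 3 U hU
    omega
  · intro τ₅ _ h
    have hext : ColorsExtend κ τ τ₅ :=
      ⟨h.1.eq_or, fun s r hs => h.1.mono s r ((o₁ 5 _ (by decide) (by decide)).trans hs)⟩
    refine ⟨hτ.trans hext, fun s' hs' i hi j hj r hr hne => ?_⟩
    rcases Nat.lt_succ_iff_lt_or_eq.1 hs' with h' | rfl
    · exact hext.mono _ _ (hdone s' h' i hi j hj r hr hne)
    · exact h.2 i hi j hj r hr hne

end Colors

/-! ### The program: decoding base sets and weights

The variable `31` holds the part of the code that has not been read yet, `35` the last digit read,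
the array `34` the indicator functions of the refined sets, and the array `32` the exponents. -/

/-- Runs `P` if the cells `x` and `y` hold the same number. -/
def eqTest (x y : Ref) (P : Prog) : Prog :=
  .natSub ⟨26, []⟩ x y ⨾ .natSub ⟨27, []⟩ y x ⨾ .natAdd ⟨26, []⟩ ⟨26, []⟩ ⟨27, []⟩ ⨾
  .ifNatZero ⟨26, []⟩ P .skip

/-- Moves the last digit of the variable `31` to the variable `35`. -/
def readDigit : Prog :=
  .natConst ⟨38, []⟩ 0 ⨾ .natConst ⟨27, []⟩ 0 ⨾ .natAdd ⟨35, []⟩ ⟨31, []⟩ ⟨27, []⟩ ⨾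
  forLoop 25 31 (.natSub ⟨27, []⟩ ⟨9, []⟩ ⟨35, []⟩ ⨾ .ifNatZero ⟨27, []⟩
    (.natSub ⟨35, []⟩ ⟨35, []⟩ ⟨9, []⟩ ⨾ .natConst ⟨27, []⟩ 1 ⨾
      .natAdd ⟨38, []⟩ ⟨38, []⟩ ⟨27, []⟩) .skip) ⨾
  .natConst ⟨27, []⟩ 0 ⨾ .natAdd ⟨31, []⟩ ⟨38, []⟩ ⟨27, []⟩

/-- Decides whether the element `23` belongs to the refined set of index `37`. -/
def refineElement : Prog :=
  .natConst ⟨36, []⟩ 0 ⨾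
  forLoop 39 23 (.ifNatZero ⟨34, [20, 39]⟩ .skip (eqTest ⟨5, [20, 39]⟩ ⟨5, [20, 23]⟩
    (.natConst ⟨27, []⟩ 1 ⨾ .natAdd ⟨36, []⟩ ⟨36, []⟩ ⟨27, []⟩))) ⨾
  .natAdd ⟨36, []⟩ ⟨1, []⟩ ⟨36, []⟩ ⨾ .natConst ⟨34, [37, 23]⟩ 0 ⨾
  .ifNatZero ⟨34, [20, 23]⟩ .skip
    (eqTest ⟨35, []⟩ ⟨5, [20, 23]⟩ (.natConst ⟨34, [37, 23]⟩ 1) ⨾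
      eqTest ⟨35, []⟩ ⟨36, []⟩ (.natConst ⟨34, [37, 23]⟩ 1))

/-- Computes the refined set of index `20 + 1` from the refined set of index `20`. -/
def refineProg : Prog :=
  .natConst ⟨27, []⟩ 1 ⨾ .natAdd ⟨37, []⟩ ⟨20, []⟩ ⟨27, []⟩ ⨾ forLoop 23 1 refineElement

/-- Appends a digit to the exponent of the element `23`. -/
def weightElement : Prog :=
  .natConst ⟨26, []⟩ 0 ⨾ forLoop 39 9 (.natAdd ⟨26, []⟩ ⟨26, []⟩ ⟨32, [23]⟩) ⨾
  .ifNatZero ⟨34, [20, 23]⟩ .skip (.natAdd ⟨26, []⟩ ⟨26, []⟩ ⟨40, []⟩) ⨾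
  .natConst ⟨27, []⟩ 0 ⨾ .natAdd ⟨32, [23]⟩ ⟨26, []⟩ ⟨27, []⟩ ⨾
  .natAdd ⟨40, []⟩ ⟨40, []⟩ ⟨40, []⟩ ⨾ .natSub ⟨27, []⟩ ⟨41, []⟩ ⟨40, []⟩ ⨾
  .ifNatZero ⟨27, []⟩ (.natSub ⟨40, []⟩ ⟨40, []⟩ ⟨41, []⟩) .skip

/-- Appends a digit to the exponents of all elements. -/
def weightProg : Prog :=
  .natConst ⟨27, []⟩ 1 ⨾ .natAdd ⟨41, []⟩ ⟨35, []⟩ ⟨27, []⟩ ⨾ .natConst ⟨40, []⟩ 1 ⨾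
  forLoop 23 1 weightElement

/-- Reads the choice of one base set and its moduli. -/
def stageProg : Prog :=
  .natConst ⟨20, []⟩ 0 ⨾ forLoop 23 1 (.natConst ⟨34, [20, 23]⟩ 1) ⨾
  forLoop 20 6 (readDigit ⨾ refineProg) ⨾
  .natConst ⟨27, []⟩ 0 ⨾ .natAdd ⟨20, []⟩ ⟨6, []⟩ ⟨27, []⟩ ⨾
  forLoop 21 8 (readDigit ⨾ weightProg)

/-- Computes the exponents that are encoded by the variable `30`. -/
def decodeProg : Prog :=
  .natConst ⟨27, []⟩ 0 ⨾ .natAdd ⟨31, []⟩ ⟨30, []⟩ ⟨27, []⟩ ⨾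
  forLoop 23 1 (.natConst ⟨32, [23]⟩ 0) ⨾ forLoop 33 7 stageProg

/-- The data on which the main loop operates. -/
structure Params (F : Type*) where
  (n c k q m l X U : ℕ)
  d : ℕ → ℕ
  col : ℕ → ℕ → ℕ
  top : ℕ → ℕ → F
  const : ℕ → ℕ → ℕ → F
  coeff : ℕ → ℕ → ℕ → ℕ → F

namespace Params

variable {F : Type*}

/-- The memory `σ` contains the data `D`. -/
structure Holds (D : Params F) (σ : Memory F) : Prop where
  n : σ.nat (1, []) = D.n
  c : σ.nat (2, []) = D.c
  k : σ.nat (3, []) = D.k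
  d : ∀ s, σ.nat (4, [s]) = D.d s
  col : ∀ s r, σ.nat (5, [s, r]) = D.col s r
  q : σ.nat (6, []) = D.q
  m : σ.nat (7, []) = D.m
  l : σ.nat (8, []) = D.l
  X : σ.nat (9, []) = D.X
  U : σ.nat (10, []) = D.U
  top : ∀ s i, σ.fld (0, [s, i]) = D.top s i
  const : ∀ s i j, σ.fld (1, [s, i, j]) = D.const s i j
  coeff : ∀ s i j r, σ.fld (2, [s, i, j, r]) = D.coeff s i j r

theorem Holds.congr {D : Params F} {σ τ : Memory F} (h : D.Holds σ)
    (hn : ∀ x l, 1 ≤ x → x ≤ 10 → τ.nat (x, l) = σ.nat (x, l))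
    (hf : ∀ x l, x ≤ 2 → τ.fld (x, l) = σ.fld (x, l)) : D.Holds τ := by
  constructor <;> intros
  any_goals rw [hn _ _ (by decide) (by decide)]
  any_goals rw [hf _ _ (by decide)]
  exacts [h.n, h.c, h.k, h.d _, h.col _ _, h.q, h.m, h.l, h.X, h.U, h.top _ _, h.const _ _ _,
    h.coeff _ _ _ _]

theorem Holds.setNat {D : Params F} {σ : Memory F} (h : D.Holds σ) {x : ℕ} {l : List ℕ} {v : ℕ}
    (hx : 10 < x) : D.Holds (σ.setNat ⟨x, l⟩ v) :=
  h.congr (fun y l' _ hy => by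
    rw [Memory.setNat_nat, if_neg]
    rintro ⟨⟩
    omega) fun _ _ _ => rfl

theorem Holds.setFld {D : Params F} {σ : Memory F} (h : D.Holds σ) {x : ℕ} {l : List ℕ} {v : F}
    (hx : 2 < x) : D.Holds (σ.setFld ⟨x, l⟩ v) :=
  h.congr (fun _ _ _ _ => rfl) fun y l' hy => by
    rw [Memory.setFld_fld, if_neg]
    rintro ⟨⟩
    omega

end Params

/-- The program does not change the data of the main loop. -/
def Prog.keepsParams (P : Prog) : Bool :=
  (List.range 10).all (fun x => !P.writesNat (x + 1)) && (List.range 3).all fun x => !P.writesFld x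

theorem Params.Holds.frame {F : Type*} {D : Params F} {σ τ : Memory F} {P : Prog} (h : D.Holds σ)
    (hF : Frame P σ τ) (hP : P.keepsParams = true) : D.Holds τ := by
  simp only [Prog.keepsParams, Bool.and_eq_true, List.all_eq_true, List.mem_range,
    Bool.not_eq_true'] at hP
  refine h.congr (fun x l h1 h2 => hF.nat x l ?_) fun x l hx => hF.fld x l (hP.2 x (by omega))
  obtain ⟨y, rfl⟩ : ∃ y, x = y + 1 := ⟨x - 1, by omega⟩
  exact hP.1 y (by omega)

/-! ### Correctness and cost of reading digits, refining sets and appending weights -/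

section Decoding

variable {F : Type*} [Field F] {σ : Memory F}

theorem Ends.eqTest {x y : Ref} {P : Prog} {a b T : ℕ} {R : Memory F → Prop}
    (hx : ∀ τ : Memory F, (∀ z l, z ≠ 26 → z ≠ 27 → τ.nat (z, l) = σ.nat (z, l)) →
      τ.getNat x = a)
    (hy : ∀ τ : Memory F, (∀ z l, z ≠ 26 → z ≠ 27 → τ.nat (z, l) = σ.nat (z, l)) →
      τ.getNat y = b) (hT : 1 ≤ T)
    (h₁ : a = b → ∀ τ, (∀ z l, z ≠ 26 → z ≠ 27 → τ.nat (z, l) = σ.nat (z, l)) →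
      τ.fld = σ.fld → Ends P τ T R)
    (h₂ : a ≠ b → ∀ τ, (∀ z l, z ≠ 26 → z ≠ 27 → τ.nat (z, l) = σ.nat (z, l)) →
      τ.fld = σ.fld → R τ) :
    Ends (eqTest x y P) σ (T + 4) R := by
  set σ₁ := σ.setNat ⟨26, []⟩ (σ.getNat x - σ.getNat y) with hσ₁
  have o₁ : ∀ z l, z ≠ 26 → z ≠ 27 → σ₁.nat (z, l) = σ.nat (z, l) := by
    intro z l h1 _
    simp [hσ₁, Memory.setNat_nat, h1]
  set σ₂ := σ₁.setNat ⟨27, []⟩ (σ₁.getNat y - σ₁.getNat x) with hσ₂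
  set σ₃ := σ₂.setNat ⟨26, []⟩ (σ₂.getNat ⟨26, []⟩ + σ₂.getNat ⟨27, []⟩) with hσ₃
  have o₃ : ∀ z l, z ≠ 26 → z ≠ 27 → σ₃.nat (z, l) = σ.nat (z, l) := by
    intro z l h1 h2
    rw [← o₁ z l h1 h2]
    simp [hσ₃, hσ₂, Memory.setNat_nat, h1, h2]
  have h26 : σ₃.nat (26, []) = (a - b) + (b - a) := by
    simp [hσ₃, hσ₂, Memory.setNat_nat, Memory.getNat_mk]
    rw [hx σ₁ o₁, hy σ₁ o₁, hσ₁]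
    simp [Memory.setNat_nat, hx σ fun _ _ _ _ => rfl, hy σ fun _ _ _ _ => rfl]
  refine Ends.imp (T := 1 + (1 + (1 + (T + 1)))) (Ends.run_seq (.natSub _ _ _ _) (Ends.run_seq
    (.natSub _ _ _ _) (Ends.run_seq (.natAdd _ _ _ _) (Ends.ifNatZero (fun h0 => ?_)
      fun h0 => ?_)))) (by omega) fun _ _ h => h
  · have h0' : σ₃.nat (26, []) = 0 := h0
    exact h₁ (by omega) σ₃ o₃ rfl
  · have h0' : σ₃.nat (26, []) ≠ 0 := h0
    exact (Ends.of_run (.skip _) (h₂ (by omega) σ₃ o₃ rfl)).imp hT fun _ _ h => h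

/-- Division by repeated subtraction: after `j` rounds either the remainder is already below `X`, or
exactly `j` copies of `X` have been removed. The second case cannot persist after `a` rounds, as `X
* a ≥ a`. -/
theorem readDigit_ends {a X U : ℕ} (ha : σ.nat (31, []) = a) (hX : σ.nat (9, []) = X)
    (hX1 : 1 ≤ X) (hU : 1 ≤ U) (haU : a ≤ U) :
    Ends readDigit σ (17 * U) fun τ => τ.nat (35, []) = a % X ∧ τ.nat (31, []) = a / X := by
  refine Ends.imp (T := 1 + (1 + (1 + ((a * (5 + 4) + 3) + (1 + 1))))) (Ends.run_seq (.natConst _ _ _)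
    (Ends.run_seq (.natConst _ _ _) (Ends.run_seq (.natAdd _ _ _ _) (Ends.seq
    (Ends.forLoop (n := a) (fun j τ => τ.nat (35, []) + X * τ.nat (38, []) = a ∧
      (τ.nat (35, []) < X ∨ τ.nat (38, []) = j)) (by rfl) ?_ ?_ ?_ ?_)
    fun τ hF h => Ends.run_seq (.natConst _ _ _) (Ends.of_run (R := fun τ =>
      τ.nat (35, []) = a % X ∧ τ.nat (31, []) = a / X) (.natAdd _ _ _ _) ?_)))))
    (by omega) fun _ _ h => h
  · simp [Memory.setNat_nat, ha]
  · intro j τ τ' hn _ h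
    simpa [hn] using h
  · simp [Memory.setNat_nat, Memory.getNat_mk, ha]
  · rintro j - τ hF - ⟨hsum, hor⟩
    have h9 : τ.nat (9, []) = X := by
      rw [hF.nat 9 [] rfl]
      simpa [Memory.setNat_nat] using hX
    refine Ends.run_seq (T := 4) (.natSub _ _ _ _) (Ends.ifNatZero (fun h0 => ?_) fun h0 => ?_)
    · refine Ends.run_seq (.natSub _ _ _ _) (Ends.run_seq (.natConst _ _ _)
        (Ends.of_run (.natAdd _ _ _ _) ?_))
      simp [Memory.setNat_nat, Memory.getNat_mk, h9] at h0 ⊢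
      rw [Nat.mul_succ]
      omega
    · refine Ends.imp (Ends.of_run (.skip _) (R := fun τ =>
        τ.nat (35, []) + X * τ.nat (38, []) = a ∧ (τ.nat (35, []) < X ∨ τ.nat (38, []) = j + 1)) ?_)
        (by norm_num) fun _ _ h => h
      simp [Memory.setNat_nat, Memory.getNat_mk, h9] at h0 ⊢
      exact ⟨hsum, Or.inl (by omega)⟩
  · obtain ⟨hsum, hor⟩ := h
    have hlt : τ.nat (35, []) < X := by
      rcases hor with h | h
      · exact h
      · by_contra hge
        have h1 : a ≤ X * a := Nat.le_mul_of_pos_left a hX1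
        rw [h] at hsum
        omega
    simp [Memory.setNat_nat, Memory.getNat_mk]
    rw [← hsum]
    exact ⟨by rw [Nat.add_mul_mod_self_left, Nat.mod_eq_of_lt hlt],
      by rw [Nat.add_mul_div_left _ _ hX1, Nat.div_eq_of_lt hlt, zero_add]⟩

/-- The row `s` of the array `34` is the indicator function of `A` on the numbers below `n`. -/
def HoldsSet (n s : ℕ) (A : Finset ℕ) (σ : Memory F) : Prop :=
  ∀ r < n, σ.nat (34, [s, r]) = if r ∈ A then 1 else 0

theorem card_filter_lt_succ (A : Finset ℕ) (p : ℕ → Prop) [DecidablePred p] (j : ℕ) :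
    (A.filter fun r => r < j + 1 ∧ p r).card =
      (A.filter fun r => r < j ∧ p r).card + if j ∈ A ∧ p j then 1 else 0 := by
  have h : (A.filter fun r => r < j + 1 ∧ p r) =
      (A.filter fun r => r < j ∧ p r) ∪ A.filter fun r => r = j ∧ p r := by
    ext r
    simp only [Finset.mem_filter, Finset.mem_union]
    constructor
    · rintro ⟨hA, hr, hp⟩
      rcases Nat.lt_succ_iff_lt_or_eq.1 hr with h | h
      · exact Or.inl ⟨hA, h, hp⟩
      · exact Or.inr ⟨hA, h, hp⟩
    · rintro (⟨hA, hr, hp⟩ | ⟨hA, hr, hp⟩)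
      · exact ⟨hA, by omega, hp⟩
      · exact ⟨hA, by omega, hp⟩
  rw [h, Finset.card_union_of_disjoint]
  · congr 1
    split_ifs with hj
    · rw [Finset.card_eq_one]
      refine ⟨j, ?_⟩
      ext r
      simp only [Finset.mem_filter, Finset.mem_singleton]
      exact ⟨fun h => h.2.1, by rintro rfl; exact ⟨hj.1, rfl, hj.2⟩⟩
    · rw [Finset.card_eq_zero, Finset.filter_eq_empty_iff]
      rintro r hr ⟨rfl, hp⟩
      exact hj ⟨hr, hp⟩
  · rw [Finset.disjoint_left]
    intro r hr hr'
    simp only [Finset.mem_filter] at hr hr'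
    omega

/-- The part of `refineElement` that computes the index in the color class. -/
theorem classIndex_ends {D : Params F} (hD : D.Holds σ) {s r : ℕ} {A : Finset ℕ}
    (hr : r < D.n) (hs : σ.nat (20, []) = s) (hr23 : σ.nat (23, []) = r)
    (h36 : σ.nat (36, []) = 0) (hA : HoldsSet D.n s A σ) :
    Ends (forLoop 39 23 (.ifNatZero ⟨34, [20, 39]⟩ .skip (eqTest ⟨5, [20, 39]⟩ ⟨5, [20, 23]⟩
      (.natConst ⟨27, []⟩ 1 ⨾ .natAdd ⟨36, []⟩ ⟨36, []⟩ ⟨27, []⟩)))) σ (r * (7 + 4) + 3)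
      fun τ => τ.nat (36, []) = classIndex (D.col s) A r := by
  refine Ends.forLoop (n := r) (fun j τ => τ.nat (36, []) =
    (A.filter fun r' => r' < j ∧ D.col s r' = D.col s r).card) (by rfl) hr23 ?_ (by simpa using h36)
    ?_
  · intro j τ τ' hn _ h
    simpa [hn] using h
  · intro j hj τ hF h39 h
    have h20 : τ.nat (20, []) = s := (hF.nat 20 [] rfl).trans hs
    have h23 : τ.nat (23, []) = r := (hF.nat 23 [] rfl).trans hr23
    have h34 : τ.nat (34, [s, j]) = if j ∈ A then 1 else 0 :=
      (hF.nat 34 _ rfl).trans (hA j (by omega))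
    have h5 : ∀ r, τ.nat (5, [s, r]) = D.col s r := fun r => (hF.nat 5 _ rfl).trans (hD.col s r)
    rw [card_filter_lt_succ]
    refine Ends.ifNatZero (T := 6) (fun h0 => ?_) fun h0 => ?_
    · have hjA : j ∉ A := by
        intro hjA
        simp [Memory.getNat_mk, h20, h39, h34, hjA] at h0
      refine (Ends.of_run (.skip _) (R := fun τ => τ.nat (36, []) = _) ?_).imp (by norm_num)
        fun _ _ h => h
      simp [hjA, h]
    · have hjA : j ∈ A := by
        by_contra hjA
        simp [Memory.getNat_mk, h20, h39, h34, hjA] at h0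
      refine Ends.eqTest (a := D.col s j) (b := D.col s r) (T := 2) (fun ρ hρ => ?_)
        (fun ρ hρ => ?_) (by norm_num) (fun hab ρ hρ _ => ?_) fun hab ρ hρ _ => ?_
      · simp [Memory.getNat_mk, hρ, h20, h39, h5]
      · simp [Memory.getNat_mk, hρ, h20, h23, h5]
      · refine Ends.run_seq (.natConst _ _ _) (Ends.of_run (.natAdd _ _ _ _) ?_)
        simp [Memory.setNat_nat, Memory.getNat_mk, hρ, h, hab, hjA]
      · simp [hρ, h, hab]

theorem refineElement_ends {D : Params F} (hD : D.Holds σ) {s r g : ℕ} {A : Finset ℕ}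
    (hr : r < D.n) (hs : σ.nat (20, []) = s) (hs1 : σ.nat (37, []) = s + 1)
    (hr23 : σ.nat (23, []) = r) (hg : σ.nat (35, []) = g) (hA : HoldsSet D.n s A σ) {U : ℕ}
    (hU : 1 ≤ U) (hnU : D.n ≤ U) :
    Ends refineElement σ (31 * U ^ 1) fun τ => τ.nat (34, [s + 1, r]) =
        (if r ∈ refineStep D.n (D.col s) A g then 1 else 0) ∧
      ∀ l, l ≠ [s + 1, r] → τ.nat (34, l) = σ.nat (34, l) := by
  refine Ends.imp (T := 1 + ((r * (7 + 4) + 3) + (1 + (1 + (5 + 5 + 1)))))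
    (Ends.run_seq (.natConst _ _ _) (Ends.seq (classIndex_ends (hD.setNat (by decide)) hr
      (by simpa [Memory.setNat_nat] using hs) (by simpa [Memory.setNat_nat] using hr23)
      (by simp [Memory.setNat_nat])
      (fun r hr => by simpa [Memory.setNat_nat] using hA r hr)) fun τ hF h36 =>
      Ends.run_seq (.natAdd _ _ _ _) (Ends.run_seq (.natConst _ _ _) ?_)))
    (by rw [pow_one]; omega) fun _ _ h => h
  have h1 : τ.nat (1, []) = D.n :=
    (hF.nat 1 [] rfl).trans (by simpa [Memory.setNat_nat] using hD.n)
  have h20 : τ.nat (20, []) = s :=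
    (hF.nat 20 [] rfl).trans (by simpa [Memory.setNat_nat] using hs)
  have h23 : τ.nat (23, []) = r :=
    (hF.nat 23 [] rfl).trans (by simpa [Memory.setNat_nat] using hr23)
  have h35 : τ.nat (35, []) = g :=
    (hF.nat 35 [] rfl).trans (by simpa [Memory.setNat_nat] using hg)
  have h37 : τ.nat (37, []) = s + 1 :=
    (hF.nat 37 [] rfl).trans (by simpa [Memory.setNat_nat] using hs1)
  have h34 : ∀ l, τ.nat (34, l) = σ.nat (34, l) := fun l =>
    (hF.nat 34 l rfl).trans (by simp [Memory.setNat_nat])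
  have h5 : ∀ l, τ.nat (5, l) = σ.nat (5, l) := fun l =>
    (hF.nat 5 l rfl).trans (by simp [Memory.setNat_nat])
  set τ₁ := τ.setNat ⟨36, []⟩ (τ.getNat ⟨1, []⟩ + τ.getNat ⟨36, []⟩) with hτ₁
  set τ₂ := τ₁.setNat ⟨34, [37, 23]⟩ 0 with hτ₂
  have g20 : τ₂.nat (20, []) = s := by simp [hτ₂, hτ₁, Memory.setNat_nat, h20]
  have g23 : τ₂.nat (23, []) = r := by simp [hτ₂, hτ₁, Memory.setNat_nat, h23]
  have g35 : τ₂.nat (35, []) = g := by simp [hτ₂, hτ₁, Memory.setNat_nat, h35]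
  have g36 : τ₂.nat (36, []) = D.n + classIndex (D.col s) A r := by
    simp [hτ₂, hτ₁, Memory.setNat_nat, Memory.getNat_mk, h1, h36]
  have g37 : τ₂.nat (37, []) = s + 1 := by simp [hτ₂, hτ₁, Memory.setNat_nat, h37]
  have g34 : ∀ l, τ₂.nat (34, l) = if l = [s + 1, r] then 0 else σ.nat (34, l) := fun l => by
    simp [hτ₂, hτ₁, Memory.setNat_nat, h34, h37, h23]
  have g5 : ∀ r, τ₂.nat (5, [s, r]) = D.col s r := fun r => by
    simp [hτ₂, hτ₁, Memory.setNat_nat, h5, hD.col]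
  have hrA : τ₂.getNat ⟨34, [20, 23]⟩ = if r ∈ A then 1 else 0 := by
    simp [Memory.getNat_mk, g20, g23, g34, hA r hr]
  refine Ends.ifNatZero (fun h0 => ?_) fun h0 => ?_
  · have hr' : r ∉ A := by
      intro h
      simp [hrA, h] at h0
    refine (Ends.of_run (.skip _) (R := fun ρ => ρ.nat (34, [s + 1, r]) = _ ∧
      ∀ l, l ≠ [s + 1, r] → ρ.nat (34, l) = σ.nat (34, l)) ?_).imp (by norm_num) fun _ _ h => h
    simp +contextual [g34, refineStep, hr']
  · have hr' : r ∈ A := by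
      by_contra h
      simp [hrA, h] at h0
    refine Ends.seq (T := 1 + 4) (T' := 1 + 4) (R := fun ρ =>
      (∀ x l, x ≠ 26 → x ≠ 27 → x ≠ 34 → ρ.nat (x, l) = τ₂.nat (x, l)) ∧
      ρ.nat (34, [s + 1, r]) = (if g = D.col s r then 1 else 0) ∧
      ∀ l, l ≠ [s + 1, r] → ρ.nat (34, l) = σ.nat (34, l))
      (Ends.eqTest (a := g) (b := D.col s r) (fun ρ hρ => ?_)
        (fun ρ hρ => ?_) le_rfl (fun hab ρ hρ _ => ?_) fun hab ρ hρ _ => ?_)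
      fun ρ _ ⟨ho, hρr, hρ⟩ => Ends.eqTest (a := g) (b := D.n + classIndex (D.col s) A r)
        (fun π hπ => ?_) (fun π hπ => ?_) le_rfl (fun hab π hπ _ => ?_) fun hab π hπ _ => ?_
    · simp [Memory.getNat_mk, hρ, g35]
    · simp [Memory.getNat_mk, hρ, g20, g23, g5]
    · refine Ends.of_run (.natConst _ _ _) ?_
      simp +contextual [Memory.setNat_nat, hρ, g37, g23, g34, hab]
    · simp +contextual [hρ, g34, hab]
    · simp [Memory.getNat_mk, hπ, ho, g35]
    · simp [Memory.getNat_mk, hπ, ho, g36]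
    · refine Ends.of_run (.natConst _ _ _) ?_
      simp +contextual [Memory.setNat_nat, hπ, ho, g37, g23, hρ, refineStep, hr', hab]
    · simp +contextual [hπ, hρ, hρr, refineStep, hr', hab]

theorem refineProg_ends {D : Params F} (hD : D.Holds σ) {s g : ℕ} {A : Finset ℕ}
    (hs : σ.nat (20, []) = s) (hg : σ.nat (35, []) = g) (hA : HoldsSet D.n s A σ) {U : ℕ}
    (hU : 1 ≤ U) (hnU : D.n ≤ U) :
    Ends refineProg σ (40 * U ^ 2) (HoldsSet D.n (s + 1) (refineStep D.n (D.col s) A g)) := by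
  refine Ends.imp (T := 1 + (1 + (31 + 7) * U ^ (1 + 1))) (Ends.run_seq (.natConst _ _ _)
    (Ends.run_seq (.natAdd _ _ _ _) (Ends.forLoop_pow (n := D.n)
    (fun j τ => HoldsSet D.n s A τ ∧ HoldsSet j (s + 1) (refineStep D.n (D.col s) A g) τ)
    (by rfl) ?_ hU hnU ?_ ⟨?_, ?_⟩ ?_))) ?_ fun _ _ h => h.2
  · simpa [Memory.setNat_nat] using hD.n
  · intro j τ τ' hn _ h
    simpa [HoldsSet, hn] using h
  · intro r hr
    simpa [Memory.setNat_nat] using hA r hr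
  · intro r hr
    omega
  · rintro j hj τ hF h23 ⟨hτA, hτ⟩
    have hD' : D.Holds τ := ((hD.setNat (by decide)).setNat (by decide)).frame hF (by rfl)
    refine (refineElement_ends hD' hj (s := s) (g := g) ?_ ?_ h23 ?_ hτA hU hnU).imp le_rfl ?_
    · rw [hF.nat 20 [] rfl]
      simp [Memory.setNat_nat, hs]
    · rw [hF.nat 37 [] rfl]
      simp [Memory.setNat_nat, Memory.getNat_mk, hs]
    · rw [hF.nat 35 [] rfl]
      simp [Memory.setNat_nat, hg]
    · rintro ρ - ⟨h1, h2⟩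
      refine ⟨fun r hr => ?_, fun r hr => ?_⟩
      · rw [h2 _ (by simp), hτA r hr]
      · rcases Nat.lt_succ_iff_lt_or_eq.1 hr with h | rfl
        · rw [h2 _ (by simpa using h.ne), hτ r h]
        · exact h1
  · have := Nat.one_le_pow 2 U hU
    norm_num
    omega

theorem weightElement_ends {D : Params F} (hD : D.Holds σ) {s r p u w : ℕ} {B : Finset ℕ}
    (hr : r < D.n) (hs : σ.nat (20, []) = s) (hr23 : σ.nat (23, []) = r)
    (hp : σ.nat (41, []) = p) (hu : σ.nat (40, []) = u) (hw : σ.nat (32, [r]) = w)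
    (hB : HoldsSet D.n s B σ) {U : ℕ} (hU : 1 ≤ U) (hXU : D.X ≤ U) :
    Ends weightElement σ (20 * U ^ 1) fun τ =>
      τ.nat (32, [r]) = w * D.X + (if r ∈ B then u else 0) ∧
      τ.nat (40, []) = (if p ≤ u + u then u + u - p else u + u) ∧
      ∀ l, l ≠ [r] → τ.nat (32, l) = σ.nat (32, l) := by
  refine Ends.imp (T := 1 + ((D.X * (1 + 4) + 3) + ((1 + 1) + (1 + (1 + (1 + (1 + (1 + 1))))))))
    (Ends.run_seq (.natConst _ _ _) (Ends.seq (Ends.forLoop (n := D.X)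
      (fun j τ => τ.nat (26, []) = w * j) (by rfl) ?_ ?_ ?_ ?_) fun τ hF h26 => Ends.seq
      (R := fun ρ => (∀ x l, x ≠ 26 → ρ.nat (x, l) = τ.nat (x, l)) ∧
        ρ.nat (26, []) = w * D.X + if r ∈ B then u else 0) ?_
      fun ρ _ ⟨ho, h26⟩ => Ends.run_seq (.natConst _ _ _) (Ends.run_seq (.natAdd _ _ _ _)
        (Ends.run_seq (.natAdd _ _ _ _) (Ends.run_seq (.natSub _ _ _ _) (Ends.ifNatZero
        (fun h0 => ?_) fun h0 => ?_))))))
    (by rw [pow_one]; omega) fun _ _ h => h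
  · simpa [Memory.setNat_nat] using hD.X
  · intro j τ τ' hn _ h
    simpa [hn] using h
  · simp [Memory.setNat_nat]
  · rintro j hj τ hF - h
    have h23 := hF.nat 23 [] rfl
    have h32 := hF.nat 32 [r] rfl
    simp only [Memory.setNat_nat, Prod.mk.injEq, Nat.reduceEqDiff, false_and, if_false, hr23, hw]
      at h23 h32
    refine Ends.of_run (.natAdd _ _ _ _) ?_
    simp [Memory.setNat_nat, Memory.getNat_mk, h23, h32, h]
    ring
  · have g20 : τ.nat (20, []) = s := (hF.nat 20 [] rfl).trans (by simp [Memory.setNat_nat, hs])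
    have g23 : τ.nat (23, []) = r := (hF.nat 23 [] rfl).trans (by simp [Memory.setNat_nat, hr23])
    have g40 : τ.nat (40, []) = u := (hF.nat 40 [] rfl).trans (by simp [Memory.setNat_nat, hu])
    have g34 : τ.nat (34, [s, r]) = if r ∈ B then 1 else 0 :=
      (hF.nat 34 _ rfl).trans (by simpa [Memory.setNat_nat] using hB r hr)
    refine Ends.ifNatZero (fun h0 => Ends.of_run (.skip _) ?_)
      fun h0 => Ends.of_run (.natAdd _ _ _ _) ?_
    · simp [Memory.getNat_mk, g20, g23, g34] at h0
      simp [h26, h0]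
    · simp [Memory.getNat_mk, g20, g23, g34] at h0
      simp +contextual [Memory.setNat_nat, Memory.getNat_mk, h26, h0, g40]
  all_goals
    have g23 : ρ.nat (23, []) = r := by
      rw [ho 23 [] (by decide), hF.nat 23 [] rfl]
      simp [Memory.setNat_nat, hr23]
    have g40 : ρ.nat (40, []) = u := by
      rw [ho 40 [] (by decide), hF.nat 40 [] rfl]
      simp [Memory.setNat_nat, hu]
    have g41 : ρ.nat (41, []) = p := by
      rw [ho 41 [] (by decide), hF.nat 41 [] rfl]
      simp [Memory.setNat_nat, hp]
    have g32 : ∀ l, ρ.nat (32, l) = σ.nat (32, l) := fun l => by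
      rw [ho 32 l (by decide), hF.nat 32 l rfl]
      simp [Memory.setNat_nat]
    simp [Memory.setNat_nat, Memory.getNat_mk, g40, g41] at h0
  · refine Ends.of_run (.natSub _ _ _ _) ?_
    simp +contextual [Memory.setNat_nat, Memory.getNat_mk, g40, g41, g23, g32, h26]
    omega
  · refine Ends.of_run (.skip _) ?_
    simp +contextual [Memory.setNat_nat, Memory.getNat_mk, g40, g41, g23, g32, h26]
    omega

/-- Cell `40` runs through the residues of the powers of two in step with the variables, whether or
not they belong to `B`. -/
theorem weightProg_ends {D : Params F} (hD : D.Holds σ) {s p : ℕ} {w : ℕ → ℕ} {B : Finset ℕ}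
    (hs : σ.nat (20, []) = s) (hp : σ.nat (35, []) = p) (hw : ∀ r < D.n, σ.nat (32, [r]) = w r)
    (hB : HoldsSet D.n s B σ) {U : ℕ} (hU : 1 ≤ U) (hXU : D.X ≤ U) (hnU : D.n ≤ U) :
    Ends weightProg σ (30 * U ^ 2) fun τ => ∀ r < D.n,
      τ.nat (32, [r]) = w r * D.X + (if r ∈ B then powResidue (p + 1) r else 0) := by
  refine Ends.imp (T := 1 + (1 + (1 + (20 + 7) * U ^ (1 + 1)))) (Ends.run_seq (.natConst _ _ _)
    (Ends.run_seq (.natAdd _ _ _ _) (Ends.run_seq (.natConst _ _ _) (Ends.forLoop_pow (n := D.n)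
    (fun j τ => τ.nat (40, []) = powResidue (p + 1) j ∧ ∀ r < D.n, τ.nat (32, [r]) =
      if r < j then w r * D.X + (if r ∈ B then powResidue (p + 1) r else 0) else w r)
    (by rfl) ?_ hU hnU ?_ ?_ ?_)))) ?_ fun τ _ h r hr => by rw [h.2 r hr, if_pos hr]
  · simpa [Memory.setNat_nat] using hD.n
  · intro j τ τ' hn _ h
    simpa [hn] using h
  · simp +contextual [Memory.setNat_nat, hw, powResidue]
  · rintro j hj τ hF h23 ⟨h40, hτ⟩
    have hD' : D.Holds τ :=
      (((hD.setNat (by decide)).setNat (by decide)).setNat (by decide)).frame hF (by rfl)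
    refine (weightElement_ends hD' hj (s := s) (p := p + 1) (B := B) ?_ h23 ?_ h40 (hτ j hj) ?_ hU
      hXU).imp le_rfl ?_
    · rw [hF.nat 20 [] rfl]
      simp [Memory.setNat_nat, hs]
    · rw [hF.nat 41 [] rfl]
      simp [Memory.setNat_nat, Memory.getNat_mk, hp]
    · intro r hr
      rw [hF.nat 34 _ rfl]
      simpa [Memory.setNat_nat] using hB r hr
    · rintro ρ - ⟨h1, h2, h3⟩
      refine ⟨by rw [h2, powResidue], fun r hr => ?_⟩
      rcases eq_or_ne r j with rfl | hne
      · simpa using h1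
      · rw [h3 _ (by simpa using hne), hτ r hr]
        exact if_congr (by omega) rfl rfl
  · have := Nat.one_le_pow 2 U hU
    norm_num
    omega

end Decoding

/-! ### Correctness and cost of decoding a complete code -/

section Stages

variable {F : Type*} [Field F] {σ : Memory F}

theorem digit_div (X a o i : ℕ) : digit X (a / X ^ o) i = digit X a (o + i) := by
  rw [digit, digit, Nat.div_div_eq_div_mul, pow_add]

theorem div_pow_succ (X a i : ℕ) : a / X ^ i / X = a / X ^ (i + 1) := by
  rw [Nat.div_div_eq_div_mul, pow_succ]

/-- Row `s` of the array `34` holds the set after `s` refinements. Before the moduli are read, cell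
`20` is set to `q`, so that the weights see the final base set. -/
theorem stageProg_ends {D : Params F} (hD : D.Holds σ) {a U : ℕ} {w : ℕ → ℕ}
    (ha : σ.nat (31, []) = a) (hw : ∀ r < D.n, σ.nat (32, [r]) = w r) (hX1 : 1 ≤ D.X)
    (haU : a ≤ U) (hU : 1 ≤ U) (hXU : D.X ≤ U) (hnU : D.n ≤ U) (hqU : D.q ≤ U) (hlU : D.l ≤ U) :
    Ends stageProg σ (132 * U ^ 3) fun τ => τ.nat (31, []) = a / D.X ^ (D.q + D.l) ∧
      ∀ r < D.n, τ.nat (32, [r]) = horner D.X (fun i =>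
        if r ∈ refineSet D.n D.col (fun s => digit D.X a s) (Finset.range D.n) D.q then
          powResidue (digit D.X a (D.q + i) + 1) r else 0) (w r) D.l := by
  have hU1 : 1 ≤ U ^ 2 := Nat.one_le_pow 2 U hU
  have hU2 : U ≤ U ^ 2 := Nat.le_self_pow (by norm_num) U
  have hU3 : U ^ 2 ≤ U ^ 3 := Nat.pow_le_pow_right hU (by norm_num)
  refine Ends.imp (T := 1 + ((1 + 7) * U ^ (0 + 1) + ((57 + 7) * U ^ (2 + 1) + (1 + (1 +
    (47 + 7) * U ^ (2 + 1)))))) (Ends.run_seq (.natConst _ _ _) (Ends.seq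
    (Ends.forLoop_pow (n := D.n) (fun j τ => HoldsSet j 0 (Finset.range D.n) τ) (by rfl) ?_ hU hnU
      ?_ ?_ ?_) fun σ₁ hF₁ h₁ => Ends.seq (Ends.forLoop_pow (n := D.q)
    (fun j τ => τ.nat (31, []) = a / D.X ^ j ∧ HoldsSet D.n j
      (refineSet D.n D.col (fun s => digit D.X a s) (Finset.range D.n) j) τ)
      (by rfl) ?_ hU hqU ?_ ⟨?_, h₁⟩ ?_) fun σ₂ hF₂ h₂ => Ends.run_seq (.natConst _ _ _)
    (Ends.run_seq (.natAdd _ _ _ _) (Ends.forLoop_pow (n := D.l)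
    (fun j τ => τ.nat (31, []) = a / D.X ^ (D.q + j) ∧ ∀ r < D.n, τ.nat (32, [r]) = horner D.X
      (fun i => if r ∈ refineSet D.n D.col (fun s => digit D.X a s) (Finset.range D.n) D.q then
          powResidue (digit D.X a (D.q + i) + 1) r else 0) (w r) j)
      (by rfl) ?_ hU hlU ?_ ⟨?_, ?_⟩ ?_)))) ?_ fun _ _ h => h
  · simpa [Memory.setNat_nat] using hD.n
  · intro j τ τ' hn _ h
    simpa [HoldsSet, hn] using h
  · intro r hr
    omega
  · intro j hj τ hF h23 h
    have h20 : τ.nat (20, []) = 0 := (hF.nat 20 [] rfl).trans (by simp [Memory.setNat_nat])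
    rw [pow_zero, mul_one]
    refine Ends.of_run (.natConst _ _ _) fun r hr => ?_
    rcases Nat.lt_succ_iff_lt_or_eq.1 hr with hlt | rfl
    · simpa [Memory.setNat_nat, h20, h23, hlt.ne] using h r hlt
    · simp [Memory.setNat_nat, h20, h23, hj]
  · rw [hF₁.nat 6 [] rfl]
    simpa [Memory.setNat_nat] using hD.q
  · intro j τ τ' hn _ h
    simpa [HoldsSet, hn] using h
  · rw [hF₁.nat 31 [] rfl]
    simpa [Memory.setNat_nat] using ha
  · rintro j hj τ hF h20 ⟨h31, hset⟩
    have hD' : D.Holds τ := ((hD.setNat (by decide)).frame hF₁ (by rfl)).frame hF (by rfl)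
    refine (Ends.seq (readDigit_ends h31 hD'.X hX1 hU ((Nat.div_le_self _ _).trans haU))
      fun ρ hG ⟨h35, h31'⟩ => (refineProg_ends (hD'.frame hG (by rfl))
        ((hG.nat 20 [] rfl).trans h20) h35 (A := refineSet D.n D.col (fun s => digit D.X a s)
        (Finset.range D.n) j) (fun r hr => (hG.nat 34 _ rfl).trans (hset r hr)) hU hnU).imp
        (R' := fun π => π.nat (31, []) = a / D.X ^ (j + 1) ∧ HoldsSet D.n (j + 1)
      (refineSet D.n D.col (fun s => digit D.X a s) (Finset.range D.n) (j + 1)) π) le_rfl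
        fun π hP hπ => ⟨?_, hπ⟩).imp (by omega) fun _ _ h => h
    rw [hP.nat 31 [] rfl, h31', div_pow_succ]
  · have h := ((hD.setNat (by decide)).frame hF₁ (by rfl)).frame hF₂ (by rfl)
    simpa [Memory.setNat_nat] using h.l
  · intro j τ τ' hn _ h
    simpa [hn] using h
  · simpa [Memory.setNat_nat] using h₂.1
  · intro r hr
    have h := (hF₂.nat 32 [r] rfl).trans (hF₁.nat 32 [r] rfl)
    simpa [Memory.setNat_nat, horner, hw r hr] using h
  · rintro j hj τ hF - ⟨h31, hτ⟩
    have hD₂ : D.Holds σ₂ := ((hD.setNat (by decide)).frame hF₁ (by rfl)).frame hF₂ (by rfl)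
    have hD' : D.Holds τ := ((hD₂.setNat (by decide)).setNat (by decide)).frame hF (by rfl)
    refine (Ends.seq (readDigit_ends h31 hD'.X hX1 hU ((Nat.div_le_self _ _).trans haU))
      fun ρ hG ⟨h35, h31'⟩ => (weightProg_ends (hD'.frame hG (by rfl)) (s := D.q) ?_ h35
        (fun r hr => (hG.nat 32 _ rfl).trans (hτ r hr))
        (B := refineSet D.n D.col (fun s => digit D.X a s) (Finset.range D.n) D.q) ?_ hU hXU
        hnU).imp (R' := fun π => π.nat (31, []) = a / D.X ^ (D.q + (j + 1)) ∧
          ∀ r < D.n, π.nat (32, [r]) = horner D.X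
      (fun i => if r ∈ refineSet D.n D.col (fun s => digit D.X a s) (Finset.range D.n) D.q then
          powResidue (digit D.X a (D.q + i) + 1) r else 0) (w r) (j + 1)) le_rfl
        fun π hP hπ => ⟨?_, hπ⟩).imp (by omega) fun _ _ h => h
    · rw [hG.nat 20 [] rfl, hF.nat 20 [] rfl]
      simp [Memory.setNat_nat, Memory.getNat_mk, hD₂.q]
    · intro r hr
      rw [hG.nat 34 _ rfl, hF.nat 34 _ rfl]
      simpa [Memory.setNat_nat] using h₂.2 r hr
    · rw [hP.nat 31 [] rfl, h31', div_pow_succ, add_assoc]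
  · norm_num
    omega

theorem decodeProg_ends {D : Params F} (hD : D.Holds σ) {a U : ℕ}
    (ha : σ.nat (30, []) = a) (hX1 : 1 ≤ D.X) (haU : a ≤ U) (hU : 1 ≤ U) (hXU : D.X ≤ U)
    (hnU : D.n ≤ U) (hqU : D.q ≤ U) (hlU : D.l ≤ U) (hmU : D.m ≤ U) :
    Ends decodeProg σ (149 * U ^ 4) fun τ => ∀ r < D.n,
      τ.nat (32, [r]) = codeWeight D.n D.q D.l D.X D.col a r D.m := by
  have hU1 : 1 ≤ U ^ 4 := Nat.one_le_pow 4 U hU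
  have hU2 : U ≤ U ^ 4 := Nat.le_self_pow (by norm_num) U
  refine Ends.imp (T := 1 + (1 + ((1 + 7) * U ^ (0 + 1) + (132 + 7) * U ^ (3 + 1))))
    (Ends.run_seq (.natConst _ _ _) (Ends.run_seq (.natAdd _ _ _ _) (Ends.seq
    (Ends.forLoop_pow (n := D.n) (fun j τ => ∀ r < j, τ.nat (32, [r]) = 0) (by rfl) ?_ hU hnU
      ?_ ?_ ?_) fun σ₁ hF₁ h₁ => Ends.forLoop_pow (n := D.m)
    (fun t τ => τ.nat (31, []) = a / D.X ^ (t * (D.q + D.l)) ∧ ∀ r < D.n,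
      τ.nat (32, [r]) = codeWeight D.n D.q D.l D.X D.col a r t) (by rfl) ?_ hU hmU ?_ ⟨?_, h₁⟩ ?_)))
    ?_ fun _ _ h => h.2
  · simpa [Memory.setNat_nat] using hD.n
  · intro j τ τ' hn _ h
    simpa [hn] using h
  · intro r hr
    omega
  · intro j hj τ hF h23 h
    rw [pow_zero, mul_one]
    refine Ends.of_run (.natConst _ _ _) fun r hr => ?_
    rcases Nat.lt_succ_iff_lt_or_eq.1 hr with hlt | rfl
    · simpa [Memory.setNat_nat, h23, hlt.ne] using h r hlt
    · simp [Memory.setNat_nat, h23]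
  · rw [hF₁.nat 7 [] rfl]
    simpa [Memory.setNat_nat] using hD.m
  · intro j τ τ' hn _ h
    simpa [hn] using h
  · rw [hF₁.nat 31 [] rfl]
    simp [Memory.setNat_nat, Memory.getNat_mk, ha]
  · rintro t ht τ hF - ⟨h31, hτ⟩
    have hD' : D.Holds τ :=
      (((hD.setNat (by decide)).setNat (by decide)).frame hF₁ (by rfl)).frame hF (by rfl)
    refine (stageProg_ends hD' h31 hτ hX1 ((Nat.div_le_self _ _).trans haU) hU hXU hnU hqU
      hlU).imp le_rfl fun ρ _ ⟨h1, h2⟩ => ⟨?_, fun r hr => ?_⟩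
    · rw [h1, Nat.div_div_eq_div_mul, ← pow_add, add_mul, one_mul]
    · rw [h2 r hr, codeWeight]
      simp only [digit_div, codeSet, add_assoc]
  · norm_num
    omega

end Stages

/-! ### The program: evaluating the circuits and searching for a nonzero coefficient

As many coefficients as the variable `10` says of polynomials in one variable are
stored in the field arrays `3` (the value of all circuits) and `4` (the partial products of a
product gate). -/

/-- Computes the coefficient `42` of the next partial product. -/
def factorElement : Prog :=
  .fldMul ⟨4, [44, 42]⟩ ⟨1, [20, 21, 22]⟩ ⟨4, [22, 42]⟩ ⨾
  forLoop 23 1 (.natSub ⟨27, []⟩ ⟨32, [23]⟩ ⟨42, []⟩ ⨾ .ifNatZero ⟨27, []⟩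
    (.natSub ⟨43, []⟩ ⟨42, []⟩ ⟨32, [23]⟩ ⨾
      .fldMul ⟨5, []⟩ ⟨2, [20, 21, 22, 23]⟩ ⟨4, [22, 43]⟩ ⨾
      .fldAdd ⟨4, [44, 42]⟩ ⟨4, [44, 42]⟩ ⟨5, []⟩) .skip)

/-- Multiplies a partial product by the factor `22`. -/
def factorProg : Prog :=
  .natConst ⟨27, []⟩ 1 ⨾ .natAdd ⟨44, []⟩ ⟨22, []⟩ ⟨27, []⟩ ⨾ forLoop 42 10 factorElement

/-- Adds the product gate `21` of the circuit `20` to the value of the circuits. -/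
def productProg : Prog :=
  .natConst ⟨22, []⟩ 0 ⨾ forLoop 42 10 (.fldZero ⟨4, [22, 42]⟩) ⨾ .natConst ⟨42, []⟩ 0 ⨾
  .fldOne ⟨4, [22, 42]⟩ ⨾ forLoop 22 24 factorProg ⨾
  forLoop 42 10 (.fldMul ⟨5, []⟩ ⟨0, [20, 21]⟩ ⟨4, [24, 42]⟩ ⨾
    .fldAdd ⟨3, [42]⟩ ⟨3, [42]⟩ ⟨5, []⟩)

/-- Computes the value of all circuits. -/
def evalProg : Prog :=
  forLoop 42 10 (.fldZero ⟨3, [42]⟩) ⨾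
  forLoop 20 2 (.natConst ⟨27, []⟩ 0 ⨾ .natAdd ⟨24, []⟩ ⟨4, [20]⟩ ⟨27, []⟩ ⨾
    forLoop 21 3 productProg)

/-- Outputs `1` if the value of the circuits has a nonzero coefficient. -/
def checkProg : Prog :=
  forLoop 42 10 (.ifFldZero ⟨3, [42]⟩ .skip (.natConst ⟨0, []⟩ 1))

/-- The search through all codes. -/
def searchProg : Prog := forLoop 30 10 (decodeProg ⨾ evalProg ⨾ checkProg)

open Polynomial

namespace Params

variable {F : Type*} [Field F]

/-- The value of a factor if a power of one variable is substituted for each variable. -/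
noncomputable def factorVal (D : Params F) (w : ℕ → ℕ) (s i j : ℕ) : F[X] :=
  C (D.const s i j) + ∑ r ∈ Finset.range D.n, C (D.coeff s i j r) * Polynomial.X ^ w r

/-- The value of the product of the first `j` factors. -/
noncomputable def productVal (D : Params F) (w : ℕ → ℕ) (s i j : ℕ) : F[X] :=
  ∏ j' ∈ Finset.range j, D.factorVal w s i j'

/-- The value of the first `i` product gates of a circuit. -/
noncomputable def gatesVal (D : Params F) (w : ℕ → ℕ) (s i : ℕ) : F[X] :=
  ∑ i' ∈ Finset.range i, C (D.top s i') * D.productVal w s i' (D.d s)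

/-- The value of the first `s` circuits. -/
noncomputable def circuitsVal (D : Params F) (w : ℕ → ℕ) (s : ℕ) : F[X] :=
  ∑ s' ∈ Finset.range s, D.gatesVal w s' D.k

/-- Coefficient `v` of the product needs only coefficients of `p` up to `v`. Truncating all
polynomials at degree `U` therefore leaves the stored coefficients exact. -/
theorem coeff_mul_factorVal (D : Params F) (w : ℕ → ℕ) (s i j v : ℕ) (p : F[X]) :
    (p * D.factorVal w s i j).coeff v = D.const s i j * p.coeff v +
      ∑ r ∈ Finset.range D.n, if w r ≤ v then D.coeff s i j r * p.coeff (v - w r) else 0 := by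
  rw [factorVal, mul_add, coeff_add, mul_comm p (C _), coeff_C_mul, Finset.mul_sum,
    finsetSum_coeff]
  congr 1
  refine Finset.sum_congr rfl fun r _ => ?_
  rw [mul_left_comm, coeff_C_mul, coeff_mul_X_pow', mul_ite, mul_zero]

end Params

/-! ### Correctness and cost of the truncated expansion and of the search -/

section Evaluation

variable {F : Type*} [Field F] {σ : Memory F} {D : Params F} {w : ℕ → ℕ}

theorem factorElement_ends (hD : D.Holds σ) (hw : ∀ r < D.n, σ.nat (32, [r]) = w r)
    {s i j v U : ℕ} {p : F[X]} (hs : σ.nat (20, []) = s) (hi : σ.nat (21, []) = i)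
    (hj : σ.nat (22, []) = j) (hj1 : σ.nat (44, []) = j + 1) (hv : σ.nat (42, []) = v)
    (hp : ∀ v' ≤ v, σ.fld (4, [j, v']) = p.coeff v') (hU : 1 ≤ U) (hnU : D.n ≤ U) :
    Ends factorElement σ (13 * U ^ 1) fun τ =>
      τ.fld (4, [j + 1, v]) = (p * D.factorVal w s i j).coeff v ∧
      ∀ l, l ≠ [j + 1, v] → τ.fld (4, l) = σ.fld (4, l) := by
  refine Ends.imp (T := 1 + (D.n * (5 + 4) + 3)) (Ends.run_seq (.fldMul _ _ _ _)
    (Ends.forLoop (n := D.n) (fun r' τ => τ.fld (4, [j + 1, v]) = D.const s i j * p.coeff v +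
      (∑ r ∈ Finset.range r', if w r ≤ v then D.coeff s i j r * p.coeff (v - w r) else 0) ∧
      ∀ l, l ≠ [j + 1, v] → τ.fld (4, l) = σ.fld (4, l)) (by rfl) ?_ ?_ ?_ ?_))
    (by rw [pow_one]; omega) fun τ _ h => by rwa [D.coeff_mul_factorVal]
  · simpa [Memory.setFld_nat] using hD.n
  · intro j τ τ' _ hf h
    simpa [hf] using h
  · simp +contextual [Memory.setFld_fld, Memory.getFld_mk, hs, hi, hj, hj1, hv, hD.const, hp]
  · rintro r hr τ hF h23 ⟨h1, h2⟩
    have hD' : D.Holds τ := (hD.setFld (by decide)).frame hF (by rfl)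
    have h20 : τ.nat (20, []) = s := (hF.nat 20 [] rfl).trans hs
    have h21 : τ.nat (21, []) = i := (hF.nat 21 [] rfl).trans hi
    have h22 : τ.nat (22, []) = j := (hF.nat 22 [] rfl).trans hj
    have h44 : τ.nat (44, []) = j + 1 := (hF.nat 44 [] rfl).trans hj1
    have h42 : τ.nat (42, []) = v := (hF.nat 42 [] rfl).trans hv
    have h32 : τ.nat (32, [r]) = w r := (hF.nat 32 _ rfl).trans (hw r hr)
    rw [Finset.sum_range_succ]
    refine Ends.run_seq (T := 4) (.natSub _ _ _ _) (Ends.ifNatZero (fun h0 => ?_) fun h0 => ?_)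
    · have hle : w r ≤ v := by
        simpa [Memory.setNat_nat, Memory.getNat_mk, h23, h32, h42, Nat.sub_eq_zero_iff_le] using h0
      refine Ends.run_seq (.natSub _ _ _ _) (Ends.run_seq (.fldMul _ _ _ _)
        (Ends.of_run (.fldAdd _ _ _ _) ?_))
      have h3 : τ.fld (4, [j, v - w r]) = p.coeff (v - w r) := by
        rw [h2 _ (by simp), hp _ (Nat.sub_le _ _)]
      simp +contextual [Memory.setNat_nat, Memory.getNat_mk, Memory.setFld_fld, Memory.getFld_mk,
        Memory.setFld_nat, Memory.setNat_fld, h20, h21, h22, h44, h42, h23, h32, h3, h1, h2, hle,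
        hD'.coeff, add_assoc]
    · have hle : ¬ w r ≤ v := by
        simpa [Memory.setNat_nat, Memory.getNat_mk, h23, h32, h42, Nat.sub_eq_zero_iff_le] using h0
      refine Ends.imp (Ends.of_run (.skip _) (R := fun τ => τ.fld (4, [j + 1, v]) = _ ∧
        ∀ l, l ≠ [j + 1, v] → τ.fld (4, l) = σ.fld (4, l)) ⟨?_, h2⟩) (by norm_num) fun _ _ h => h
      simp [Memory.setNat_fld, h1, hle]

theorem factorProg_ends (hD : D.Holds σ) (hw : ∀ r < D.n, σ.nat (32, [r]) = w r)
    {s i j : ℕ} {p : F[X]} (hs : σ.nat (20, []) = s) (hi : σ.nat (21, []) = i)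
    (hj : σ.nat (22, []) = j) (hp : ∀ v < D.U, σ.fld (4, [j, v]) = p.coeff v)
    (hU : 1 ≤ D.U) (hnU : D.n ≤ D.U) :
    Ends factorProg σ (22 * D.U ^ 2) fun τ =>
      ∀ v < D.U, τ.fld (4, [j + 1, v]) = (p * D.factorVal w s i j).coeff v := by
  refine Ends.imp (T := 1 + (1 + (13 + 7) * D.U ^ (1 + 1))) (Ends.run_seq (.natConst _ _ _)
    (Ends.run_seq (.natAdd _ _ _ _) (Ends.forLoop_pow (n := D.U) (fun v' τ =>
      (∀ v < v', τ.fld (4, [j + 1, v]) = (p * D.factorVal w s i j).coeff v) ∧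
      ∀ v < D.U, τ.fld (4, [j, v]) = p.coeff v) (by rfl) ?_ hU le_rfl ?_ ?_ ?_)))
    ?_ fun τ _ h => h.1
  · simpa [Memory.setNat_nat] using hD.U
  · intro j τ τ' _ hf h
    simpa [hf] using h
  · exact ⟨fun v hv => by omega, hp⟩
  · rintro v hv τ hF h42 ⟨h1, h2⟩
    have hD' : D.Holds τ := ((hD.setNat (by decide)).setNat (by decide)).frame hF (by rfl)
    refine (factorElement_ends (w := w) hD' (fun r hr => ?_) (s := s) (i := i) (j := j) ?_ ?_ ?_ ?_
      h42 (fun v' hv' => h2 v' (by omega)) hU hnU).imp le_rfl fun ρ _ ⟨g1, g2⟩ =>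
        ⟨fun v' hv' => ?_, fun v' hv' => ?_⟩
    · rw [hF.nat 32 _ rfl]
      simpa [Memory.setNat_nat] using hw r hr
    · rw [hF.nat 20 _ rfl]
      simpa [Memory.setNat_nat] using hs
    · rw [hF.nat 21 _ rfl]
      simpa [Memory.setNat_nat] using hi
    · rw [hF.nat 22 _ rfl]
      simpa [Memory.setNat_nat] using hj
    · rw [hF.nat 44 _ rfl]
      simp [Memory.setNat_nat, Memory.getNat_mk, hj]
    · rcases Nat.lt_succ_iff_lt_or_eq.1 hv' with hlt | rfl
      · rw [g2 _ (by simpa using hlt.ne), h1 v' hlt]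
      · exact g1
    · rw [g2 _ (by simp), h2 v' hv']
  · have := Nat.one_le_pow 2 D.U hU
    norm_num
    omega

theorem productProg_ends (hD : D.Holds σ) (hw : ∀ r < D.n, σ.nat (32, [r]) = w r)
    {s i d : ℕ} {p : F[X]} (hs : σ.nat (20, []) = s) (hi : σ.nat (21, []) = i)
    (hd : σ.nat (24, []) = d) (hp : ∀ v < D.U, σ.fld (3, [v]) = p.coeff v)
    (hU : 1 ≤ D.U) (hnU : D.n ≤ D.U) (hdU : d ≤ D.U) :
    Ends productProg σ (49 * D.U ^ 3) fun τ =>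
      ∀ v < D.U, τ.fld (3, [v]) = (p + C (D.top s i) * D.productVal w s i d).coeff v := by
  have hU1 : 1 ≤ D.U ^ 3 := Nat.one_le_pow 3 _ hU
  have hU2 : D.U ≤ D.U ^ 3 := Nat.le_self_pow (by norm_num) _
  refine Ends.imp (T := 1 + ((1 + 7) * D.U ^ (0 + 1) + (1 + (1 + ((22 + 7) * D.U ^ (2 + 1) +
    (2 + 7) * D.U ^ (0 + 1)))))) (Ends.run_seq (.natConst _ _ _) (Ends.seq (Ends.forLoop_pow
    (n := D.U) (fun v' τ => ∀ v < v', τ.fld (4, [0, v]) = 0) (by rfl) ?_ hU le_rfl ?_ ?_ ?_)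
    fun σ₁ hF₁ h₁ => Ends.run_seq (.natConst _ _ _) (Ends.run_seq (.fldOne _ _) (Ends.seq
    (Ends.forLoop_pow (n := d) (fun j τ => ∀ v < D.U,
      τ.fld (4, [j, v]) = (D.productVal w s i j).coeff v) (by rfl) ?_ hU hdU ?_ ?_ ?_)
    fun σ₂ hF₂ h₂ => Ends.forLoop_pow (n := D.U) (fun v' τ => ∀ v < D.U, τ.fld (3, [v]) =
      if v < v' then (p + C (D.top s i) * D.productVal w s i d).coeff v else p.coeff v)
      (by rfl) ?_ hU le_rfl ?_ ?_ ?_))))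
    ?_ fun τ _ h v hv => by rw [h v hv, if_pos hv]
  · simpa [Memory.setNat_nat] using hD.U
  · intro j τ τ' _ hf h
    simpa [hf] using h
  · intro v hv
    omega
  · intro v hv τ hF h42 h
    have h22 : τ.nat (22, []) = 0 := (hF.nat 22 [] rfl).trans (by simp [Memory.setNat_nat])
    rw [pow_zero, mul_one]
    refine Ends.of_run (.fldZero _ _) fun v' hv' => ?_
    rcases Nat.lt_succ_iff_lt_or_eq.1 hv' with hlt | rfl
    · simpa [Memory.setFld_fld, h22, h42, hlt.ne] using h v' hlt
    · simp [Memory.setFld_fld, h22, h42]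
  · simp only [Memory.setNat_nat, Memory.setFld_nat, Prod.mk.injEq, Nat.reduceEqDiff, false_and,
      if_false]
    rw [hF₁.nat 24 _ rfl]
    simpa [Memory.setNat_nat] using hd
  · intro j τ τ' _ hf h
    simpa [hf] using h
  · intro v hv
    have h22 : σ₁.nat (22, []) = 0 := (hF₁.nat 22 [] rfl).trans (by simp [Memory.setNat_nat])
    simp [Memory.setNat_nat, Memory.setFld_fld, Memory.setNat_fld, h22, Params.productVal,
      coeff_one, h₁ v hv]
  · intro j hj τ hF h22 h
    have hD' : D.Holds τ := ((((hD.setNat (by decide)).frame hF₁ (by rfl)).setNat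
      (by decide)).setFld (by decide)).frame hF (by rfl)
    refine (factorProg_ends (w := w) hD' (fun r hr => ?_) (s := s) (i := i) ?_ ?_ h22 h hU
      hnU).imp le_rfl fun ρ _ h v hv => ?_
    · rw [hF.nat 32 _ rfl]
      simp only [Memory.setNat_nat, Memory.setFld_nat, Prod.mk.injEq, Nat.reduceEqDiff, false_and,
        if_false]
      rw [hF₁.nat 32 _ rfl]
      simpa [Memory.setNat_nat] using hw r hr
    · rw [hF.nat 20 _ rfl]
      simp only [Memory.setNat_nat, Memory.setFld_nat, Prod.mk.injEq, Nat.reduceEqDiff, false_and,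
        if_false]
      rw [hF₁.nat 20 _ rfl]
      simpa [Memory.setNat_nat] using hs
    · rw [hF.nat 21 _ rfl]
      simp only [Memory.setNat_nat, Memory.setFld_nat, Prod.mk.injEq, Nat.reduceEqDiff, false_and,
        if_false]
      rw [hF₁.nat 21 _ rfl]
      simpa [Memory.setNat_nat] using hi
    · rw [h v hv, Params.productVal, Params.productVal, Finset.prod_range_succ]
  · have hD' : D.Holds σ₂ := ((((hD.setNat (by decide)).frame hF₁ (by rfl)).setNat
      (by decide)).setFld (by decide)).frame hF₂ (by rfl)
    exact hD'.U
  · intro j τ τ' _ hf h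
    simpa [hf] using h
  · intro v hv
    rw [if_neg (by omega), hF₂.fld 3 _ rfl]
    simp only [Memory.setFld_fld, Memory.setNat_fld, Prod.mk.injEq, Nat.reduceEqDiff, false_and,
        if_false]
    rw [hF₁.fld 3 _ rfl]
    exact hp v hv
  · intro v hv τ hF h42 h
    have hD' : D.Holds τ := (((((hD.setNat (by decide)).frame hF₁ (by rfl)).setNat
      (by decide)).setFld (by decide)).frame hF₂ (by rfl)).frame hF (by rfl)
    have h24 : τ.nat (24, []) = d := by
      rw [hF.nat 24 _ rfl, hF₂.nat 24 _ rfl]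
      simp only [Memory.setNat_nat, Memory.setFld_nat, Prod.mk.injEq, Nat.reduceEqDiff, false_and,
        if_false]
      rw [hF₁.nat 24 _ rfl]
      simpa [Memory.setNat_nat] using hd
    have h20 : τ.nat (20, []) = s := by
      rw [hF.nat 20 _ rfl, hF₂.nat 20 _ rfl]
      simp only [Memory.setNat_nat, Memory.setFld_nat, Prod.mk.injEq, Nat.reduceEqDiff, false_and,
        if_false]
      rw [hF₁.nat 20 _ rfl]
      simpa [Memory.setNat_nat] using hs
    have h21 : τ.nat (21, []) = i := by
      rw [hF.nat 21 _ rfl, hF₂.nat 21 _ rfl]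
      simp only [Memory.setNat_nat, Memory.setFld_nat, Prod.mk.injEq, Nat.reduceEqDiff, false_and,
        if_false]
      rw [hF₁.nat 21 _ rfl]
      simpa [Memory.setNat_nat] using hi
    have h4 : τ.fld (4, [d, v]) = (D.productVal w s i d).coeff v :=
      (hF.fld 4 _ rfl).trans (h₂ v hv)
    rw [pow_zero, mul_one]
    refine Ends.run_seq (.fldMul _ _ _ _) (Ends.of_run (.fldAdd _ _ _ _) fun v' hv' => ?_)
    rcases eq_or_ne v' v with rfl | hne
    · simp [Memory.setFld_fld, Memory.getFld_mk, Memory.setFld_nat, h42, h20, h21, h24, h4,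
        hD'.top, h v' hv']
    · simp only [Memory.setFld_fld, Memory.getFld_mk, Memory.setFld_nat, h42, List.map_cons,
        List.map_nil, Prod.mk.injEq, List.cons.injEq, hne, Nat.reduceEqDiff, false_and, and_false,
        if_false, h v' hv']
      exact if_congr (by omega) rfl rfl
  · norm_num
    omega

theorem evalProg_ends (hD : D.Holds σ) (hw : ∀ r < D.n, σ.nat (32, [r]) = w r)
    (hU : 1 ≤ D.U) (hnU : D.n ≤ D.U) (hcU : D.c ≤ D.U) (hkU : D.k ≤ D.U)
    (hdU : ∀ s < D.c, D.d s ≤ D.U) :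
    Ends evalProg σ (73 * D.U ^ 5) fun τ =>
      ∀ v < D.U, τ.fld (3, [v]) = (D.circuitsVal w D.c).coeff v := by
  have hU1 : 1 ≤ D.U ^ 4 := Nat.one_le_pow 4 _ hU
  have hU2 : D.U ≤ D.U ^ 5 := Nat.le_self_pow (by norm_num) _
  refine Ends.imp (T := (1 + 7) * D.U ^ (0 + 1) + (58 + 7) * D.U ^ (4 + 1)) (Ends.seq
    (Ends.forLoop_pow (n := D.U) (fun v' τ => ∀ v < v', τ.fld (3, [v]) = 0) (by rfl) hD.U hU le_rfl
      ?_ ?_ ?_)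
    fun σ₁ hF₁ h₁ => Ends.forLoop_pow (n := D.c) (fun s τ => ∀ v < D.U,
      τ.fld (3, [v]) = (D.circuitsVal w s).coeff v) (by rfl)
      ((hD.frame hF₁ (by rfl)).c) hU hcU ?_ ?_ ?_)
    ?_ fun τ _ h => h
  · intro j τ τ' _ hf h
    simpa [hf] using h
  · intro v hv
    omega
  · intro v hv τ hF h42 h
    rw [pow_zero, mul_one]
    refine Ends.of_run (.fldZero _ _) fun v' hv' => ?_
    rcases Nat.lt_succ_iff_lt_or_eq.1 hv' with hlt | rfl
    · simpa [Memory.setFld_fld, h42, hlt.ne] using h v' hlt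
    · simp [Memory.setFld_fld, h42]
  · intro j τ τ' _ hf h
    simpa [hf] using h
  · intro v hv
    simp [h₁ v hv, Params.circuitsVal]
  · intro s hs τ hF h20 h
    have hD' : D.Holds τ := (hD.frame hF₁ (by rfl)).frame hF (by rfl)
    refine Ends.imp (T := 1 + (1 + (49 + 7) * D.U ^ (3 + 1))) (Ends.run_seq (.natConst _ _ _)
      (Ends.run_seq (.natAdd _ _ _ _) (Ends.forLoop_pow (n := D.k) (fun i τ => ∀ v < D.U,
        τ.fld (3, [v]) = (D.circuitsVal w s + D.gatesVal w s i).coeff v) (by rfl) ?_ hU hkU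
        ?_ ?_ ?_))) (by norm_num; omega) fun ρ _ h v hv => ?_
    · simpa [Memory.setNat_nat] using hD'.k
    · intro j τ τ' _ hf h
      simpa [hf] using h
    · intro v hv
      simp [Memory.setNat_fld, h v hv, Params.gatesVal]
    · intro i hi ρ hG h21 hρ
      have hD₂ : D.Holds ρ := ((hD'.setNat (by decide)).setNat (by decide)).frame hG (by rfl)
      refine (productProg_ends (w := w) hD₂ (fun r hr => ?_) (s := s) (d := D.d s) ?_ h21 ?_ hρ hU
        hnU (hdU s hs)).imp le_rfl fun π _ h v hv => ?_
      · rw [hG.nat 32 _ rfl]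
        simp only [Memory.setNat_nat, Prod.mk.injEq, Nat.reduceEqDiff, false_and, if_false]
        rw [hF.nat 32 _ rfl, hF₁.nat 32 _ rfl, hw r hr]
      · rw [hG.nat 20 _ rfl]
        simpa [Memory.setNat_nat] using h20
      · rw [hG.nat 24 _ rfl]
        simp [Memory.setNat_nat, Memory.getNat_mk, h20, hD'.d]
      · rw [h v hv, Params.gatesVal, Params.gatesVal, Finset.sum_range_succ, add_assoc]
    · rw [h v hv, Params.circuitsVal, Params.circuitsVal, Finset.sum_range_succ]
  · norm_num
    omega

theorem checkProg_ends (hD : D.Holds σ) {p : F[X]} (hp : ∀ v < D.U, σ.fld (3, [v]) = p.coeff v)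
    (hU : 1 ≤ D.U) :
    Ends checkProg σ (9 * D.U ^ 1) fun τ => ((∃ v < D.U, p.coeff v ≠ 0) → τ.nat (0, []) = 1) ∧
      ((∀ v < D.U, p.coeff v = 0) → τ.nat (0, []) = σ.nat (0, [])) ∧
      (τ.nat (0, []) = 1 ∨ τ.nat (0, []) = σ.nat (0, [])) := by
  refine Ends.imp (Ends.forLoop_pow (n := D.U) (a := 2) (e := 0) (fun v' τ =>
    ((∃ v < v', p.coeff v ≠ 0) → τ.nat (0, []) = 1) ∧
      ((∀ v < D.U, p.coeff v = 0) → τ.nat (0, []) = σ.nat (0, [])) ∧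
      (τ.nat (0, []) = 1 ∨ τ.nat (0, []) = σ.nat (0, []))) (by rfl) hD.U hU
    le_rfl ?_ ?_ ?_) le_rfl fun τ _ h => h
  · intro j τ τ' hn _ h
    simpa [hn] using h
  · simp
  · rintro v hv τ hF h42 ⟨h1, h2, h3⟩
    have h4 : τ.fld (3, [v]) = p.coeff v := (hF.fld 3 _ rfl).trans (hp v hv)
    rw [pow_zero, mul_one]
    refine Ends.ifFldZero (fun h0 => Ends.of_run (.skip _) ⟨?_, h2, h3⟩)
      fun h0 => Ends.of_run (.natConst _ _ _) ⟨?_, ?_, ?_⟩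
    · simp only [Memory.getFld_mk, List.map_cons, List.map_nil, h42, h4] at h0
      rintro ⟨v', hv', hne⟩
      rcases Nat.lt_succ_iff_lt_or_eq.1 hv' with hlt | rfl
      · exact h1 ⟨v', hlt, hne⟩
      · exact absurd h0 hne
    · simp [Memory.setNat_nat]
    · simp only [Memory.getFld_mk, List.map_cons, List.map_nil, h42, h4] at h0
      exact fun h => absurd (h v hv) h0
    · simp [Memory.setNat_nat]

/-- The output cell is only ever set to 1, so a success for one code survives the later rounds. The
evaluation of one code costs `O(U ^ 5)` and dominates its decoding. -/
theorem searchProg_ends (hD : D.Holds σ) (hout : σ.nat (0, []) = 0) (hX1 : 1 ≤ D.X)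
    (hU : 1 ≤ D.U) (hXU : D.X ≤ D.U) (hnU : D.n ≤ D.U) (hcU : D.c ≤ D.U) (hkU : D.k ≤ D.U)
    (hqU : D.q ≤ D.U) (hlU : D.l ≤ D.U) (hmU : D.m ≤ D.U) (hdU : ∀ s < D.c, D.d s ≤ D.U) :
    Ends searchProg σ (238 * D.U ^ 6) fun τ => (τ.nat (0, []) = 1 ∨ τ.nat (0, []) = 0) ∧
      (τ.nat (0, []) = 1 ↔ ∃ a < D.U, ∃ v < D.U, (D.circuitsVal
        (fun r => codeWeight D.n D.q D.l D.X D.col a r D.m) D.c).coeff v ≠ 0) := by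
  have hU2 : D.U ^ 4 ≤ D.U ^ 5 := Nat.pow_le_pow_right hU (by norm_num)
  have hU3 : D.U ^ 1 ≤ D.U ^ 5 := Nat.pow_le_pow_right hU (by norm_num)
  refine Ends.imp (Ends.forLoop_pow (n := D.U) (a := 231) (e := 5) (fun a' τ =>
    (τ.nat (0, []) = 1 ∨ τ.nat (0, []) = 0) ∧
      (τ.nat (0, []) = 1 ↔ ∃ a < a', ∃ v < D.U, (D.circuitsVal
        (fun r => codeWeight D.n D.q D.l D.X D.col a r D.m) D.c).coeff v ≠ 0)) (by rfl) hD.U hU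
    le_rfl ?_ ?_ ?_) le_rfl fun τ _ h => h
  · intro j τ τ' hn _ h
    simpa [hn] using h
  · simp [hout]
  · rintro a ha τ hF h30 ⟨h1, h2⟩
    have hD' : D.Holds τ := hD.frame hF (by rfl)
    refine Ends.imp (Ends.seq (decodeProg_ends hD' h30 hX1 ha.le hU hXU hnU hqU hlU hmU)
      fun τ₁ hF₁ h₁ => Ends.seq (evalProg_ends (hD'.frame hF₁ (by rfl)) h₁ hU hnU hcU hkU hdU)
      fun τ₂ hF₂ h₂ => (checkProg_ends ((hD'.frame hF₁ (by rfl)).frame hF₂ (by rfl)) h₂ hU).imp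
      (R' := fun ρ => (ρ.nat (0, []) = 1 ∨ ρ.nat (0, []) = 0) ∧
      (ρ.nat (0, []) = 1 ↔ ∃ a' < a + 1, ∃ v < D.U, (D.circuitsVal
        (fun r => codeWeight D.n D.q D.l D.X D.col a' r D.m) D.c).coeff v ≠ 0)) le_rfl ?_)
      (by omega) fun _ _ h => h
    intro ρ _ ⟨g1, g2, g3⟩
    have h0 : τ₂.nat (0, []) = τ.nat (0, []) := (hF₂.nat 0 _ rfl).trans (hF₁.nat 0 _ rfl)
    rw [h0] at g2 g3
    refine ⟨?_, fun h => ?_, ?_⟩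
    · rcases g3 with g | g
      · exact Or.inl g
      · rw [g]
        exact h1
    · by_contra hno
      push Not at hno
      have h4 := g2 fun v hv => hno a (by omega) v hv
      rw [h4, h2] at h
      obtain ⟨a', ha', v, hv, hne⟩ := h
      exact hne (hno a' (by omega) v hv)
    · rintro ⟨a', ha', v, hv, hne⟩
      rcases Nat.lt_succ_iff_lt_or_eq.1 ha' with hlt | rfl
      · rcases g3 with g | g
        · exact g
        · rw [g, h2]
          exact ⟨a', hlt, v, hv, hne⟩
      · exact g1 ⟨v, hv, hne⟩

end Evaluation

/-! ### The whole program -/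

/-- Computes the parameters other than the number of codes. -/
def parameterProg : Prog := rootProg ⨾ baseCountProg ⨾ levelCountProg ⨾ digitBaseProg

/-- Computes the number of codes and the colors of the variables. -/
def setupProg : Prog := codeCountProg ⨾ colorProg

/-- Decides whether a sum of set-multilinear circuits is zero. -/
def zeroTestProg : Prog := parameterProg ⨾ setupProg ⨾ searchProg

open Polynomial

section Correctness

variable {F : Type*} [Field F] {n c k : ℕ}

/-- The data of the main loop on the input `C`. -/
def inputParams (C : Fin c → Depth3Circuit F n k) (q m l X U : ℕ) (col : ℕ → ℕ → ℕ) :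
    Params F where
  n := n
  c := c
  k := k
  q := q
  m := m
  l := l
  X := X
  U := U
  d := fun s => (inputMemory C).nat (4, [s])
  col := col
  top := fun s i => (inputMemory C).fld (0, [s, i])
  const := fun s i j => (inputMemory C).fld (1, [s, i, j])
  coeff := fun s i j r => (inputMemory C).fld (2, [s, i, j, r])

theorem circuitsVal_inputParams (C : Fin c → Depth3Circuit F n k) (q m l X U : ℕ)
    (col : ℕ → ℕ → ℕ) (w : ℕ → ℕ) :
    (inputParams C q m l X U col).circuitsVal w c =
      evalSum C Polynomial.C fun r => Polynomial.X ^ w r := by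
  rw [Params.circuitsVal, evalSum, Finset.sum_range]
  refine Finset.sum_congr rfl fun s _ => ?_
  rw [Params.gatesVal, Finset.sum_range]
  refine Finset.sum_congr rfl fun (i : Fin k) _ => ?_
  have hd : (inputParams C q m l X U col).d s = (C s).d := by simp [inputParams, inputMemory]
  rw [Params.productVal, hd, Finset.prod_range]
  congr 1
  · simp [inputParams, inputMemory, s.2, i.2]
  · refine Finset.prod_congr rfl fun j _ => ?_
    rw [Params.factorVal, Finset.sum_range]
    congr 1
    · simp [inputParams, inputMemory]
    · refine Finset.sum_congr rfl fun (r : Fin n) _ => ?_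
      simp [inputParams, inputMemory]

/-- The required bound is `512 * n ^ 3 * c ^ 4 * k ^ 4 + 2 * n`; a fourth power is convenient
because the program reaches it by squaring twice. -/
theorem weightBase_lt (hn : 1 ≤ n) (hc : 1 ≤ c) (hk : 1 ≤ k) :
    weightBase n c k < (8 * (n * c * k)) ^ 4 := by
  have h : n ≤ n ^ 4 * (c ^ 4 * k ^ 4) :=
    (Nat.le_self_pow (by norm_num) n).trans (Nat.le_mul_of_pos_right _ (by positivity))
  have h' : n ^ 3 * (c ^ 4 * k ^ 4) ≤ n ^ 4 * (c ^ 4 * k ^ 4) := by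
    gcongr
    norm_num
  have e1 : weightBase n c k = 512 * (n ^ 3 * (c ^ 4 * k ^ 4)) + 2 * n := by
    rw [weightBase]
    ring
  have e2 : (8 * (n * c * k)) ^ 4 = 4096 * (n ^ 4 * (c ^ 4 * k ^ 4)) := by ring
  rw [e1, e2]
  omega

/-- Nonempty colors number at most `n`, so colors are below `n` and cannot be confused with the
codes `n + i` of transversals. -/
theorem exists_color (C : Fin c → Depth3Circuit F n k) (hC : ∀ s, (C s).IsSetMultilinear) :
    ∃ κ : ℕ → ℕ → ℕ, (∀ s < c, ∀ r < n, κ s r < n) ∧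
      ∀ (s : Fin c) i j (r : Fin n), (C s).coeff i j r ≠ 0 → κ s r = j := by
  choose color hsurj hcolor using hC
  refine ⟨fun s r => if h : s < c ∧ r < n then color ⟨s, h.1⟩ ⟨r, h.2⟩ else 0,
    fun s hs r hr => ?_, fun s i j r h => ?_⟩
  · have hle := Fintype.card_le_of_surjective _ (hsurj ⟨s, hs⟩)
    simp only [Fintype.card_fin] at hle
    simp only [hs, hr, and_self, dite_true]
    exact (color ⟨s, hs⟩ ⟨r, hr⟩).2.trans_le hle
  · simp [hcolor s i j r h]

theorem parameterProg_ends (C : Fin c → Depth3Circuit F n k) (hn : 2 ≤ n) {X : ℕ}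
    (hX : X = (8 * (n * c * k)) ^ 4) (hX1 : 1 ≤ X) (hnX : n ≤ X) (hcX : c ≤ X) (hkX : k ≤ X)
    (hYX : 8 * (n * c * k) ≤ X) :
    ∃ (t : ℕ) (τ : Memory F) (m b e : ℕ), Run parameterProg (inputMemory C) t τ ∧
      τ.nat (6, []) = c - 1 ∧ τ.nat (7, []) = m ∧ τ.nat (8, []) = 2 * e ∧ τ.nat (9, []) = X ∧
      1 ≤ m ∧ m ≤ n ∧ 1 ≤ b ∧ b ^ 2 ^ (c - 1) ≤ n ∧ n < (b + 1) ^ 2 ^ (c - 1) ∧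
      (m = n ∨ 2 ^ (c - 1) * n ≤ b * m) ∧ (m - 1) * b < 2 ^ (c - 1) * n ∧
      1 ≤ e ∧ n ≤ 2 ^ e ∧ 2 ^ (e - 1) < n ∧ t ≤ 112 * X ^ 2 := by
  obtain ⟨t₁, τ₁, run₁, ht₁, h6, h13, hb, hbn, hnb⟩ := rootProg_ends (σ := inputMemory C) (n := n)
    (U := X) rfl (by omega) hX1 hnX hcX
  have hF₁ := run₁.frame
  change τ₁.nat (6, []) = c - 1 at h6
  change τ₁.nat (13, []) = 2 ^ (c - 1) * n at h13
  change τ₁.nat (12, []) ^ 2 ^ (c - 1) ≤ n at hbn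
  change n < (τ₁.nat (12, []) + 1) ^ 2 ^ (c - 1) at hnb
  obtain ⟨t₂, τ₂, run₂, ht₂, hm1, hmn, hm, hmb⟩ := baseCountProg_ends (σ := τ₁) (n := n) (U := X)
    (hF₁.nat 1 [] rfl) (by omega) hX1 hnX (by
      rw [h13]
      exact Nat.mul_pos (by positivity) (by omega))
  have hF₂ := run₂.frame
  rw [h13] at hm hmb
  obtain ⟨t₃, τ₃, run₃, ht₃, e, he1, h8, hne, hen⟩ := levelCountProg_ends (σ := τ₂) (n := n) (U := X)
    ((hF₂.nat 1 [] rfl).trans (hF₁.nat 1 [] rfl)) hn hnX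
  have hF₃ := run₃.frame
  obtain ⟨t₄, τ₄, run₄, ht₄, h9⟩ := digitBaseProg_ends (σ := τ₃) (n := n) (c := c) (k := k) (U := X)
    (by rw [hF₃.nat 1 [] rfl, hF₂.nat 1 [] rfl, hF₁.nat 1 [] rfl]; rfl)
    (by rw [hF₃.nat 2 [] rfl, hF₂.nat 2 [] rfl, hF₁.nat 2 [] rfl]; rfl)
    (by rw [hF₃.nat 3 [] rfl, hF₂.nat 3 [] rfl, hF₁.nat 3 [] rfl]; rfl) hX1 hcX hkX hYX
    (by
      rw [hX]
      rcases Nat.eq_zero_or_pos (8 * (n * c * k)) with h | h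
      · simp [h]
      · exact Nat.pow_le_pow_right h (by norm_num))
  have hF₄ := run₄.frame
  refine ⟨_, τ₄, τ₂.nat (7, []), τ₁.nat (12, []), e, .seq run₁ (.seq run₂ (.seq run₃ run₄)), ?_,
    ?_, ?_, h9.trans hX.symm, hm1, hmn, hb, hbn, hnb, hm, hmb, he1, hne, hen, ?_⟩
  · rw [hF₄.nat 6 [] rfl, hF₃.nat 6 [] rfl, hF₂.nat 6 [] rfl, h6]
  · rw [hF₄.nat 7 [] rfl, hF₃.nat 7 [] rfl]
  · rw [hF₄.nat 8 [] rfl, h8]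
  · have := Nat.le_self_pow (n := 2) (by norm_num) X
    omega

theorem setupProg_ends (C : Fin c → Depth3Circuit F n k) {σ : Memory F} {m e X U : ℕ}
    (h6 : σ.nat (6, []) = c - 1) (h7 : σ.nat (7, []) = m) (h8 : σ.nat (8, []) = 2 * e)
    (h9 : σ.nat (9, []) = X)
    (hnat : ∀ x l, x ≤ 5 → σ.nat (x, l) = (inputMemory C).nat (x, l))
    (hfld : ∀ x l, x ≤ 2 → σ.fld (x, l) = (inputMemory C).fld (x, l))
    (hU : U = X ^ (m * (c - 1 + 2 * e))) (hU1 : 1 ≤ U) (hqU : c - 1 + 2 * e ≤ U) (hmU : m ≤ U)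
    (hXU : X ≤ U) (hnU : n ≤ U) (hcU : c ≤ U) (hkU : k ≤ U) (hdn : ∀ s, (C s).d ≤ n)
    {κ : ℕ → ℕ → ℕ} (hκ : ∀ (s : Fin c) i j (r : Fin n), (C s).coeff i j r ≠ 0 → κ s r = j) :
    ∃ (t : ℕ) (τ : Memory F) (col : ℕ → ℕ → ℕ), Run setupProg σ t τ ∧
      (inputParams C (c - 1) m (2 * e) X U col).Holds τ ∧ τ.nat (0, []) = 0 ∧
      (∀ s r, col s r = 0 ∨ col s r = κ s r) ∧
      (∀ (s : Fin c) i j (r : Fin n), (C s).coeff i j r ≠ 0 → col s r = j) ∧ t ≤ 60 * U ^ 4 := by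
  obtain ⟨t₁, τ₁, run₁, ht₁, h10⟩ := codeCountProg_ends h6 h8 h7 h9 hU1 hqU hmU hXU
  have hF₁ := run₁.frame
  have hdn' : ∀ s < c, (inputMemory C).nat (4, [s]) ≤ n := fun s hs => by
    simpa [inputMemory, hs] using hdn ⟨s, hs⟩
  have hfld₁ : ∀ l, τ₁.fld (2, l) = (inputMemory C).fld (2, l) := fun l =>
    (hF₁.fld 2 l rfl).trans (hfld 2 l (by norm_num))
  obtain ⟨t₂, τ₂, run₂, ht₂, hcol, hcol'⟩ := colorProg_ends (σ := τ₁) (κ := κ) (n := n) (c := c)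
    (k := k) (U := U) (d := fun s => (inputMemory C).nat (4, [s]))
    ((hF₁.nat 1 [] rfl).trans (hnat 1 [] (by norm_num)))
    ((hF₁.nat 2 [] rfl).trans (hnat 2 [] (by norm_num)))
    ((hF₁.nat 3 [] rfl).trans (hnat 3 [] (by norm_num)))
    (fun s => (hF₁.nat 4 [s] rfl).trans (hnat 4 [s] (by norm_num)))
    hU1 hnU hcU hkU (fun s hs => (hdn' s hs).trans hnU)
    (fun s r => (hF₁.nat 5 _ rfl).trans (hnat 5 _ (by norm_num)))
    (fun s hs i hi j hj r hr hne => by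
      have hj' : j < (C ⟨s, hs⟩).d := by simpa [inputMemory, hs] using hj
      refine hκ ⟨s, hs⟩ ⟨i, hi⟩ ⟨j, hj'⟩ ⟨r, hr⟩ ?_
      rw [hfld₁] at hne
      simpa [inputMemory, hs, hi, hj', hr] using hne)
  have hF₂ := run₂.frame
  refine ⟨_, τ₂, fun s r => τ₂.nat (5, [s, r]), .seq run₁ run₂, ?_, ?_, hcol,
    fun s i j r h => ?_, ?_⟩
  · constructor
    · exact (hF₂.nat 1 [] rfl).trans ((hF₁.nat 1 [] rfl).trans (hnat 1 [] (by norm_num)))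
    · exact (hF₂.nat 2 [] rfl).trans ((hF₁.nat 2 [] rfl).trans (hnat 2 [] (by norm_num)))
    · exact (hF₂.nat 3 [] rfl).trans ((hF₁.nat 3 [] rfl).trans (hnat 3 [] (by norm_num)))
    · exact fun s => (hF₂.nat 4 _ rfl).trans ((hF₁.nat 4 _ rfl).trans (hnat 4 _ (by norm_num)))
    · exact fun _ _ => rfl
    · exact (hF₂.nat 6 [] rfl).trans ((hF₁.nat 6 [] rfl).trans h6)
    · exact (hF₂.nat 7 [] rfl).trans ((hF₁.nat 7 [] rfl).trans h7)
    · exact (hF₂.nat 8 [] rfl).trans ((hF₁.nat 8 [] rfl).trans h8)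
    · exact (hF₂.nat 9 [] rfl).trans ((hF₁.nat 9 [] rfl).trans h9)
    · exact (hF₂.nat 10 [] rfl).trans (h10.trans hU.symm)
    · exact fun _ _ => (hF₂.fld 0 _ rfl).trans ((hF₁.fld 0 _ rfl).trans (hfld 0 _ (by norm_num)))
    · exact fun _ _ _ => (hF₂.fld 1 _ rfl).trans ((hF₁.fld 1 _ rfl).trans (hfld 1 _ (by norm_num)))
    · exact fun _ _ _ _ => (hF₂.fld 2 _ rfl).trans (hfld₁ _)
  · exact (hF₂.nat 0 [] rfl).trans ((hF₁.nat 0 [] rfl).trans (hnat 0 [] (by norm_num)))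
  · refine (hcol' s s.2 i i.2 j ?_ r r.2 ?_).trans (hκ s i j r h)
    · simp [inputMemory]
    · rw [hfld₁]
      simpa [inputMemory] using h
  · have h34 : U ^ 3 ≤ U ^ 4 := Nat.pow_le_pow_right hU1 (by norm_num)
    omega

theorem zeroTestProg_ends (C : Fin c → Depth3Circuit F n k) (hn : 2 ≤ n) (hc : 1 ≤ c) (hk : 1 ≤ k)
    (hC : ∀ s, (C s).IsSetMultilinear) :
    ∃ (t : ℕ) (τ : Memory F) (m b e : ℕ), Run zeroTestProg (inputMemory C) t τ ∧
      1 ≤ m ∧ m ≤ n ∧ 1 ≤ b ∧ n < (b + 1) ^ 2 ^ (c - 1) ∧ (m - 1) * b < 2 ^ (c - 1) * n ∧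
      1 ≤ e ∧ 2 ^ (e - 1) < n ∧
      t ≤ (((8 * (n * c * k)) ^ 4) ^ (m * (c - 1 + 2 * e))) ^ 7 ∧
      (τ.output = 1 ∨ τ.output = 0) ∧ (τ.output = 1 ↔ ∑ s, (C s).poly ≠ 0) := by
  obtain ⟨κ, hκn, hκ⟩ := exists_color C hC
  have hdn : ∀ s, (C s).d ≤ n := fun s => by
    obtain ⟨color, hsurj, -⟩ := hC s
    simpa using Fintype.card_le_of_surjective _ hsurj
  obtain ⟨X, hX⟩ : ∃ X, X = (8 * (n * c * k)) ^ 4 := ⟨_, rfl⟩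
  have hck : 1 ≤ c * k := Nat.mul_pos hc hk
  have hnY : 8 * n ≤ 8 * (n * c * k) := by
    rw [mul_assoc n]
    exact Nat.mul_le_mul_left 8 (Nat.le_mul_of_pos_right n hck)
  have hcY : 8 * c ≤ 8 * (n * c * k) := by
    rw [show n * c * k = c * (n * k) by ring]
    exact Nat.mul_le_mul_left 8 (Nat.le_mul_of_pos_right c (Nat.mul_pos (by omega) hk))
  have hkY : 8 * k ≤ 8 * (n * c * k) := by
    rw [show n * c * k = k * (n * c) by ring]
    exact Nat.mul_le_mul_left 8 (Nat.le_mul_of_pos_right k (Nat.mul_pos (by omega) hc))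
  have hYX : 8 * (n * c * k) ≤ X := hX ▸ Nat.le_self_pow (by norm_num) _
  have hXbig : 65536 ≤ X :=
    hX ▸ (Nat.pow_le_pow_left (by omega : 16 ≤ 8 * (n * c * k)) 4).trans' (by norm_num)
  obtain ⟨t₁, τ₁, m, b, e, run₁, h6, h7, h8, h9, hm1, hmn, hb, hbn, hnb, hm, hmb, he1, hne, hen,
    ht₁⟩ := parameterProg_ends C hn hX (by omega) (by omega) (by omega) (by omega) hYX
  have he : e < n := by
    have := Nat.lt_two_pow_self (n := e - 1)
    omega
  obtain ⟨N, hN⟩ : ∃ N, N = m * (c - 1 + 2 * e) := ⟨_, rfl⟩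
  obtain ⟨U, hU⟩ : ∃ U, U = X ^ N := ⟨_, rfl⟩
  have hN2 : 2 ≤ N := hN ▸ (Nat.le_mul_of_pos_left _ hm1).trans' (by omega)
  have hX2U : X ^ 2 ≤ U := hU ▸ Nat.pow_le_pow_right (by omega) hN2
  have hXU : X ≤ U := (Nat.le_self_pow (by norm_num) X).trans hX2U
  have hF₁ := run₁.frame
  obtain ⟨t₂, τ₂, col, run₂, hholds, h0, hcol, hcol', ht₂⟩ := setupProg_ends C (U := U) h6 h7 h8 h9
    (fun x l hx => by
      have : x = 0 ∨ x = 1 ∨ x = 2 ∨ x = 3 ∨ x = 4 ∨ x = 5 := by omega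
      rcases this with rfl | rfl | rfl | rfl | rfl | rfl
      all_goals exact hF₁.nat _ l rfl)
    (fun x l hx => by
      have : x = 0 ∨ x = 1 ∨ x = 2 := by omega
      rcases this with rfl | rfl | rfl
      all_goals exact hF₁.fld _ l rfl)
    (hN ▸ hU) (by omega) (by omega) (by omega) hXU (by omega) (by omega) (by omega) hdn hκ
  obtain ⟨t₃, τ₃, run₃, ht₃, hout, hiff⟩ := searchProg_ends hholds h0 (show 1 ≤ X by omega)
    (show 1 ≤ U by omega) hXU (show n ≤ U by omega) (show c ≤ U by omega) (show k ≤ U by omega)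
    (show c - 1 ≤ U by omega) (show 2 * e ≤ U by omega) (show m ≤ U by omega)
    (fun s (hs : s < c) => by
      have h1 : (inputMemory C).nat (4, [s]) = (C ⟨s, hs⟩).d := by simp [inputMemory, hs]
      exact (h1.trans_le (hdn _)).trans (show n ≤ U by omega))
  change t₃ ≤ 238 * U ^ 6 at ht₃
  refine ⟨_, τ₃, m, b, e, .seq run₁ (.seq run₂ run₃), hm1, hmn, hb, hnb, hmb, he1, hen, ?_, hout,
    ?_⟩
  · rw [← hX, ← hN, ← hU]
    have h16 : U ≤ U ^ 6 := Nat.le_self_pow (by norm_num) U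
    have h46 : U ^ 4 ≤ U ^ 6 := Nat.pow_le_pow_right (by omega) (by norm_num)
    -- All numerical constants of the phases are absorbed by one further factor `U`, which is at
    -- least `16 ^ 4`.
    have h7 : U ^ 6 * 65536 ≤ U ^ 7 := by
      rw [pow_succ U 6]
      exact Nat.mul_le_mul_left _ (by omega)
    omega
  · rw [Memory.output, hiff]
    change (∃ a < U, ∃ v < U, ((inputParams C (c - 1) m (2 * e) X U col).circuitsVal
      (fun r => codeWeight n (c - 1) (2 * e) X col a r m) c).coeff v ≠ 0) ↔ _
    simp only [circuitsVal_inputParams]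
    constructor
    -- Soundness needs no property of the code: any substitution into the zero polynomial gives
    -- zero.
    · rintro ⟨a, -, v, -, hne⟩ hzero
      rw [evalSum_eq_eval₂Hom, hzero, map_zero, coeff_zero] at hne
      exact hne rfl
    · intro hpoly
      rw [hU, hN]
      refine exists_code C hpoly (by omega) hc hk col (fun s hs r hr => ?_) hcol' hb hbn hm
        (by omega) ?_ (hX ▸ weightBase_lt (by omega) hc hk) (by omega)
      · rcases hcol s r with h | h
        · exact h.trans_lt (by omega)
        · exact h.trans_lt (hκn s hs r hr)
      · rw [two_mul, pow_add]
        exact Nat.mul_le_mul hne hne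

end Correctness

/-! ### The running time -/

section RunningTime

theorem root_lt_of_lt_pow {n b q : ℕ} (h : n < (b + 1) ^ 2 ^ q) :
    (n : ℝ) ^ (1 / 2 ^ q : ℝ) < b + 1 := by
  have h0 : (0 : ℝ) < 1 / 2 ^ q := by positivity
  have h1 : (n : ℝ) < ((b : ℝ) + 1) ^ 2 ^ q := by exact_mod_cast h
  calc (n : ℝ) ^ (1 / 2 ^ q : ℝ) < (((b : ℝ) + 1) ^ 2 ^ q) ^ (1 / 2 ^ q : ℝ) :=
        Real.rpow_lt_rpow (by positivity) h1 h0
    _ = b + 1 := by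
        have : ((1 : ℝ) / 2 ^ q) = ((2 ^ q : ℕ) : ℝ)⁻¹ := by push_cast; rw [one_div]
        rw [this, Real.pow_rpow_inv_natCast (by positivity) (by positivity)]

theorem rpow_one_sub_mul {n : ℕ} (hn : 1 ≤ n) (ε : ℝ) : (n : ℝ) ^ (1 - ε) * (n : ℝ) ^ ε = n := by
  rw [← Real.rpow_add (by exact_mod_cast hn)]
  simp

theorem one_le_rpow_one_sub {n : ℕ} (hn : 1 ≤ n) (q : ℕ) :
    1 ≤ (n : ℝ) ^ (1 - 1 / 2 ^ q : ℝ) := by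
  refine Real.one_le_rpow (by exact_mod_cast hn) ?_
  rw [sub_nonneg, div_le_one (by positivity)]
  exact one_le_pow₀ (by norm_num)

/-- Rounding the root down costs a factor 2, since `n ^ (1 / 2 ^ q) < b + 1 ≤ 2 * b`. Rounding the
quotient up adds 1, which is at most `2 ^ q * n ^ (1 - 1 / 2 ^ q)`; hence 3. -/
theorem baseCount_le {n m b q : ℕ} (hn : 1 ≤ n) (hb : 1 ≤ b) (hnb : n < (b + 1) ^ 2 ^ q)
    (hmb : (m - 1) * b < 2 ^ q * n) :
    (m : ℝ) ≤ 3 * (2 ^ q * (n : ℝ) ^ (1 - 1 / 2 ^ q : ℝ)) := by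
  have hroot := root_lt_of_lt_pow hnb
  set R := (n : ℝ) ^ (1 / 2 ^ q : ℝ) with hR
  set S := (n : ℝ) ^ (1 - 1 / 2 ^ q : ℝ) with hS
  have hSR : S * R = n := rpow_one_sub_mul hn _
  have hS1 : 1 ≤ S := one_le_rpow_one_sub hn q
  have h2 : (1 : ℝ) ≤ 2 ^ q := one_le_pow₀ (by norm_num)
  have hb' : (1 : ℝ) ≤ b := by exact_mod_cast hb
  have hmb' : ((m - 1 : ℕ) : ℝ) * b < 2 ^ q * (S * R) := by
    rw [hSR]
    exact_mod_cast hmb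
  have hm1 : ((m - 1 : ℕ) : ℝ) ≤ 2 * (2 ^ q * S) := by
    by_contra hlt
    push Not at hlt
    have h3 : 2 ^ q * (S * R) ≤ 2 ^ q * (S * (2 * b)) := by
      gcongr
      linarith
    have h4 : 2 * (2 ^ q * S) * b < ((m - 1 : ℕ) : ℝ) * b := by gcongr
    linarith
  have hm : (m : ℝ) ≤ ((m - 1 : ℕ) : ℝ) + 1 := by
    have : m ≤ m - 1 + 1 := by omega
    exact_mod_cast this
  have : 1 ≤ 2 ^ q * S := one_le_mul_of_one_le_of_one_le h2 hS1
  linarith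

/-- The part `m * 2 * e` contributes 12, as `e ≤ 2 * L`, and the part `m * q` contributes 3. -/
theorem digitCount_le {n m b e q : ℕ} (hn : 2 ≤ n) (hmn : m ≤ n) (hb : 1 ≤ b)
    (hnb : n < (b + 1) ^ 2 ^ q) (hmb : (m - 1) * b < 2 ^ q * n) (hen : 2 ^ (e - 1) < n) :
    ((m * (q + 2 * e) : ℕ) : ℝ) ≤
      15 * (2 ^ q * (n : ℝ) ^ (1 - 1 / 2 ^ q : ℝ) * Real.logb 2 n) := by
  have hm := baseCount_le (by omega) hb hnb hmb
  have hSR : (n : ℝ) ^ (1 - 1 / 2 ^ q : ℝ) * (n : ℝ) ^ (1 / 2 ^ q : ℝ) = n :=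
    rpow_one_sub_mul (by omega) _
  have hS1 := one_le_rpow_one_sub (n := n) (by omega) q
  set S := (n : ℝ) ^ (1 - 1 / 2 ^ q : ℝ) with hS
  set L := Real.logb 2 n with hL
  have hL1 : 1 ≤ L := by
    rw [hL, Real.le_logb_iff_rpow_le (by norm_num) (by positivity), Real.rpow_one]
    exact_mod_cast hn
  have he : (e : ℝ) ≤ 2 * L := by
    have h1 : ((e - 1 : ℕ) : ℝ) ≤ L := by
      rw [hL, Real.le_logb_iff_rpow_le (by norm_num) (by positivity), Real.rpow_natCast]
      exact_mod_cast hen.le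
    have h2 : (e : ℝ) ≤ ((e - 1 : ℕ) : ℝ) + 1 := by
      have : e ≤ e - 1 + 1 := by omega
      exact_mod_cast this
    linarith
  have h2q : (1 : ℝ) ≤ 2 ^ q := one_le_pow₀ (by norm_num)
  have hme : (m : ℝ) * e ≤ 3 * (2 ^ q * S) * (2 * L) :=
    mul_le_mul hm he (by positivity) (by positivity)
  have hmq : (m : ℝ) * q ≤ 3 * (2 ^ q * S) * L := by
    rcases le_total (q : ℝ) L with h | h
    · exact mul_le_mul hm h (by positivity) (by positivity)
    -- Here `q` exceeds `log n`, so it cannot be absorbed by the logarithm. But then `n ^ (1 / 2 ^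
    -- q) ≤ 2`, so `2 * n ^ (1 - 1 / 2 ^ q)` is at least `n`, and the crude bounds `m ≤ n` and `q ≤
    -- 2 ^ q` suffice.
    · have hn2q : (n : ℝ) ≤ 2 ^ q := by
        rw [hL, Real.logb_le_iff_le_rpow (by norm_num) (by positivity), Real.rpow_natCast] at h
        exact h
      have hq2 : q ≤ 2 ^ q := Nat.lt_two_pow_self.le
      have hR : (n : ℝ) ^ (1 / 2 ^ q : ℝ) ≤ 2 := by
        calc (n : ℝ) ^ (1 / 2 ^ q : ℝ) ≤ ((2 : ℝ) ^ 2 ^ q) ^ (1 / 2 ^ q : ℝ) := by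
              refine Real.rpow_le_rpow (by positivity) (hn2q.trans ?_) (by positivity)
              exact pow_le_pow_right₀ (by norm_num) hq2
          _ = 2 := by
              have : ((1 : ℝ) / 2 ^ q) = ((2 ^ q : ℕ) : ℝ)⁻¹ := by push_cast; rw [one_div]
              rw [this, Real.pow_rpow_inv_natCast (by positivity) (by positivity)]
      calc (m : ℝ) * q ≤ n * 2 ^ q := by
            refine mul_le_mul (by exact_mod_cast hmn) (by exact_mod_cast hq2) (by positivity)
              (by positivity)
        _ = S * (n : ℝ) ^ (1 / 2 ^ q : ℝ) * 2 ^ q := by rw [hSR]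
        _ ≤ S * 2 * 2 ^ q := by gcongr
        _ ≤ 3 * (2 ^ q * S) * 1 := by
            have : 0 ≤ 2 ^ q * S := by positivity
            linarith
        _ ≤ 3 * (2 ^ q * S) * L := by gcongr
  push_cast
  linarith

/-- As `n * c * k ≥ 2`, the factor 8 is absorbed by a fourth power. The exponent is multiplied by `4
* 4 * 7 = 112`, and `112 * 15 = 1680`. -/
theorem natCast_le_timeBound {n c k m b e t : ℕ} (hn : 2 ≤ n) (hc : 1 ≤ c) (hk : 1 ≤ k)
    (hmn : m ≤ n) (hb : 1 ≤ b) (hnb : n < (b + 1) ^ 2 ^ (c - 1))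
    (hmb : (m - 1) * b < 2 ^ (c - 1) * n) (hen : 2 ^ (e - 1) < n)
    (ht : t ≤ (((8 * (n * c * k)) ^ 4) ^ (m * (c - 1 + 2 * e))) ^ 7) :
    (t : ℝ) ≤ timeBound 1680 n c k := by
  have hN : 2 ≤ n * c * k := by
    rw [mul_assoc]
    exact hn.trans (Nat.le_mul_of_pos_right n (Nat.mul_pos hc hk))
  have hN8 : 8 * (n * c * k) ≤ (n * c * k) ^ 4 := by
    rw [pow_succ]
    exact Nat.mul_le_mul_right _ (Nat.pow_le_pow_left hN 3)
  have hdig := digitCount_le hn hmn hb hnb hmb hen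
  have ht' : t ≤ (n * c * k) ^ (112 * (m * (c - 1 + 2 * e))) := by
    refine ht.trans ((Nat.pow_le_pow_left (Nat.pow_le_pow_left
      (Nat.pow_le_pow_left hN8 _) _) _).trans ?_)
    rw [← pow_mul, ← pow_mul, ← pow_mul]
    exact Nat.pow_le_pow_right (by omega) (by ring_nf; omega)
  have hN1 : (1 : ℝ) ≤ (n : ℝ) * c * k := by exact_mod_cast one_le_two.trans hN
  calc (t : ℝ) ≤ ((n : ℝ) * c * k) ^ (112 * (m * (c - 1 + 2 * e))) := by exact_mod_cast ht'
    _ = ((n : ℝ) * c * k) ^ (112 * ((m * (c - 1 + 2 * e) : ℕ) : ℝ)) := by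
        rw [← Real.rpow_natCast]
        congr 1
        push_cast
        ring
    _ ≤ timeBound 1680 n c k := by
        refine Real.rpow_le_rpow_of_exponent_le hN1 ?_
        linarith

/-- For fixed `c` and `k n ≤ n ^ a`, the logarithm of the base is `O(log n)`, so the whole is `O(n ^
(1 - ε) * (log n) ^ 2)`, and `(log n) ^ 2 = o(n ^ ε)`. -/
theorem log_timeBound_isLittleO (K : ℝ) {c : ℕ} (hc : 1 ≤ c) (a : ℕ) (k : ℕ → ℕ)
    (hk : ∀ n, 2 ≤ n → 1 ≤ k n ∧ k n ≤ n ^ a) :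
    (fun n : ℕ => Real.log (timeBound K n c (k n))) =o[Filter.atTop] (fun n : ℕ => (n : ℝ)) := by
  set ε : ℝ := 1 / 2 ^ (c - 1) with hε
  have hε0 : 0 < ε := by positivity
  have hlog : (fun n : ℕ => Real.log n ^ (2 : ℝ)) =o[Filter.atTop] fun n : ℕ => (n : ℝ) ^ ε :=
    (isLittleO_log_rpow_rpow_atTop 2 hε0).comp_tendsto tendsto_natCast_atTop_atTop
  have hmul : (fun n : ℕ => (n : ℝ) ^ (1 - ε) * Real.log n ^ (2 : ℝ)) =o[Filter.atTop]
      fun n : ℕ => (n : ℝ) := by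
    refine ((Asymptotics.isBigO_refl (fun n : ℕ => (n : ℝ) ^ (1 - ε)) _).mul_isLittleO hlog).congr'
      Filter.EventuallyEq.rfl ?_
    filter_upwards [Filter.eventually_ge_atTop 1] with n hn
    exact rpow_one_sub_mul hn ε
  refine Asymptotics.IsBigO.trans_isLittleO (Asymptotics.IsBigO.of_bound
    (|K| * 2 ^ (c - 1) / Real.log 2 * (c + a + 1)) ?_) hmul
  filter_upwards [Filter.eventually_ge_atTop 3] with n hn
  obtain ⟨hk1, hka⟩ := hk n (by omega)
  have hn0 : (0 : ℝ) < n := by positivity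
  have hc0 : (0 : ℝ) < c := by exact_mod_cast hc
  have hk0 : (0 : ℝ) < k n := by exact_mod_cast hk1
  have hl2 : 0 < Real.log 2 := Real.log_pos (by norm_num)
  have hln : 1 ≤ Real.log n := by
    rw [Real.le_log_iff_exp_le hn0]
    exact Real.exp_one_lt_three.le.trans (by exact_mod_cast hn)
  have hlogle : Real.log (n * c * k n) ≤ (c + a + 1) * Real.log n := by
    rw [Real.log_mul (by positivity) hk0.ne', Real.log_mul hn0.ne' hc0.ne']
    have h1 : Real.log c ≤ c * Real.log n :=
      (Real.log_le_self hc0.le).trans (le_mul_of_one_le_right hc0.le hln)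
    have h2 : Real.log (k n) ≤ a * Real.log n := by
      rw [← Real.log_pow]
      exact Real.log_le_log hk0 (by exact_mod_cast hka)
    linarith
  have hlog0 : 0 ≤ Real.log (n * c * k n) := by
    refine Real.log_nonneg ?_
    exact_mod_cast Nat.mul_pos (Nat.mul_pos (by omega) hc) hk1
  rw [timeBound, Real.log_rpow (by positivity), Real.logb, Real.rpow_two, Real.norm_eq_abs,
    Real.norm_eq_abs, ← hε]
  have hS : 0 ≤ (n : ℝ) ^ (1 - ε) := by positivity
  rw [abs_mul, abs_mul, abs_mul, abs_mul, abs_mul, abs_of_nonneg hS, abs_of_nonneg hlog0,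
    abs_of_nonneg (by positivity : (0 : ℝ) ≤ 2 ^ (c - 1)),
    abs_of_nonneg (by positivity : 0 ≤ Real.log n / Real.log 2),
    abs_of_nonneg (by positivity : 0 ≤ Real.log n ^ 2)]
  calc |K| * 2 ^ (c - 1) * (n : ℝ) ^ (1 - ε) * (Real.log n / Real.log 2) *
        Real.log (n * c * k n) ≤ |K| * 2 ^ (c - 1) * (n : ℝ) ^ (1 - ε) *
        (Real.log n / Real.log 2) * ((c + a + 1) * Real.log n) := by gcongr
    _ = _ := by
      field_simp

end RunningTime

theorem theorem2 :
    ∃ (P : Prog) (K : ℝ), 0 < K ∧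
      -- one program `P` tests the sums of `c` set-multilinear circuits for zero in the stated time
      (∀ (F : Type*) [Field F] (n c k : ℕ), 2 ≤ n → 1 ≤ c → 1 ≤ k →
        ∀ C : Fin c → Depth3Circuit F n k, (∀ s, (C s).IsSetMultilinear) →
          ∃ (t : ℕ) (τ : Memory F), Run P (inputMemory C) t τ ∧
            (t : ℝ) ≤ timeBound K n c k ∧
            (τ.output = 1 ∨ τ.output = 0) ∧
            (τ.output = 1 ↔ ∑ s, (C s).poly ≠ 0)) ∧
      -- for constant `c` and polynomially bounded `k` the time is subexponential, `2 ^ o(n)`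
      (∀ c : ℕ, 1 ≤ c → ∀ (a : ℕ) (k : ℕ → ℕ), (∀ n, 2 ≤ n → 1 ≤ k n ∧ k n ≤ n ^ a) →
        (fun n : ℕ => Real.log (timeBound K n c (k n))) =o[Filter.atTop]
          (fun n : ℕ => (n : ℝ))) := by
  refine ⟨zeroTestProg, 1680, by norm_num, fun F _ n c k hn hc hk C hC => ?_,
    fun c hc a k hk => log_timeBound_isLittleO 1680 hc a k hk⟩
  obtain ⟨t, τ, m, b, e, hrun, -, hmn, hb, hnb, hmb, -, hen, ht, hout, hiff⟩ :=
    zeroTestProg_ends C hn hc hk hC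
  exact ⟨t, τ, hrun, natCast_le_timeBound hn hc hk hmn hb hnb hmb hen ht, hout, hiff⟩
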